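/- Setting. Let $X=(X_t)_{t\ge 0}$ be a right-continuous Markov chain with left limits on a probability space $(\Omega,\mathcal F,P)$, whose states are the unit vectors $e_1,\dots,e_N$ of $\mathbb R^N$ and whose (deterministic, measurable, bounded) rate matrix is $A=(A_t)_{t\ge0}$: off-diagonal entries of $A_t$ are nonnegative, its columns sum to $0$, and $E[X_t\mid\mathcal F_s]=\Phi(s,t)X_s$ for $s\le t$, where $\Phi(s,t)=I+\int_s^tA_u\Phi(s,u)\,du$. Here $(\mathcal F_t)$ is the completed natural filtration of $X$. Let $M_t=X_t-X_0-\int_0^tA_sX_s\,ds$ be the martingale part of $X$. Put $\Psi_t=\mathrm{diag}(A_tX_{t-})-\mathrm{diag}(X_{t-})A_t'-A_t\,\mathrm{diag}(X_{t-})$ and $\|C\|_{X_t}^2=C'\Psi_tC$ for $C\in\mathbb R^N$ (with $X_{0-}=X_0$). Let $T\ge 0$ and $c',c''\ge0$, and put $c=\max\{c',c''\}$. Let $f:\Omega\times[0,T]\times\mathbb R\times\mathbb R^N\to\mathbb R$ be measurable with respect to the product of the predictable and the Borel $\sigma$-algebras, with $E\int_0^T|f(t,0,0)|^2dt<\infty$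 and, almost surely, $$|f(t,y_1,z_1)-f(t,y_2,z_2)|\le c'|y_1-y_2|+c''\|z_1-z_2\|_{X_t}\qquad\text{for all } t\in[0,T],\ y_1,y_2\in\mathbb R,\ z_1,z_2\in\mathbb R^N.$$ For $i=1,2$ let $\xi_i$ be a real $\mathcal F_T$-measurable random variable with $E|\xi_i|^2<\infty$, and let $\varphi^{(i)}$ be a real predictable process on $[0,T]$ with $E\int_0^T|\varphi^{(i)}_t|^2dt<\infty$. Let $(Y^{(i)},Z^{(i)})$ be a solution of the BSDE $$Y^{(i)}_t=\xi_i+\int_t^T\big(f(s,Y^{(i)}_s,Z^{(i)}_s)+\varphi^{(i)}_s\big)ds-\int_t^T(Z^{(i)}_s)'dM_s,\qquad t\in[0,T],$$ where $Y^{(i)}$ is real, adapted and right-continuous with left limits, with $E\int_0^T|Y^{(i)}_t|^2dt<\infty$, and $Z^{(i)}$ is $\mathbb R^N$-valued and predictable, with $E\int_0^T\|Z^{(i)}_t\|_{X_t}^2dt<\infty$. Set $(y,z)=(Y^{(1)}-Y^{(2)},Z^{(1)}-Z^{(2)})$. Proposition. There is a constant $\bar C'>0$ depending only on $c$ and $T$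 such that $$E\Big[\sup_{t\in[0,T]}|y_t|^2+\int_0^T\|z_t\|_{X_t}^2dt\Big]\le\bar C'\,E\Big[|\xi_1-\xi_2|^2+\Big(\int_0^T|\varphi^{(1)}_t-\varphi^{(2)}_t|\,dt\Big)^2\Big].$$ -/

import Mathlib

open MeasureTheory Set Filter Topology
open scoped NNReal ENNReal Matrix

noncomputable section

namespace MarkovBSDE

/-- Lebesgue measure `dt` on the time axis `[0,∞)`. -/
def leb : Measure ℝ≥0 := Measure.comap (fun t : ℝ≥0 => (t : ℝ)) volume

/-- `A` is a bounded (measurable, time dependent) rate matrix, with the convention `dX = A X dt + dM`: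
the entry `A t j i` is the rate of jumping from state `i` to state `j ≠ i` at time `t`,
so off-diagonal entries are nonnegative and every column sums to zero. -/
structure IsRateMatrix {N : ℕ} (A : ℝ≥0 → Matrix (Fin N) (Fin N) ℝ) : Prop where
  measurable : ∀ i j, Measurable fun t => A t i j
  offDiag_nonneg : ∀ t i j, i ≠ j → 0 ≤ A t i j
  col_sum : ∀ t j, ∑ i, A t i j = 0
  bounded : ∃ m : ℝ, ∀ t i j, |A t i j| ≤ m

/-- `Φ s t`, `s ≤ t`, is the transition matrix generated by the rate matrix `A`: the continuous
solution of the Kolmogorov forward equation `∂Φ(s,t)/∂t = A_t Φ(s,t)`, `Φ(s,s) = I`,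
written in integrated form. -/
structure IsTransitionMatrix {N : ℕ} (A : ℝ≥0 → Matrix (Fin N) (Fin N) ℝ)
    (Φ : ℝ≥0 → ℝ≥0 → Matrix (Fin N) (Fin N) ℝ) : Prop where
  continuousOn : ∀ s, ContinuousOn (Φ s) (Ici s)
  forward : ∀ s t, s ≤ t → ∀ i j,
    Φ s t i j = (1 : Matrix (Fin N) (Fin N) ℝ) i j + ∫ u in Ioc s t, (A u * Φ s u) i j ∂leb

/-- The path `x` is right continuous with left limits on `[0,T]`. -/
def IsRCLLOn {E : Type*} [TopologicalSpace E] (T : ℝ≥0) (x : ℝ≥0 → E) : Prop :=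
  (∀ t < T, ContinuousWithinAt x (Ici t) t) ∧ ∀ t ≤ T, ∃ l, Tendsto x (𝓝[<] t) (𝓝 l)

section Model

variable {Ω : Type*} [MeasurableSpace Ω] {N : ℕ}

/-- The completed natural filtration of `X`: `ℱ_t` is generated by `X_s`, `0 ≤ s ≤ t`, and the
`P`-null sets. -/
def completedFiltration (P : Measure Ω) (X : ℝ≥0 → Ω → Fin N → ℝ) (hX : ∀ t, Measurable (X t)) :
    Filtration ℝ≥0 (inferInstance : MeasurableSpace Ω) where
  seq t := (⨆ s ∈ Iic t, MeasurableSpace.comap (X s) inferInstance) ⊔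
    MeasurableSpace.generateFrom {B | MeasurableSet B ∧ P B = 0}
  mono' _ _ hst := sup_le_sup_right (biSup_mono fun _ hr => le_trans hr hst) _
  le' _ := sup_le (iSup₂_le fun s _ => (hX s).comap_le)
    (MeasurableSpace.generateFrom_le fun _ hB => hB.1)

/-- `X` is a right continuous Markov chain with left limits, whose states are the unit vectors
`e_1, …, e_N` of `ℝ^N` and whose rate matrix is `A`. The Markov property relative to the completed
natural filtration reads `E[X_t | ℱ_s] = Φ(s,t) X_s`, that is,
`P(X_t = e_j | ℱ_s) = Φ(s,t)_{ji}` on `{X_s = e_i}`, where `Φ` is the transition matrix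
generated by `A`. -/
structure IsMarkovChain (P : Measure Ω) (A : ℝ≥0 → Matrix (Fin N) (Fin N) ℝ)
    (X : ℝ≥0 → Ω → Fin N → ℝ) (hX : ∀ t, Measurable (X t)) : Prop where
  unit_vector : ∀ t ω, ∃ i : Fin N, X t ω = Pi.single i 1
  rcll : ∀ ω T, IsRCLLOn T fun t => X t ω
  markov : ∃ Φ, IsTransitionMatrix A Φ ∧ ∀ s t, s ≤ t → ∀ j,
    P[(fun ω => X t ω j) | completedFiltration P X hX s] =ᵐ[P] fun ω => (Φ s t *ᵥ X s ω) j

/-- The left limit `X_{t-}` (with `X_{0-} = X_0`). -/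
def leftX (X : ℝ≥0 → Ω → Fin N → ℝ) (t : ℝ≥0) (ω : Ω) : Fin N → ℝ :=
  Function.leftLim (fun s => X s ω) t

/-- `Ψ_t = diag(A_t X_{t-}) - diag(X_{t-}) A_t' - A_t diag(X_{t-})`, the density of `⟨X,X⟩`. -/
def Psi (A : ℝ≥0 → Matrix (Fin N) (Fin N) ℝ) (X : ℝ≥0 → Ω → Fin N → ℝ) (t : ℝ≥0) (ω : Ω) :
    Matrix (Fin N) (Fin N) ℝ :=
  Matrix.diagonal (A t *ᵥ leftX X t ω) - Matrix.diagonal (leftX X t ω) * (A t)ᵀ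
    - A t * Matrix.diagonal (leftX X t ω)

/-- The squared seminorm `‖C‖²_{X_t} = C' Ψ_t C`. -/
def xNormSq (A : ℝ≥0 → Matrix (Fin N) (Fin N) ℝ) (X : ℝ≥0 → Ω → Fin N → ℝ) (t : ℝ≥0) (ω : Ω)
    (C : Fin N → ℝ) : ℝ :=
  C ⬝ᵥ (Psi A X t ω *ᵥ C)

/-- The seminorm `‖C‖_{X_t}`. -/
def xNorm (A : ℝ≥0 → Matrix (Fin N) (Fin N) ℝ) (X : ℝ≥0 → Ω → Fin N → ℝ) (t : ℝ≥0) (ω : Ω)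
    (C : Fin N → ℝ) : ℝ :=
  √(xNormSq A X t ω C)

/-- The stochastic integral `∫_{(s,t]} Z_u' dM_u` against the martingale
`M_t = X_t - X_0 - ∫_0^t A_u X_u du`. The paths of `M` have finite variation: `X` is piecewise
constant with finitely many jumps in `(s,t]`, and `dM = dX - A X du`. For a predictable `Z` with
`E ∫ ‖Z_u‖²_{X_u} du < ∞` (so that `∫ |Z_u' A_u X_u| du < ∞` almost surely) the stochastic integral
is therefore the pathwise Stieltjes integral: the sum of `Z_u' ΔX_u` over the jump times `u ∈ (s,t]`
minus the Lebesgue integral of `Z_u' A_u X_u`. -/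
def stochInt (A : ℝ≥0 → Matrix (Fin N) (Fin N) ℝ) (X : ℝ≥0 → Ω → Fin N → ℝ)
    (Z : ℝ≥0 → Ω → Fin N → ℝ) (s t : ℝ≥0) (ω : Ω) : ℝ :=
  (∑ᶠ u ∈ Ioc s t, Z u ω ⬝ᵥ (X u ω - leftX X u ω))
    - ∫ u in Ioc s t, Z u ω ⬝ᵥ (A u *ᵥ X u ω) ∂leb

/-- `u`, seen as a process on `[0,T]`, is predictable. -/
def IsPredictableOn {E : Type*} [Zero E] [MeasurableSpace E]
    (ℱ : Filtration ℝ≥0 (inferInstance : MeasurableSpace Ω)) (T : ℝ≥0) (u : ℝ≥0 → Ω → E) : Prop :=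
  Measurable[ℱ.predictable] ((Icc (0 : ℝ≥0) T ×ˢ (univ : Set Ω)).indicator fun p => u p.1 p.2)

/-- `ξ ∈ L²(ℱ_T)`. -/
structure MemL2Terminal (P : Measure Ω) (ℱ : Filtration ℝ≥0 (inferInstance : MeasurableSpace Ω))
    (T : ℝ≥0) (ξ : Ω → ℝ) : Prop where
  measurable : Measurable[ℱ T] ξ
  sq_integrable : ∫⁻ ω, ‖ξ ω‖ₑ ^ 2 ∂P < ∞

/-- `Y ∈ L²_ℱ(0,T;ℝ)`: adapted, right continuous with left limits, `E ∫_0^T |Y_t|² dt < ∞`. -/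
structure MemL2Adapted (P : Measure Ω) (ℱ : Filtration ℝ≥0 (inferInstance : MeasurableSpace Ω))
    (T : ℝ≥0) (Y : ℝ≥0 → Ω → ℝ) : Prop where
  adapted : ∀ t ≤ T, Measurable[ℱ t] (Y t)
  rcll : ∀ ω, IsRCLLOn T fun t => Y t ω
  sq_integrable : ∫⁻ ω, (∫⁻ t in Icc 0 T, ‖Y t ω‖ₑ ^ 2 ∂leb) ∂P < ∞

/-- `Z ∈ P²_ℱ(0,T;ℝ^N)`: predictable with `E ∫_0^T ‖Z_t‖²_{X_t} dt < ∞`. -/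
structure MemP2 (P : Measure Ω) (ℱ : Filtration ℝ≥0 (inferInstance : MeasurableSpace Ω))
    (A : ℝ≥0 → Matrix (Fin N) (Fin N) ℝ) (X : ℝ≥0 → Ω → Fin N → ℝ)
    (T : ℝ≥0) (Z : ℝ≥0 → Ω → Fin N → ℝ) : Prop where
  predictable : IsPredictableOn ℱ T Z
  sq_integrable : ∫⁻ ω, (∫⁻ t in Icc 0 T, ENNReal.ofReal (xNormSq A X t ω (Z t ω)) ∂leb) ∂P < ∞

/-- A perturbation: a predictable process `φ` on `[0,T]` with `E ∫_0^T |φ_t|² dt < ∞`. -/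
structure IsPerturbation (P : Measure Ω) (ℱ : Filtration ℝ≥0 (inferInstance : MeasurableSpace Ω))
    (T : ℝ≥0) (φ : ℝ≥0 → Ω → ℝ) : Prop where
  predictable : IsPredictableOn ℱ T φ
  sq_integrable : ∫⁻ ω, (∫⁻ t in Icc 0 T, ‖φ t ω‖ₑ ^ 2 ∂leb) ∂P < ∞

/-- A driver `f` on `[0,T]` with Lipschitz constants `c', c''`: measurable for the product of the
predictable and the Borel `σ`-algebras, Lipschitz in `(y,z)` with respect to `|·|` and `‖·‖_{X_t}`,
and with `E ∫_0^T |f(t,0,0)|² dt < ∞`. -/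
structure IsLipschitzDriver (P : Measure Ω)
    (ℱ : Filtration ℝ≥0 (inferInstance : MeasurableSpace Ω))
    (A : ℝ≥0 → Matrix (Fin N) (Fin N) ℝ) (X : ℝ≥0 → Ω → Fin N → ℝ) (T : ℝ≥0) (c' c'' : ℝ)
    (f : ℝ≥0 → Ω → ℝ → (Fin N → ℝ) → ℝ) : Prop where
  measurable : Measurable[ℱ.predictable.prod (inferInstance : MeasurableSpace (ℝ × (Fin N → ℝ)))]
    (((Icc (0 : ℝ≥0) T ×ˢ (univ : Set Ω)) ×ˢ (univ : Set (ℝ × (Fin N → ℝ)))).indicator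
      fun p => f p.1.1 p.1.2 p.2.1 p.2.2)
  lipschitz : ∀ᵐ ω ∂P, ∀ t ≤ T, ∀ y₁ y₂ z₁ z₂,
    |f t ω y₁ z₁ - f t ω y₂ z₂| ≤ c' * |y₁ - y₂| + c'' * xNorm A X t ω (z₁ - z₂)
  sq_integrable : ∫⁻ ω, (∫⁻ t in Icc 0 T, ‖f t ω 0 0‖ₑ ^ 2 ∂leb) ∂P < ∞

/-- `(Y,Z) ∈ L²_ℱ(0,T;ℝ) × P²_ℱ(0,T;ℝ^N)` solves the BSDE
`Y_t = ξ + ∫_t^T (f(s,Y_s,Z_s) + φ_s) ds - ∫_t^T Z_s' dM_s`, `t ∈ [0,T]`. -/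
structure IsBSDESolution (P : Measure Ω) (ℱ : Filtration ℝ≥0 (inferInstance : MeasurableSpace Ω))
    (A : ℝ≥0 → Matrix (Fin N) (Fin N) ℝ) (X : ℝ≥0 → Ω → Fin N → ℝ) (T : ℝ≥0)
    (f : ℝ≥0 → Ω → ℝ → (Fin N → ℝ) → ℝ) (φ : ℝ≥0 → Ω → ℝ) (ξ : Ω → ℝ)
    (Y : ℝ≥0 → Ω → ℝ) (Z : ℝ≥0 → Ω → Fin N → ℝ) : Prop where
  memY : MemL2Adapted P ℱ T Y
  memZ : MemP2 P ℱ A X T Z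
  equation : ∀ᵐ ω ∂P, ∀ t ≤ T,
    Y t ω = ξ ω + (∫ s in Ioc t T, (f s ω (Y s ω) (Z s ω) + φ s ω) ∂leb) - stochInt A X Z t T ω

end Model

end MarkovBSDE

end

namespace MarkovBSDE

/-! ### Lebesgue measure on the time axis -/

/-! The difference (y,z) of two solutions satisfies y_t = ξ + ∫_t^T h ds - ∫_t^T z' dM with |h| ≤
|ψ| + c|y| + c‖z‖, where ξ = ξ₁ - ξ₂ and ψ = φ⁽¹⁾ - φ⁽²⁾. The a priori estimate holds for every such
dominated equation (`IsDominatedBSDE.estimate`). Each single solution is itself dominated, with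
source |f(·,0,0)| + |φ|; this supplies the integrability needed to subtract the two equations
(`IsDominatedBSDE.sub`).

Write e = E|ξ|², q = E(∫|ψ|)², U = E∫y², W = E∫‖z‖², s = E sup|y|² and κ = 2E∫|y||ψ|. The energy
identity E y_t² + E∫_t^T ‖z‖² = e + 2E∫_t^T y_- h, Young's inequality and Gronwall bound U and W by
multiples of e + κ. Since y_t is the conditional expectation of ξ + ∫_t^T h, Doob's inequality
bounds s by e, q, U and W. Finally κ ≤ εs + ε⁻¹q, because |y| is at most its supremum; this is where
q enters with the square outside the time integral, and why the supremum must be estimated together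
with W. As s is finite, a small ε absorbs it (`closing_estimate`).

The stochastic calculus is elementary because the paths of X are step functions. The formula for y²
is a pathwise identity for an integral plus a finite sum (`sq_backward_path`). Expectations of sums
over jumps come from one compensation formula: the jumps into a state j, with rate (1 - X_-^j)(A
X_-)_j, have a compensator that agrees with the jump measure on the predictable σ-algebra
(`IsMarkovChain.trim_jumpKernel_eq`). It is deduced from the Kolmogorov equation by sampling on
grids and a π-system argument. Its integrability condition needs only y_- in L²(P ⊗ dt) and E∫‖z‖²
finite, so no localization is required. The left limit y_- is predictable and equals y for almost
every t. -/

theorem measurableEmbedding_nnreal_coe : MeasurableEmbedding (fun t : ℝ≥0 => (t : ℝ)) :=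
  NNReal.isClosedEmbedding_coe.measurableEmbedding

theorem leb_Ioc (s t : ℝ≥0) : leb (Ioc s t) = ENNReal.ofReal (t - s) := by
  rw [leb, measurableEmbedding_nnreal_coe.comap_apply]
  have : (fun t : ℝ≥0 => (t : ℝ)) '' Ioc s t = Ioc (s : ℝ) t := by
    ext x
    constructor
    · rintro ⟨u, ⟨h1, h2⟩, rfl⟩
      exact ⟨by exact_mod_cast h1, by exact_mod_cast h2⟩
    · rintro ⟨h1, h2⟩
      exact ⟨⟨x, s.2.trans h1.le⟩, ⟨h1, h2⟩, rfl⟩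
  rw [this, Real.volume_Ioc]

instance nullSingletonClass_leb : NullSingletonClass leb where
  measure_singleton t := by
    rw [leb, measurableEmbedding_nnreal_coe.comap_apply]
    simp

instance isFiniteMeasure_leb_Ioc (s t : ℝ≥0) : IsFiniteMeasure (leb.restrict (Ioc s t)) :=
  ⟨by simp [leb_Ioc]⟩

theorem leb_Icc (s t : ℝ≥0) : leb (Icc s t) = ENNReal.ofReal (t - s) := by
  rw [← leb_Ioc]; exact measure_congr Ioc_ae_eq_Icc.symm

instance sigmaFinite_leb : SigmaFinite leb := by
  refine ⟨⟨⟨fun n => Icc 0 (n : ℝ≥0), fun _ => trivial, fun n => by simp [leb_Icc], ?_⟩⟩⟩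
  refine iUnion_eq_univ_iff.2 fun x => ?_
  obtain ⟨n, hn⟩ := exists_nat_ge x
  exact ⟨n, zero_le, hn⟩

/-! ### Squares of integrals and of sums -/

/-- The square is an integral over a product, split into the two triangles u < v and v < u, which
Fubini identifies; the diagonal is null because μ has no atoms. This plays the role of the chain
rule for the absolutely continuous part of a path. -/
theorem sq_integral_eq {α : Type*} [MeasurableSpace α] [TopologicalSpace α] [LinearOrder α]
    [OrderClosedTopology α] [SecondCountableTopology α] [OpensMeasurableSpace α]
    {μ : Measure α} [SFinite μ] [NullSingletonClass μ] {k : α → ℝ} (hk : Integrable k μ) :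
    (∫ u, k u ∂μ) ^ 2 = 2 * ∫ u, k u * ∫ v in Ioi u, k v ∂μ ∂μ := by
  have hprod : Integrable (fun p : α × α => k p.1 * k p.2) (μ.prod μ) := hk.mul_prod hk
  have hs : MeasurableSet {p : α × α | p.1 < p.2} := measurableSet_lt measurable_fst measurable_snd
  have hs' : MeasurableSet {p : α × α | p.2 < p.1} := measurableSet_lt measurable_snd measurable_fst
  have hI1 := hprod.indicator hs
  have hI2 := hprod.indicator hs'
  have e1 : ∀ u v, ({p : α × α | p.1 < p.2}).indicator (fun p : α × α => k p.1 * k p.2) (u, v)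
      = (Ioi u).indicator (fun v => k u * k v) v := fun u v => rfl
  have e2 : ∀ u v, ({p : α × α | p.2 < p.1}).indicator (fun p : α × α => k p.1 * k p.2) (u, v)
      = (Iio u).indicator (fun v => k u * k v) v := fun u v => rfl
  have e3 : ∀ u v, ({p : α × α | p.2 < p.1}).indicator (fun p : α × α => k p.1 * k p.2) (u, v)
      = (Ioi v).indicator (fun u => k v * k u) u := fun u v => by
    simp [indicator_apply, mul_comm]
  have hswap : ∫ u, k u * ∫ v in Iio u, k v ∂μ ∂μ = ∫ u, k u * ∫ v in Ioi u, k v ∂μ ∂μ := by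
    have h1 := integral_integral_swap (f := fun u v =>
      ({p : α × α | p.2 < p.1}).indicator (fun p : α × α => k p.1 * k p.2) (u, v)) hI2
    simp_rw [e3] at h1
    simp_rw [integral_indicator measurableSet_Ioi, integral_const_mul] at h1
    rw [← h1]
    refine integral_congr_ae (ae_of_all _ fun u => ?_)
    simp only
    rw [← integral_const_mul, ← integral_indicator measurableSet_Iio]
    refine integral_congr_ae (ae_of_all _ fun v => ?_)
    rw [← e2, e3]
  have hi1 : Integrable (fun u => k u * ∫ v in Ioi u, k v ∂μ) μ := by
    refine hI1.integral_prod_left.congr (ae_of_all _ fun u => ?_)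
    simp_rw [e1]
    rw [integral_indicator measurableSet_Ioi, integral_const_mul]
  have hi2 : Integrable (fun u => k u * ∫ v in Iio u, k v ∂μ) μ := by
    refine hI2.integral_prod_left.congr (ae_of_all _ fun u => ?_)
    simp_rw [e2]
    rw [integral_indicator measurableSet_Iio, integral_const_mul]
  have hsplit : ∀ u, ∫ v, k v ∂μ = (∫ v in Ioi u, k v ∂μ) + ∫ v in Iio u, k v ∂μ := by
    intro u
    rw [← integral_add_compl (measurableSet_Ioi (a := u)) hk, compl_Ioi,
      setIntegral_congr_set Iio_ae_eq_Iic]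
  calc (∫ u, k u ∂μ) ^ 2 = ∫ u, k u * ∫ v, k v ∂μ ∂μ := by rw [integral_mul_const, sq]
    _ = ∫ u, (k u * (∫ v in Ioi u, k v ∂μ) + k u * ∫ v in Iio u, k v ∂μ) ∂μ := by
      refine integral_congr_ae (ae_of_all _ fun u => ?_)
      simp only
      rw [hsplit u, mul_add]
    _ = _ := by rw [integral_add hi1 hi2, hswap]; ring

/-- The discrete counterpart of `sq_integral_eq`. Here the diagonal survives, and it becomes the sum
of squared jumps in the energy identity. -/
theorem sq_sum_eq {α : Type*} [LinearOrder α] (S : Finset α) (a : α → ℝ) :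
    (∑ u ∈ S, a u) ^ 2 = 2 * ∑ u ∈ S, a u * ∑ v ∈ S with u < v, a v + ∑ u ∈ S, a u ^ 2 := by
  classical
  induction S using Finset.induction_on_min with
  | empty => simp
  | insert x S hx ih =>
    have hxS : x ∉ S := fun h => lt_irrefl _ (hx x h)
    rw [Finset.sum_insert hxS, Finset.sum_insert hxS, Finset.sum_insert hxS, add_sq, ih]
    have h1 : (insert x S).filter (fun v => x < v) = S := by
      ext v; simp only [Finset.mem_filter, Finset.mem_insert]
      constructor
      · rintro ⟨rfl | h, h'⟩
        · exact absurd h' (lt_irrefl _)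
        · exact h
      · exact fun h => ⟨Or.inr h, hx v h⟩
    have h2 : ∀ u ∈ S, (insert x S).filter (fun v => u < v) = S.filter (fun v => u < v) := by
      intro u hu
      rw [Finset.filter_insert, if_neg (not_lt.2 (hx u hu).le)]
    have h3 : ∑ u ∈ S, a u * ∑ v ∈ insert x S with u < v, a v
        = ∑ u ∈ S, a u * ∑ v ∈ S with u < v, a v :=
      Finset.sum_congr rfl fun u hu => by rw [h2 u hu]
    rw [h1, h3]
    ring

/-- Change of variables for the square of a backward finite variation path. -/
theorem sq_backward_path {T t : ℝ≥0} (htT : t ≤ T) {ξ : ℝ} {k a y : ℝ≥0 → ℝ} {S : Finset ℝ≥0}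
    (hS : ∀ u ∈ S, u ∈ Ioc 0 T) (hk : IntegrableOn k (Ioc 0 T) leb)
    (hy : ∀ s ≤ T, y s = ξ + (∫ u in Ioc s T, k u ∂leb) - ∑ u ∈ S with s < u, a u) :
    y t ^ 2 = ξ ^ 2 + 2 * (∫ u in Ioc t T, y u * k u ∂leb)
      - ∑ u ∈ S with t < u, (2 * a u * y u - a u ^ 2) := by
  have hkt : ∀ s, IntegrableOn k (Ioc s T) leb := fun s =>
    hk.mono_set (Ioc_subset_Ioc_left zero_le)
  set I : ℝ≥0 → ℝ := fun s => ∫ u in Ioc s T, k u ∂leb with hI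
  set B : ℝ≥0 → ℝ := fun s => ∑ u ∈ S with s < u, a u with hB
  set R := S.filter (fun u => t < u) with hR
  have hI2 : I t ^ 2 = 2 * ∫ u in Ioc t T, k u * I u ∂leb := by
    have := sq_integral_eq (μ := leb.restrict (Ioc t T)) (hkt t)
    change (∫ u in Ioc t T, k u ∂leb) ^ 2 = _
    rw [this]
    congr 1
    refine setIntegral_congr_fun measurableSet_Ioc fun u hu => ?_
    rw [Measure.restrict_restrict measurableSet_Ioi]
    congr 3
    ext v; simp only [mem_inter_iff, mem_Ioi, mem_Ioc]
    exact ⟨fun h => ⟨h.1, h.2.2⟩, fun h => ⟨h.1, hu.1.trans h.1, h.2⟩⟩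
  have hkI : IntegrableOn (fun u => k u * I u) (Ioc t T) leb := by
    have hc : AEStronglyMeasurable I (leb.restrict (Ioc t T)) := by
      -- Since `k` is only almost everywhere strongly measurable, joint measurability in (s,v) is
      -- obtained for its measurable representative.
      have : Measurable fun s : ℝ≥0 => ∫ v, (Ioc s T).indicator
          ((hk.1.mk k)) v ∂(leb.restrict (Ioc 0 T)) := by
        refine (StronglyMeasurable.integral_prod_right (f := fun s v => (Ioc s T).indicator
          ((hk.1.mk k)) v) ?_).measurable
        have hm : MeasurableSet {p : ℝ≥0 × ℝ≥0 | p.2 ∈ Ioc p.1 T} :=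
          (measurableSet_lt measurable_fst measurable_snd).inter
            (measurableSet_le (f := fun p : ℝ≥0 × ℝ≥0 => p.2) measurable_snd measurable_const)
        exact ((hk.1.stronglyMeasurable_mk.comp_measurable measurable_snd).indicator hm)
      refine this.aestronglyMeasurable.congr (ae_of_all _ fun s => ?_)
      simp only [hI]
      rw [integral_indicator measurableSet_Ioc, Measure.restrict_restrict measurableSet_Ioc,
        inter_eq_left.2 (Ioc_subset_Ioc_left zero_le)]
      refine integral_congr_ae ?_
      have hae : k =ᵐ[leb.restrict (Ioc s T)] hk.1.mk k :=
        ae_restrict_of_ae_restrict_of_subset (Ioc_subset_Ioc_left zero_le) hk.1.ae_eq_mk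
      exact hae.symm
    refine Integrable.mul_bdd (c := ∫ u in Ioc 0 T, ‖k u‖ ∂leb) (hkt t) hc
      (ae_of_all _ fun s => ?_)
    refine (norm_integral_le_integral_norm _).trans ?_
    exact setIntegral_mono_set hk.norm (ae_of_all _ fun _ => norm_nonneg _)
      (Ioc_subset_Ioc_left zero_le).eventuallyLE
  have hBk : ∀ u ∈ R, IntegrableOn (fun s => a u * (Iio u).indicator k s) (Ioc t T) leb :=
    fun u _ => ((hkt t).indicator measurableSet_Iio).const_mul _
  have hBeq : ∀ s ∈ Ioc t T, B s * k s = ∑ u ∈ R, a u * (Iio u).indicator k s := by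
    intro s hs
    rw [hB, hR]
    simp only
    rw [Finset.sum_mul, Finset.sum_filter, Finset.sum_filter]
    refine Finset.sum_congr rfl fun u hu => ?_
    by_cases h : s < u
    · simp [h, hs.1.trans h]
    · simp [h]
  -- Integration by parts between the step function B and the integral I, by exchanging a finite sum
  -- with an integral.
  have hBint : ∫ s in Ioc t T, B s * k s ∂leb = B t * I t - ∑ u ∈ R, a u * I u := by
    rw [setIntegral_congr_fun measurableSet_Ioc hBeq, integral_finsetSum _ hBk]
    rw [show B t = ∑ u ∈ R, a u from rfl, Finset.sum_mul, ← Finset.sum_sub_distrib]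
    refine Finset.sum_congr rfl fun u hu => ?_
    rw [integral_const_mul, integral_indicator measurableSet_Iio,
      Measure.restrict_restrict measurableSet_Iio, ← mul_sub]
    have huT := (hS u (Finset.mem_filter.1 hu).1).2
    have htu := (Finset.mem_filter.1 hu).2
    congr 1
    have e : I t = (∫ v in Ioc t u, k v ∂leb) + I u := by
      simp only [hI]
      rw [← setIntegral_union (Ioc_disjoint_Ioc_of_le le_rfl) measurableSet_Ioc
        ((hkt t).mono_set (Ioc_subset_Ioc_right huT)) (hkt u), Ioc_union_Ioc_eq_Ioc htu.le huT]
    rw [e, add_sub_cancel_right]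
    have e2 : Iio u ∩ Ioc t T = Ioo t u := by
      ext v; simp only [mem_inter_iff, mem_Iio, mem_Ioc, mem_Ioo]
      exact ⟨fun h => ⟨h.2.1, h.1⟩, fun h => ⟨h.2, h.1, h.2.le.trans huT⟩⟩
    rw [e2]
    exact setIntegral_congr_set Ioo_ae_eq_Ioc
  have hBki : IntegrableOn (fun s => B s * k s) (Ioc t T) leb :=
    (integrableOn_congr_fun hBeq measurableSet_Ioc).2 (integrable_finsetSum _ hBk)
  have hyk : ∫ u in Ioc t T, y u * k u ∂leb
      = ξ * I t + (∫ u in Ioc t T, k u * I u ∂leb) - (B t * I t - ∑ u ∈ R, a u * I u) := by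
    rw [← hBint]
    have : ∀ u ∈ Ioc t T, y u * k u = ξ * k u + k u * I u - B u * k u := by
      intro u hu
      rw [hy u hu.2]; simp only [hI, hB]; ring
    rw [setIntegral_congr_fun measurableSet_Ioc this,
      integral_sub (f := fun u => ξ * k u + k u * I u) (((hkt t).const_mul ξ).add hkI) hBki,
      integral_add ((hkt t).const_mul ξ) hkI, integral_const_mul]
  have hB2 : B t ^ 2 = 2 * ∑ u ∈ R, a u * B u + ∑ u ∈ R, a u ^ 2 := by
    have := sq_sum_eq R a
    rw [show B t = ∑ u ∈ R, a u from rfl, this]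
    congr 2
    refine Finset.sum_congr rfl fun u hu => ?_
    congr 1
    simp only [hB, hR, Finset.filter_filter]
    refine Finset.sum_congr ?_ fun _ _ => rfl
    ext v
    simp only [Finset.mem_filter]
    exact ⟨fun h => ⟨h.1, h.2.2⟩, fun h => ⟨h.1, (Finset.mem_filter.1 hu).2.trans h.2, h.2⟩⟩
  have hsum : ∑ u ∈ R, (2 * a u * y u - a u ^ 2)
      = 2 * ξ * B t + 2 * ∑ u ∈ R, a u * I u - 2 * ∑ u ∈ R, a u * B u - ∑ u ∈ R, a u ^ 2 := by
    rw [show B t = ∑ u ∈ R, a u from rfl, Finset.mul_sum, Finset.mul_sum, Finset.mul_sum,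
      ← Finset.sum_add_distrib, ← Finset.sum_sub_distrib, ← Finset.sum_sub_distrib]
    refine Finset.sum_congr rfl fun u hu => ?_
    rw [hy u (hS u (Finset.mem_filter.1 hu).1).2]
    simp only [hI, hB]; ring
  rw [hsum, hyk, hy t htT]
  -- After expansion the terms a_u I_u coming from the integral and from the sum cancel, and only
  -- the formulas for I² and B² remain to be used.
  change (ξ + I t - B t) ^ 2 = _
  linear_combination hI2 + hB2

/-! ### Step paths through unit vectors -/

section UnitPath

variable {N : ℕ} {x : ℝ≥0 → Fin N → ℝ}

/-- A finite subset of a T1 space is discrete, so convergence inside it is eventual equality. This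
turns right continuity with left limits into local constancy on each side of a time. -/
theorem eventually_eq_of_tendsto_of_finite {α E : Type*} [TopologicalSpace E] [T1Space E]
    {F : Set E} (hF : F.Finite) {f : α → E} (hf : ∀ a, f a ∈ F) {l : Filter α} {v : E}
    (h : Tendsto f l (𝓝 v)) : ∀ᶠ a in l, f a = v := by
  have : (F \ {v})ᶜ ∈ 𝓝 v := (hF.subset sdiff_subset).isClosed.isOpen_compl.mem_nhds (by simp)
  filter_upwards [h this] with a ha
  by_contra hne
  exact ha ⟨hf a, hne⟩

theorem finite_range_of_unit (hu : ∀ t, ∃ i : Fin N, x t = Pi.single i 1) :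
    (range x).Finite := by
  refine (finite_range fun i : Fin N => (Pi.single i 1 : Fin N → ℝ)).subset ?_
  rintro _ ⟨t, rfl⟩
  obtain ⟨i, hi⟩ := hu t
  exact ⟨i, hi.symm⟩

theorem eventually_right_eq (hF : (range x).Finite) (hr : ∀ T, IsRCLLOn T x) (t : ℝ≥0) :
    ∀ᶠ s in 𝓝[≥] t, x s = x t :=
  eventually_eq_of_tendsto_of_finite hF (fun a => mem_range_self a)
    ((hr (t + 1)).1 t (lt_add_one t))

theorem eventually_left_eq (hF : (range x).Finite) (hr : ∀ T, IsRCLLOn T x) (t : ℝ≥0) :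
    ∀ᶠ s in 𝓝[<] t, x s = Function.leftLim x t :=
  eventually_eq_of_tendsto_of_finite hF (fun a => mem_range_self a)
    (tendsto_leftLim_of_tendsto ((hr t).2 t le_rfl))

theorem leftLim_eq_of_eventually_nhds {y : ℝ≥0 → Fin N → ℝ} {t : ℝ≥0} {v : Fin N → ℝ}
    (h : ∀ᶠ s in 𝓝 t, y s = v) : Function.leftLim y t = y t := by
  refine ContinuousWithinAt.leftLim_eq (ContinuousAt.continuousWithinAt ?_)
  rw [ContinuousAt, h.self_of_nhds]
  exact tendsto_const_nhds.congr' (h.mono fun s hs => hs.symm)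

theorem eventually_nhds_of_open {s : Set ℝ≥0} (hs : IsOpen s) {t : ℝ≥0} {p : ℝ≥0 → Prop}
    (h : ∀ᶠ a in 𝓝[s] t, p a) : ∀ᶠ a in 𝓝[s] t, ∀ᶠ b in 𝓝 a, p b := by
  filter_upwards [eventually_eventually_nhdsWithin.2 h, self_mem_nhdsWithin] with a ha has
  rwa [hs.nhdsWithin_eq has] at ha

theorem eventually_gt_leftLim_eq (hF : (range x).Finite) (hr : ∀ T, IsRCLLOn T x) (t : ℝ≥0) :
    ∀ᶠ s in 𝓝[>] t, Function.leftLim x s = x s :=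
  (eventually_nhds_of_open isOpen_Ioi ((eventually_right_eq hF hr t).filter_mono
    (nhdsWithin_mono _ Ioi_subset_Ici_self))).mono fun _ h => leftLim_eq_of_eventually_nhds h

theorem eventually_lt_leftLim_eq (hF : (range x).Finite) (hr : ∀ T, IsRCLLOn T x) (t : ℝ≥0) :
    ∀ᶠ s in 𝓝[<] t, Function.leftLim x s = x s :=
  (eventually_nhds_of_open isOpen_Iio (eventually_left_eq hF hr t)).mono
    fun _ h => leftLim_eq_of_eventually_nhds h

/-- Every time has a punctured neighbourhood on which the path is continuous; compactness of `[0,T]`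
does the rest. -/
theorem finite_jumps (hF : (range x).Finite) (hr : ∀ T, IsRCLLOn T x) (T : ℝ≥0) :
    {u ∈ Icc 0 T | Function.leftLim x u ≠ x u}.Finite := by
  suffices h : ∀ K : Set ℝ≥0, IsCompact K → {u ∈ K | Function.leftLim x u ≠ x u}.Finite from
    h _ isCompact_Icc
  intro K hK
  refine hK.induction_on (p := fun K => {u ∈ K | Function.leftLim x u ≠ x u}.Finite)
    (by simp) (fun s t hst ht => ht.subset fun u hu => ⟨hst hu.1, hu.2⟩)
    (fun s t hs ht => (hs.union ht).subset ?_) fun u _ => ?_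
  · rintro u ⟨hu | hu, h⟩
    · exact Or.inl ⟨hu, h⟩
    · exact Or.inr ⟨hu, h⟩
  · have h1 := eventually_gt_leftLim_eq hF hr u
    have h2 := eventually_lt_leftLim_eq hF hr u
    have h3 : ∀ᶠ s in 𝓝[≠] u, Function.leftLim x s = x s := by
      rw [← Iio_union_Ioi, nhdsWithin_union]
      exact eventually_sup.2 ⟨h2, h1⟩
    rw [eventually_nhdsWithin_iff] at h3
    refine ⟨_, nhdsWithin_le_nhds h3, (finite_singleton u).subset ?_⟩
    rintro v ⟨hv, hne⟩
    by_contra hvu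
    exact hne (hv hvu)

/-- The jump times in `(0,T]` of a path. -/
noncomputable def jumps (x : ℝ≥0 → Fin N → ℝ) (T : ℝ≥0) : Finset ℝ≥0 := by
  classical
  -- The default value `∅` does not occur for the paths considered, by `finite_jumps`.
  exact if h : {u ∈ Icc 0 T | Function.leftLim x u ≠ x u}.Finite then h.toFinset else ∅

theorem leftLim_zero {E : Type*} [TopologicalSpace E] (x : ℝ≥0 → E) :
    Function.leftLim x 0 = x 0 :=
  leftLim_eq_of_isBot fun _ => zero_le

theorem mem_jumps (hF : (range x).Finite) (hr : ∀ T, IsRCLLOn T x) {T u : ℝ≥0} :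
    u ∈ jumps x T ↔ u ≤ T ∧ Function.leftLim x u ≠ x u := by
  rw [jumps, dif_pos (finite_jumps hF hr T)]
  simp [mem_Icc]

theorem pos_of_mem_jumps (hF : (range x).Finite) (hr : ∀ T, IsRCLLOn T x) {T u : ℝ≥0}
    (h : u ∈ jumps x T) : 0 < u := by
  refine pos_iff_ne_zero.2 ?_
  rintro rfl
  exact ((mem_jumps hF hr).1 h).2 (leftLim_zero x)

theorem jumps_filter_le (hF : (range x).Finite) (hr : ∀ T, IsRCLLOn T x) {s t : ℝ≥0}
    (hst : s ≤ t) : (jumps x t).filter (fun u => u ≤ s) = jumps x s := by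
  ext u
  simp only [Finset.mem_filter, mem_jumps hF hr]
  exact ⟨fun h => ⟨h.2, h.1.2⟩, fun h => ⟨⟨h.1.trans hst, h.2⟩, h.1⟩⟩

/-- Subtracting the accumulated jumps leaves a function that is locally constant from both sides,
hence constant on the connected half-line. -/
theorem sub_eq_sum_jumps_zero (hF : (range x).Finite) (hr : ∀ T, IsRCLLOn T x) (t : ℝ≥0) :
    x t - x 0 = ∑ u ∈ jumps x t, (x u - Function.leftLim x u) := by
  set D : ℝ≥0 → Fin N → ℝ := fun t => x t - ∑ u ∈ jumps x t, (x u - Function.leftLim x u) with hD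
  have hr' : ∀ t, ∀ᶠ s in 𝓝[≥] t, D s = D t := by
    intro t
    have h1 := eventually_gt_leftLim_eq hF hr t
    obtain ⟨b, hb, hsub⟩ := (mem_nhdsGT_iff_exists_Ioo_subset' (lt_add_one t)).1 h1
    filter_upwards [eventually_right_eq hF hr t, Ico_mem_nhdsGE hb] with s hs hsI
    simp only [hD, hs]
    congr 2
    ext u
    rw [mem_jumps hF hr, mem_jumps hF hr]
    constructor
    · rintro ⟨h, h'⟩
      refine ⟨?_, h'⟩
      by_contra hlt
      exact h' (hsub ⟨not_le.1 hlt, h.trans_lt hsI.2⟩)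
    · exact fun h => ⟨h.1.trans hsI.1, h.2⟩
  have hl' : ∀ t, ∀ᶠ s in 𝓝[<] t, D s = D t := by
    intro t
    rcases eq_or_ne t 0 with rfl | ht
    · simp
    have ht0 : 0 < t := pos_iff_ne_zero.2 ht
    have h1 := eventually_lt_leftLim_eq hF hr t
    obtain ⟨b, hb, hsub⟩ := (mem_nhdsLT_iff_exists_Ioo_subset' ht0).1 h1
    filter_upwards [eventually_left_eq hF hr t, Ioo_mem_nhdsLT hb] with s hs hsI
    -- Just before t no other jump is left, so the only change in the jump set between s and t is t
    -- itself.
    have e : jumps x s = (jumps x t).erase t := by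
      ext u
      rw [Finset.mem_erase, mem_jumps hF hr, mem_jumps hF hr]
      constructor
      · rintro ⟨h, h'⟩
        exact ⟨(h.trans_lt hsI.2).ne, h.trans hsI.2.le, h'⟩
      · rintro ⟨h, h', h''⟩
        refine ⟨?_, h''⟩
        by_contra hlt
        exact h'' (hsub ⟨hsI.1.trans (not_le.1 hlt), lt_of_le_of_ne h' h⟩)
    simp only [hD, hs, e]
    by_cases hj : t ∈ jumps x t
    · rw [← Finset.add_sum_erase _ _ hj]; abel
    · rw [Finset.erase_eq_of_notMem hj]
      have : Function.leftLim x t = x t := by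
        by_contra h; exact hj ((mem_jumps hF hr).2 ⟨le_rfl, h⟩)
      rw [this]
  have hloc : IsLocallyConstant D := by
    rw [IsLocallyConstant.iff_eventually_eq]
    intro t
    rw [← nhdsLT_sup_nhdsGE]
    exact eventually_sup.2 ⟨hl' t, hr' t⟩
  have h0 : jumps x 0 = ∅ := by
    refine Finset.eq_empty_of_forall_notMem fun u hu => ?_
    exact absurd ((mem_jumps hF hr).1 hu).1 (not_le.2 (pos_of_mem_jumps hF hr hu))
  have := hloc.apply_eq_of_preconnectedSpace t 0
  simp only [hD, h0, Finset.sum_empty, sub_zero] at this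
  rw [← this]; abel

theorem sub_eq_sum_jumps (hF : (range x).Finite) (hr : ∀ T, IsRCLLOn T x) {s t T : ℝ≥0}
    (hst : s ≤ t) (htT : t ≤ T) :
    x t - x s = ∑ u ∈ jumps x T with u ∈ Ioc s t, (x u - Function.leftLim x u) := by
  have h1 := sub_eq_sum_jumps_zero hF hr t
  have h2 := sub_eq_sum_jumps_zero hF hr s
  rw [← jumps_filter_le hF hr htT] at h1
  rw [← jumps_filter_le hF hr (hst.trans htT)] at h2
  have : (jumps x T).filter (fun u => u ≤ t)
      = (jumps x T).filter (fun u => u ∈ Ioc s t) ∪ (jumps x T).filter (fun u => u ≤ s) := by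
    ext u
    simp only [Finset.mem_union, Finset.mem_filter, mem_Ioc]
    constructor
    · rintro ⟨h, h'⟩
      rcases le_or_gt u s with hus | hus
      · exact Or.inr ⟨h, hus⟩
      · exact Or.inl ⟨h, hus, h'⟩
    · rintro (⟨h, _, h'⟩ | ⟨h, h'⟩)
      · exact ⟨h, h'⟩
      · exact ⟨h, h'.trans hst⟩
  rw [this, Finset.sum_union] at h1
  · rw [← h2] at h1
    rw [← sub_eq_iff_eq_add] at h1
    rw [← h1]; abel
  · rw [Finset.disjoint_left]
    intro u hu hu'
    simp only [Finset.mem_filter, mem_Ioc] at hu hu'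
    exact absurd hu'.2 (not_le.2 hu.2.1)

theorem exists_leftLim_eq_single (hu : ∀ t, ∃ i : Fin N, x t = Pi.single i 1)
    (hr : ∀ T, IsRCLLOn T x) (t : ℝ≥0) : ∃ i : Fin N, Function.leftLim x t = Pi.single i 1 := by
  rcases eq_or_ne t 0 with rfl | ht
  · rw [leftLim_zero]; exact hu 0
  have : (𝓝[<] t).NeBot := nhdsLT_neBot_of_exists_lt ⟨0, pos_iff_ne_zero.2 ht⟩
  obtain ⟨s, hs⟩ := (eventually_left_eq (finite_range_of_unit hu) hr t).exists
  rw [← hs]; exact hu s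

end UnitPath

/-! ### Countably many discontinuities -/

/-- For each ε the times with a jump larger than ε are isolated from the left in their set: close to
u from the left, both y and its left limits are within ε/2 of y_{u-}. A set all of whose points are
left-isolated is countable. -/
theorem countable_ne_leftLim {T : ℝ≥0} {y : ℝ≥0 → ℝ} (hy : IsRCLLOn T y) :
    {u ∈ Icc 0 T | Function.leftLim y u ≠ y u}.Countable := by
  have key : ∀ n : ℕ,
      {u ∈ Icc 0 T | 1 / ((n : ℝ) + 1) < |Function.leftLim y u - y u|}.Countable := by
    intro n
    set S := {u ∈ Icc 0 T | 1 / ((n : ℝ) + 1) < |Function.leftLim y u - y u|} with hS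
    have hε : 0 < 1 / ((n : ℝ) + 1) := by positivity
    refine (countable_setOfPred_isolated_left_within (s := S)).mono fun u hu =>
      show u ∈ S ∧ 𝓝[S ∩ Iio u] u = ⊥ from ⟨hu, ?_⟩
    rw [← empty_mem_iff_bot]
    have ht := tendsto_leftLim_of_tendsto (hy.2 u hu.1.2)
    have hev : ∀ᶠ v in 𝓝[<] u, |y v - Function.leftLim y u| < 1 / ((n : ℝ) + 1) / 2 :=
      (Metric.tendsto_nhds.1 ht) _ (half_pos hε)
    have hev2 := eventually_nhds_of_open isOpen_Iio hev
    have hnot : ∀ᶠ v in 𝓝[<] u, v ∉ S := by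
      filter_upwards [hev2, hev, self_mem_nhdsWithin] with v hv hv' hvu hvS
      rcases eq_or_ne v 0 with rfl | hv0
      · have := hvS.2
        rw [leftLim_zero] at this
        simp at this
        linarith [hε, show (0:ℝ) < ((n:ℝ)+1)⁻¹ by positivity]
      have : (𝓝[<] v).NeBot := nhdsLT_neBot_of_exists_lt ⟨0, pos_iff_ne_zero.2 hv0⟩
      have htv := tendsto_leftLim_of_tendsto (hy.2 v hvS.1.2)
      have : |Function.leftLim y v - Function.leftLim y u| ≤ 1 / ((n : ℝ) + 1) / 2 := by
        refine le_of_tendsto (htv.sub_const _).abs ?_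
        exact (hv.filter_mono nhdsWithin_le_nhds).mono fun w hw => hw.le
      have h3 := hvS.2
      have := abs_sub_le (Function.leftLim y v) (Function.leftLim y u) (y v)
      rw [abs_sub_comm (Function.leftLim y u)] at this
      linarith
    have : 𝓝[S ∩ Iio u] u ≤ 𝓝[<] u := nhdsWithin_mono _ inter_subset_right
    have h4 : ∀ᶠ v in 𝓝[S ∩ Iio u] u, False := by
      filter_upwards [hnot.filter_mono this, self_mem_nhdsWithin] with v hv hv'
      exact hv hv'.1
    exact h4
  refine (countable_iUnion key).mono ?_
  rintro u ⟨hu, hne⟩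
  obtain ⟨n, hn⟩ := exists_nat_one_div_lt (abs_pos.2 (sub_ne_zero.2 hne))
  exact mem_iUnion.2 ⟨n, hu, hn⟩

/-! ### Left grid points -/

/-- The largest point of the grid `ℕ / (n+1)` strictly below `u` (for `u > 0`). -/
noncomputable def gridLeft (n : ℕ) (u : ℝ≥0) : ℝ≥0 := ((⌈u * (n + 1)⌉₊ - 1 : ℕ) : ℝ≥0) / (n + 1)

theorem gridLeft_eq {n k : ℕ} {u : ℝ≥0}
    (hu : u ∈ Ioc ((k : ℝ≥0) / (n + 1)) (((k + 1 : ℕ) : ℝ≥0) / (n + 1))) :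
    gridLeft n u = k / (n + 1) := by
  have hn : (0 : ℝ≥0) < n + 1 := by positivity
  have h : ⌈u * (n + 1)⌉₊ = k + 1 := by
    rw [Nat.ceil_eq_iff (by simp)]
    constructor
    · simpa using (div_lt_iff₀ hn).1 hu.1
    · exact (le_div_iff₀ hn).1 hu.2
  rw [gridLeft, h]; simp

theorem mem_Ioc_gridLeft (n : ℕ) {u : ℝ≥0} (hu : 0 < u) :
    ∃ k : ℕ, u ∈ Ioc ((k : ℝ≥0) / (n + 1)) (((k + 1 : ℕ) : ℝ≥0) / (n + 1)) := by
  have hn : (0 : ℝ≥0) < n + 1 := by positivity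
  have h1 : 0 < ⌈u * (n + 1)⌉₊ := Nat.ceil_pos.2 (by positivity)
  obtain ⟨k, hk⟩ := Nat.exists_eq_succ_of_ne_zero h1.ne'
  rw [Nat.succ_eq_add_one, Nat.ceil_eq_iff (by simp)] at hk
  refine ⟨k, ?_, ?_⟩
  · rw [div_lt_iff₀ hn]; simpa using hk.1
  · rw [le_div_iff₀ hn]; exact hk.2

theorem gridLeft_lt (n : ℕ) {u : ℝ≥0} (hu : 0 < u) : gridLeft n u < u := by
  obtain ⟨k, hk⟩ := mem_Ioc_gridLeft n hu
  rw [gridLeft_eq hk]; exact hk.1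

/-- Grid points lie strictly below u, even when u is itself a grid point, so sampling a path along
them converges to its left limit and never sees the value at u. -/
theorem tendsto_gridLeft {u : ℝ≥0} (hu : 0 < u) :
    Tendsto (fun n => gridLeft n u) atTop (𝓝[<] u) := by
  refine tendsto_nhdsWithin_iff.2 ⟨?_, Eventually.of_forall fun n => gridLeft_lt n hu⟩
  have hle : ∀ n : ℕ, u - 1 / ((n : ℝ≥0) + 1) ≤ gridLeft n u := by
    intro n
    obtain ⟨k, hk⟩ := mem_Ioc_gridLeft n hu
    rw [gridLeft_eq hk, tsub_le_iff_right, ← add_div]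
    simpa using hk.2
  have h1 : Tendsto (fun n : ℕ => u - 1 / ((n : ℝ≥0) + 1)) atTop (𝓝 u) := by
    have := (tendsto_const_nhds (x := u)).sub (tendsto_one_div_add_atTop_nhds_zero_nat (𝕜 := ℝ≥0))
    simpa using this
  exact tendsto_of_tendsto_of_tendsto_of_le_of_le h1 tendsto_const_nhds hle
    fun n => (gridLeft_lt n hu).le

theorem Ioc_nat_eq_biUnion (n L : ℕ) :
    Ioc (0 : ℝ≥0) L = ⋃ k ∈ Finset.range (L * (n + 1)),
      Ioc ((k : ℝ≥0) / (n + 1)) (((k + 1 : ℕ) : ℝ≥0) / (n + 1)) := by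
  have hn : (0 : ℝ≥0) < n + 1 := by positivity
  ext u
  simp only [mem_iUnion, Finset.mem_range, exists_prop]
  constructor
  · rintro ⟨h0, hL⟩
    obtain ⟨k, hk⟩ := mem_Ioc_gridLeft n h0
    refine ⟨k, ?_, hk⟩
    have := hk.1.trans_le hL
    rw [div_lt_iff₀ hn] at this
    exact_mod_cast this
  · rintro ⟨k, hk, hu⟩
    refine ⟨zero_le.trans_lt hu.1, hu.2.trans ?_⟩
    rw [div_le_iff₀ hn]
    exact_mod_cast hk

theorem pairwiseDisjoint_grid (n : ℕ) : Pairwise (Function.onFun Disjoint fun k : ℕ =>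
    Ioc ((k : ℝ≥0) / (n + 1)) (((k + 1 : ℕ) : ℝ≥0) / (n + 1))) := by
  intro i j hij
  rw [Function.onFun, Set.disjoint_left]
  intro u hi hj
  have hn : (0 : ℝ≥0) < n + 1 := by positivity
  have h1 := gridLeft_eq hi
  rw [gridLeft_eq hj, div_left_inj' hn.ne'] at h1
  exact hij (by exact_mod_cast h1.symm)

instance isFiniteMeasureOnCompacts_leb : IsFiniteMeasureOnCompacts leb where
  lt_top_of_isCompact K hK := by
    obtain ⟨b, hb⟩ := hK.bddAbove
    have hK' : K ⊆ Icc 0 b := fun x hx => ⟨zero_le, hb hx⟩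
    refine (measure_mono hK').trans_lt ?_
    rw [leb_Icc]; exact ENNReal.ofReal_lt_top

/-! ### Predictability of left limits and joint measurability of right continuous processes. -/

section Measurability

variable {Ω : Type*} [mΩ : MeasurableSpace Ω]

theorem predictable_le (ℱ : Filtration ℝ≥0 mΩ) :
    ℱ.predictable ≤ (inferInstance : MeasurableSpace (ℝ≥0 × Ω)) :=
  measurableSpace_le_predictable_of_measurableSet
    (fun _ hA => (measurableSet_singleton _).prod (ℱ.le _ _ hA))
    (fun _ _ hA => measurableSet_Ioi.prod (ℱ.le _ _ hA))

theorem measurable_indicator_of_inter {α : Type*} {m : MeasurableSpace α} {S : Set α} {g : α → ℝ}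
    (hS : MeasurableSet S) (h : ∀ B : Set ℝ, MeasurableSet B → MeasurableSet (g ⁻¹' B ∩ S)) :
    Measurable (S.indicator g) := by
  intro B hB
  rw [indicator_preimage, Set.ite]
  exact (h B hB).union ((measurable_zero hB).diff hS)

theorem measurable_predictable_gridLeft {ℱ : Filtration ℝ≥0 mΩ} {T : ℝ≥0} {Y : ℝ≥0 → Ω → ℝ}
    (hY : ∀ t ≤ T, Measurable[ℱ t] (Y t)) (n : ℕ) :
    Measurable[ℱ.predictable]
      ((Ioc (0 : ℝ≥0) T ×ˢ (univ : Set Ω)).indicator fun p => Y (gridLeft n p.1) p.2) := by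
  refine measurable_indicator_of_inter
    (measurableSet_predictable_Ioc_prod _ _ MeasurableSet.univ) fun B hB => ?_
  -- On a grid cell the sampled value is known at the left end of the cell, so the preimage is a
  -- countable union of predictable rectangles.
  have : ((fun p : ℝ≥0 × Ω => Y (gridLeft n p.1) p.2) ⁻¹' B) ∩ (Ioc (0 : ℝ≥0) T ×ˢ (univ : Set Ω))
      = ⋃ k : ℕ, ⋃ _ : (k : ℝ≥0) / (n + 1) ≤ T,
        Ioc ((k : ℝ≥0) / (n + 1)) (min (((k + 1 : ℕ) : ℝ≥0) / (n + 1)) T)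
          ×ˢ (Y ((k : ℝ≥0) / (n + 1)) ⁻¹' B) := by
    ext ⟨u, ω⟩
    simp only [mem_inter_iff, mem_preimage, mem_prod, mem_univ, and_true, mem_iUnion, exists_prop,
      mem_Ioc, le_min_iff]
    constructor
    · rintro ⟨h, h0, hT⟩
      obtain ⟨k, hk⟩ := mem_Ioc_gridLeft n h0
      rw [gridLeft_eq hk] at h
      exact ⟨k, hk.1.le.trans hT, ⟨hk.1, hk.2, hT⟩, h⟩
    · rintro ⟨k, _, ⟨h1, h2, h3⟩, h⟩
      rw [gridLeft_eq ⟨h1, h2⟩]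
      exact ⟨h, zero_le.trans_lt h1, h3⟩
  rw [this]
  exact MeasurableSet.iUnion fun k => MeasurableSet.iUnion fun hk =>
    measurableSet_predictable_Ioc_prod _ _ (hY _ hk hB)

/-- The left limits of an adapted process form a predictable process. -/
theorem measurable_predictable_leftLim {ℱ : Filtration ℝ≥0 mΩ} {T : ℝ≥0} {Y : ℝ≥0 → Ω → ℝ}
    (hY : ∀ t ≤ T, Measurable[ℱ t] (Y t))
    (hl : ∀ ω, ∀ t ≤ T, ∃ l, Tendsto (fun s => Y s ω) (𝓝[<] t) (𝓝 l)) :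
    Measurable[ℱ.predictable] ((Ioc (0 : ℝ≥0) T ×ˢ (univ : Set Ω)).indicator
      fun p => Function.leftLim (fun s => Y s p.2) p.1) := by
  refine @measurable_of_tendsto_metrizable _ _ ℱ.predictable _ _ _ _ _ _
    (measurable_predictable_gridLeft hY) ?_
  rw [tendsto_pi_nhds]
  rintro ⟨u, ω⟩
  by_cases hu : u ∈ Ioc 0 T
  · simp only [indicator_of_mem (show (u, ω) ∈ Ioc (0 : ℝ≥0) T ×ˢ (univ : Set Ω) from ⟨hu, trivial⟩)]
    exact (tendsto_leftLim_of_tendsto (hl ω u hu.2)).comp (tendsto_gridLeft hu.1)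
  · have hn : (u, ω) ∉ Ioc (0 : ℝ≥0) T ×ˢ (univ : Set Ω) := fun h => hu h.1
    simp only [indicator_of_notMem hn]
    exact tendsto_const_nhds

/-- A process with right continuous paths on `[0,T]` is jointly measurable. -/
theorem measurable_stopped_of_right_continuous {T : ℝ≥0} {Y : ℝ≥0 → Ω → ℝ}
    (hY : ∀ t ≤ T, Measurable (Y t))
    (hr : ∀ ω, ∀ t < T, ContinuousWithinAt (fun s => Y s ω) (Ici t) t) :
    Measurable fun p : ℝ≥0 × Ω => Y (min p.1 T) p.2 := by
  -- The sample point is the next grid point strictly to the right, capped at T. Before T right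
  -- continuity gives convergence; from T on the sampled value is constantly that at T.
  obtain ⟨κ, hκ⟩ : ∃ κ : ℕ → ℕ → ℝ≥0, ∀ n k, κ n k = min (((k + 1 : ℕ) : ℝ≥0) / (n + 1)) T :=
    ⟨_, fun _ _ => rfl⟩
  have hgt : ∀ (n : ℕ) (u : ℝ≥0), u < ((⌊u * (n + 1)⌋₊ + 1 : ℕ) : ℝ≥0) / (n + 1) := by
    intro n u
    rw [lt_div_iff₀ (by positivity)]
    exact_mod_cast Nat.lt_floor_add_one (u * (n + 1))
  have hle : ∀ (n : ℕ) (u : ℝ≥0),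
      ((⌊u * (n + 1)⌋₊ + 1 : ℕ) : ℝ≥0) / (n + 1) ≤ u + 1 / ((n : ℝ≥0) + 1) := by
    intro n u
    have hn : (0 : ℝ≥0) < n + 1 := by positivity
    rw [div_le_iff₀ hn, add_mul, one_div, inv_mul_cancel₀ hn.ne', Nat.cast_add, Nat.cast_one]
    gcongr
    exact Nat.floor_le zero_le
  refine measurable_of_tendsto_metrizable (f := fun (n : ℕ) (p : ℝ≥0 × Ω) =>
    Y (κ n ⌊p.1 * ((n : ℝ≥0) + 1)⌋₊) p.2) (fun n => ?_) ?_
  · have h1 : Measurable fun q : ℕ × Ω => Y (κ n q.1) q.2 :=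
      measurable_from_prod_countable_right fun k => hY (κ n k) (by rw [hκ]; exact min_le_right _ _)
    have h2 : Measurable fun p : ℝ≥0 × Ω => (⌊p.1 * (n + 1)⌋₊, p.2) :=
      (Nat.measurable_floor.comp (measurable_fst.mul_const _)).prodMk measurable_snd
    exact h1.comp h2
  · rw [tendsto_pi_nhds]
    rintro ⟨u, ω⟩
    rcases lt_or_ge u T with hu | hu
    · simp only [min_eq_left hu.le, hκ]
      refine (hr ω u hu).tendsto.comp (tendsto_nhdsWithin_iff.2 ⟨?_, ?_⟩)
      · have h1 : Tendsto (fun n : ℕ => u + 1 / ((n : ℝ≥0) + 1)) atTop (𝓝 u) := by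
          simpa using (tendsto_const_nhds (x := u)).add
            (tendsto_one_div_add_atTop_nhds_zero_nat (𝕜 := ℝ≥0))
        have h2 : Tendsto (fun n : ℕ => ((⌊u * (n + 1)⌋₊ + 1 : ℕ) : ℝ≥0) / (n + 1)) atTop (𝓝 u) :=
          tendsto_of_tendsto_of_tendsto_of_le_of_le tendsto_const_nhds h1
            (fun n => (hgt n u).le) (fun n => hle n u)
        have := h2.min (tendsto_const_nhds (x := T))
        rwa [min_eq_left hu.le] at this
      · exact Eventually.of_forall fun n => le_min (hgt n u).le hu.le
    · have : ∀ n : ℕ, κ n ⌊u * (n + 1)⌋₊ = T := fun n => by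
        rw [hκ]; exact min_eq_right (hu.trans (hgt n u).le)
      simp only [this, min_eq_right hu]
      exact tendsto_const_nhds

end Measurability

/-! ### Elementary facts on the chain -/

section Chain

variable {Ω : Type*} [mΩ : MeasurableSpace Ω] {N : ℕ} {P : Measure Ω}
  {A : ℝ≥0 → Matrix (Fin N) (Fin N) ℝ} {X : ℝ≥0 → Ω → Fin N → ℝ} {hX : ∀ t, Measurable (X t)}

theorem IsMarkovChain.finite_range (hM : IsMarkovChain P A X hX) (ω : Ω) :
    (range fun t => X t ω).Finite :=
  finite_range_of_unit fun t => hM.unit_vector t ω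

theorem IsMarkovChain.leftX_unit (hM : IsMarkovChain P A X hX) (t : ℝ≥0) (ω : Ω) :
    ∃ i : Fin N, leftX X t ω = Pi.single i 1 :=
  exists_leftLim_eq_single (fun t => hM.unit_vector t ω) (hM.rcll ω) t

theorem measurable_completedFiltration (t : ℝ≥0) :
    Measurable[completedFiltration P X hX t] (X t) := by
  rw [measurable_iff_comap_le]
  refine le_trans ?_ le_sup_left
  exact le_iSup₂ (f := fun s (_ : s ∈ Iic t) => MeasurableSpace.comap (X s) inferInstance) t (mem_Iic.2 le_rfl)

theorem measurable_completedFiltration_apply (t : ℝ≥0) (j : Fin N) :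
    Measurable[completedFiltration P X hX t] (fun ω => X t ω j) :=
  (measurable_pi_apply j).comp (measurable_completedFiltration t)

/-- Left limits are predictable on each `(0,n]`. Time 0, where the left limit is X_0 by convention,
is added by hand from {0} × ℱ_0. -/
theorem IsMarkovChain.measurable_leftX (hM : IsMarkovChain P A X hX) (j : Fin N) :
    Measurable[(completedFiltration P X hX).predictable] fun p : ℝ≥0 × Ω => leftX X p.1 p.2 j := by
  have hcoord : ∀ t ω, ∃ l, Tendsto (fun s => X s ω j) (𝓝[<] t) (𝓝 l) := fun t ω => by
    obtain ⟨l, hl⟩ := (hM.rcll ω t).2 t le_rfl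
    exact ⟨l j, (continuous_apply j).continuousAt.tendsto.comp hl⟩
  have hleft : ∀ t ω, Function.leftLim (fun s => X s ω j) t = leftX X t ω j := by
    intro t ω
    rcases eq_or_ne t 0 with rfl | ht
    · rw [leftLim_zero, leftX, leftLim_zero]
    have : (𝓝[<] t).NeBot := nhdsLT_neBot_of_exists_lt ⟨0, pos_iff_ne_zero.2 ht⟩
    refine leftLim_eq_of_tendsto ?_
    exact (continuous_apply j).continuousAt.tendsto.comp
      (tendsto_leftLim_of_tendsto ((hM.rcll ω t).2 t le_rfl))
  have h0 : Measurable[(completedFiltration P X hX).predictable]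
      ((({0} : Set ℝ≥0) ×ˢ (univ : Set Ω)).indicator fun p => X 0 p.2 j) := by
    refine measurable_indicator_of_inter
      (measurableSet_predictable_singleton_bot_prod MeasurableSet.univ) fun B hB => ?_
    have : (fun p : ℝ≥0 × Ω => X 0 p.2 j) ⁻¹' B ∩ ({0} : Set ℝ≥0) ×ˢ (univ : Set Ω)
        = ({⊥} : Set ℝ≥0) ×ˢ ((fun ω => X 0 ω j) ⁻¹' B) := by
      ext ⟨u, ω⟩; simp [and_comm]
    rw [this]
    exact measurableSet_predictable_singleton_bot_prod
      (measurable_completedFiltration_apply (0 : ℝ≥0) j hB)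
  have h1 := fun n : ℕ => measurable_predictable_leftLim (T := (n : ℝ≥0))
    (ℱ := completedFiltration P X hX) (Y := fun t ω => X t ω j)
    (fun t _ => measurable_completedFiltration_apply t j) (fun ω t _ => hcoord t ω)
  refine @measurable_of_tendsto_metrizable _ _ (completedFiltration P X hX).predictable _ _ _ _ _ _
    (fun n => (h1 n).add h0) ?_
  rw [tendsto_pi_nhds]
  rintro ⟨u, ω⟩
  refine tendsto_const_nhds.congr' ?_
  obtain ⟨m, hm⟩ := exists_nat_ge u
  filter_upwards [eventually_ge_atTop m] with n hn
  rcases eq_or_ne u 0 with rfl | hu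
  · simp [leftX, leftLim_zero]
  · have h2 : u ≤ n := hm.trans (by exact_mod_cast hn)
    have h3 : 0 < u := pos_iff_ne_zero.2 hu
    simp [hu, h2, h3, hleft]

theorem IsMarkovChain.measurable_stopped (hM : IsMarkovChain P A X hX) (T : ℝ≥0) (j : Fin N) :
    Measurable fun p : ℝ≥0 × Ω => X (min p.1 T) p.2 j := by
  refine measurable_stopped_of_right_continuous (Y := fun t ω => X t ω j)
    (fun t _ => (measurable_pi_apply j).comp (hX t)) fun ω t ht => ?_
  exact (continuous_apply j).continuousAt.comp_continuousWithinAt ((hM.rcll ω T).1 t ht)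

theorem IsMarkovChain.abs_le_one (hM : IsMarkovChain P A X hX) (t : ℝ≥0) (ω : Ω) (j : Fin N) :
    |X t ω j| ≤ 1 := by
  obtain ⟨i, hi⟩ := hM.unit_vector t ω
  rw [hi]
  by_cases h : j = i <;> simp [h]

theorem IsMarkovChain.eq_zero_of_ne_one (hM : IsMarkovChain P A X hX) {t : ℝ≥0} {ω : Ω} {j : Fin N}
    (h : X t ω j ≠ 1) : X t ω j = 0 := by
  obtain ⟨i, hi⟩ := hM.unit_vector t ω
  rw [hi] at h ⊢
  by_cases h' : j = i
  · simp [h'] at h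
  · simp [h']

theorem IsMarkovChain.leftX_eq_zero_of_ne_one (hM : IsMarkovChain P A X hX) {t : ℝ≥0} {ω : Ω}
    {j : Fin N} (h : leftX X t ω j ≠ 1) : leftX X t ω j = 0 := by
  obtain ⟨i, hi⟩ := hM.leftX_unit t ω
  rw [hi] at h ⊢
  by_cases h' : j = i
  · simp [h'] at h
  · simp [h']

theorem IsMarkovChain.eq_of_apply_eq_one (hM : IsMarkovChain P A X hX) {t : ℝ≥0} {ω : Ω}
    {j : Fin N} (h : X t ω j = 1) : X t ω = Pi.single j 1 := by
  obtain ⟨i, hi⟩ := hM.unit_vector t ω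
  rw [hi] at h ⊢
  by_cases h' : j = i
  · rw [h']
  · simp [h'] at h

theorem IsMarkovChain.leftX_eq_of_apply_eq_one (hM : IsMarkovChain P A X hX) {t : ℝ≥0} {ω : Ω}
    {j : Fin N} (h : leftX X t ω j = 1) : leftX X t ω = Pi.single j 1 := by
  obtain ⟨i, hi⟩ := hM.leftX_unit t ω
  rw [hi] at h ⊢
  by_cases h' : j = i
  · rw [h']
  · simp [h'] at h

theorem IsMarkovChain.abs_mulVec_le (hM : IsMarkovChain P A X hX) {m : ℝ}
    (hm : ∀ t i j, |A t i j| ≤ m) (t u : ℝ≥0) (ω : Ω) (j : Fin N) :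
    |(A u *ᵥ X t ω) j| ≤ m := by
  obtain ⟨i, hi⟩ := hM.unit_vector t ω
  rw [hi, Matrix.mulVec_single_one]
  exact hm u j i

theorem IsMarkovChain.measurable_mulVec_stopped (hA : IsRateMatrix A) (hM : IsMarkovChain P A X hX)
    (T : ℝ≥0) (j : Fin N) :
    Measurable fun p : ℝ≥0 × Ω => (A p.1 *ᵥ X (min p.1 T) p.2) j := by
  simp only [Matrix.mulVec, dotProduct]
  exact Finset.measurable_sum _ fun l _ =>
    ((hA.measurable j l).comp measurable_fst).mul (hM.measurable_stopped T l)

variable [IsProbabilityMeasure P]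

theorem IsMarkovChain.integrable_apply (hM : IsMarkovChain P A X hX) (t : ℝ≥0) (j : Fin N) :
    Integrable (fun ω => X t ω j) P :=
  Integrable.of_bound ((measurable_pi_apply j).comp (hX t)).aestronglyMeasurable 1
    (ae_of_all _ fun ω => hM.abs_le_one t ω j)

/-- The Markov property integrated over an event of the past: the vector E[X_t; B] evolves
deterministically under Φ. -/
theorem IsMarkovChain.setIntegral_eq (hM : IsMarkovChain P A X hX)
    {Φ : ℝ≥0 → ℝ≥0 → Matrix (Fin N) (Fin N) ℝ}
    (hΦ : ∀ s t, s ≤ t → ∀ j, P[(fun ω => X t ω j) | completedFiltration P X hX s] =ᵐ[P]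
      fun ω => (Φ s t *ᵥ X s ω) j)
    {s t : ℝ≥0} (hst : s ≤ t) {B : Set Ω} (hB : MeasurableSet[completedFiltration P X hX s] B)
    (j : Fin N) :
    ∫ ω in B, X t ω j ∂P = (Φ s t *ᵥ fun l => ∫ ω in B, X s ω l ∂P) j := by
  rw [← setIntegral_condExp ((completedFiltration P X hX).le s) (hM.integrable_apply t j) hB,
    integral_congr_ae (ae_restrict_of_ae (hΦ s t hst j))]
  simp only [Matrix.mulVec, dotProduct]
  rw [integral_finsetSum]
  · simp_rw [integral_const_mul]
  · exact fun l _ => ((hM.integrable_apply s l).const_mul _).integrableOn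

/-- The increments of the martingale part of `X` are orthogonal to the past. -/
theorem IsMarkovChain.setIntegral_sub (hA : IsRateMatrix A) (hM : IsMarkovChain P A X hX)
    {s t : ℝ≥0} (hst : s ≤ t) {B : Set Ω} (hB : MeasurableSet[completedFiltration P X hX s] B)
    (j : Fin N) :
    ∫ ω in B, (X t ω j - X s ω j) ∂P = ∫ ω in B, ∫ u in Ioc s t, (A u *ᵥ X u ω) j ∂leb ∂P := by
  obtain ⟨Φ, hΦ, hcond⟩ := hM.markov
  obtain ⟨m, hm⟩ := hA.bounded
  -- With q_u = E[X_u; B] = Φ(s,u) q_s, the claim becomes the Kolmogorov equation q_t - q_s = ∫ A_u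
  -- q_u du after Fubini.
  set q : ℝ≥0 → Fin N → ℝ := fun u l => ∫ ω in B, X u ω l ∂P with hq
  have hqu : ∀ u, s ≤ u → q u = Φ s u *ᵥ q s := fun u hu =>
    funext fun l => hM.setIntegral_eq hcond hu hB l
  have hint : ∀ i l, IntegrableOn (fun u => (A u * Φ s u) i l) (Ioc s t) leb := by
    intro i l
    simp only [Matrix.mul_apply]
    refine integrable_finsetSum _ fun r _ => ?_
    have hc : ContinuousOn (fun u => Φ s u r l) (Icc s t) := by
      have := (hΦ.continuousOn s).mono (Icc_subset_Ici_self : Icc s t ⊆ Ici s)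
      exact ((continuous_apply l).comp (continuous_apply r)).comp_continuousOn this
    have hi : IntegrableOn (fun u => Φ s u r l) (Ioc s t) leb :=
      (hc.integrableOn_compact isCompact_Icc).mono_set Ioc_subset_Icc_self
    exact hi.bdd_mul (hA.measurable i r).aestronglyMeasurable
      (ae_of_all _ fun u => hm u i r)
  have hswap : ∫ ω in B, ∫ u in Ioc s t, (A u *ᵥ X u ω) j ∂leb ∂P
      = ∫ u in Ioc s t, ∫ ω in B, (A u *ᵥ X u ω) j ∂P ∂leb := by
    have e1 : ∀ ω, ∫ u in Ioc s t, (A u *ᵥ X u ω) j ∂leb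
        = ∫ u in Ioc s t, (A u *ᵥ X (min u t) ω) j ∂leb := fun ω =>
      setIntegral_congr_fun measurableSet_Ioc fun u hu => by simp only [min_eq_left hu.2]
    have e2 : ∫ u in Ioc s t, ∫ ω in B, (A u *ᵥ X u ω) j ∂P ∂leb
        = ∫ u in Ioc s t, ∫ ω in B, (A u *ᵥ X (min u t) ω) j ∂P ∂leb :=
      setIntegral_congr_fun measurableSet_Ioc fun u hu => by simp only [min_eq_left hu.2]
    simp_rw [e1]
    rw [e2]
    refine integral_integral_swap ?_
    refine Integrable.of_bound (C := m) ?_ (ae_of_all _ fun p => hM.abs_mulVec_le hm _ _ _ _)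
    exact ((hM.measurable_mulVec_stopped hA t j).comp measurable_swap).aestronglyMeasurable
  have hinner : ∀ u ∈ Ioc s t, ∫ ω in B, (A u *ᵥ X u ω) j ∂P
      = ∑ l, (A u * Φ s u) j l * q s l := by
    intro u hu
    have : ∫ ω in B, (A u *ᵥ X u ω) j ∂P = (A u *ᵥ q u) j := by
      simp only [Matrix.mulVec, dotProduct, hq]
      rw [integral_finsetSum]
      · simp_rw [integral_const_mul]
      · exact fun l _ => ((hM.integrable_apply u l).const_mul _).integrableOn
    rw [this, hqu u hu.1.le, Matrix.mulVec_mulVec]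
    rfl
  rw [hswap, setIntegral_congr_fun measurableSet_Ioc hinner, integral_finsetSum _
    fun l _ => (hint j l).mul_const _, integral_sub (hM.integrable_apply t j).integrableOn
    (hM.integrable_apply s j).integrableOn]
  change q t j - q s j = _
  rw [hqu t hst]
  simp_rw [integral_mul_const]
  have hf := fun l => hΦ.forward s t hst j l
  have : ∀ l, (∫ u in Ioc s t, (A u * Φ s u) j l ∂leb)
      = Φ s t j l - (1 : Matrix (Fin N) (Fin N) ℝ) j l := fun l => by
    rw [hf l]; ring
  simp_rw [this, sub_mul, Finset.sum_sub_distrib]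
  congr 1
  have : ((1 : Matrix (Fin N) (Fin N) ℝ) *ᵥ q s) j = q s j := by rw [Matrix.one_mulVec]
  rw [← this]
  rfl

end Chain

/-! ### Compensation of increments sampled on a grid. -/

section Compensation

variable {Ω : Type*} [mΩ : MeasurableSpace Ω] {N : ℕ} {P : Measure Ω}
  {A : ℝ≥0 → Matrix (Fin N) (Fin N) ℝ} {X : ℝ≥0 → Ω → Fin N → ℝ} {hX : ∀ t, Measurable (X t)}

/-- The sum of the jumps of the `j`-th coordinate of `X` in `(0,L]`, weighted by the indicator of
`B` at the grid point to the left of the jump time. -/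
noncomputable def gridSum (X : ℝ≥0 → Ω → Fin N → ℝ) (B : ℝ≥0 → Set Ω) (L n : ℕ) (j : Fin N)
    (ω : Ω) : ℝ :=
  ∑ u ∈ jumps (fun t => X t ω) L,
    (B (gridLeft n u)).indicator 1 ω * (X u ω j - leftX X u ω j)

/-- Over one cell the increment of X is the sum of its jumps there, and the weight is constant on
the cell. The horizon L is a natural number so that cells of length 1/(n+1) tile `(0,L]` exactly. -/
theorem IsMarkovChain.gridSum_eq (hM : IsMarkovChain P A X hX) (B : ℝ≥0 → Set Ω) (L n : ℕ)
    (j : Fin N) (ω : Ω) :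
    gridSum X B L n j ω = ∑ k ∈ Finset.range (L * (n + 1)),
      (B ((k : ℝ≥0) / (n + 1))).indicator
        (fun ω => X (((k + 1 : ℕ) : ℝ≥0) / (n + 1)) ω j - X ((k : ℝ≥0) / (n + 1)) ω j) ω := by
  have hF := hM.finite_range ω
  have hr := hM.rcll ω
  have hn : (0 : ℝ≥0) < n + 1 := by positivity
  have h1 : ∀ k ∈ Finset.range (L * (n + 1)), (B ((k : ℝ≥0) / (n + 1))).indicator
        (fun ω => X (((k + 1 : ℕ) : ℝ≥0) / (n + 1)) ω j - X ((k : ℝ≥0) / (n + 1)) ω j) ω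
      = ∑ u ∈ jumps (fun t => X t ω) L,
        if u ∈ Ioc ((k : ℝ≥0) / (n + 1)) (((k + 1 : ℕ) : ℝ≥0) / (n + 1)) then
          (B ((k : ℝ≥0) / (n + 1))).indicator 1 ω * (X u ω j - leftX X u ω j) else 0 := by
    intro k hk
    have h2 := congrFun (sub_eq_sum_jumps hF hr (s := (k : ℝ≥0) / (n + 1))
      (t := ((k + 1 : ℕ) : ℝ≥0) / (n + 1)) (T := L) (by gcongr; simp) (by
        rw [div_le_iff₀ hn]; exact_mod_cast Finset.mem_range.1 hk)) j
    rw [Finset.sum_apply] at h2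
    simp only [Pi.sub_apply] at h2
    rw [← Finset.sum_filter, ← Finset.mul_sum]
    change _ = _ * ∑ u ∈ _, (X u ω j - Function.leftLim (fun t => X t ω) u j)
    rw [← h2]
    by_cases hω : ω ∈ B ((k : ℝ≥0) / (n + 1)) <;> simp [hω]
  rw [Finset.sum_congr rfl h1, Finset.sum_comm, gridSum]
  refine Finset.sum_congr rfl fun u hu => ?_
  have hu0 := pos_of_mem_jumps hF hr hu
  have huL := ((mem_jumps hF hr).1 hu).1
  obtain ⟨k, hk⟩ := mem_Ioc_gridLeft n hu0
  rw [Finset.sum_eq_single k]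
  · rw [if_pos hk, gridLeft_eq hk]
  · intro k' _ hne
    rw [if_neg]
    intro hk'
    exact Set.disjoint_left.1 (pairwiseDisjoint_grid n hne) hk' hk
  · intro hk'
    exfalso
    refine hk' (Finset.mem_range.2 ?_)
    have := hk.1.trans_le huL
    rw [div_lt_iff₀ hn] at this
    exact_mod_cast this

theorem IsMarkovChain.abs_integral_mulVec_le (hM : IsMarkovChain P A X hX) {m : ℝ}
    (hm : ∀ t i j, |A t i j| ≤ m) (s t : ℝ≥0) (g : ℝ≥0 → ℝ) (hg : ∀ u, |g u| ≤ 1) (ω : Ω)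
    (j : Fin N) : |∫ u in Ioc s t, g u * (A u *ᵥ X u ω) j ∂leb| ≤ m * leb.real (Ioc s t) := by
  have hfin : leb (Ioc s t) < ∞ := by rw [leb_Ioc]; exact ENNReal.ofReal_lt_top
  rw [← Real.norm_eq_abs]
  refine norm_setIntegral_le_of_norm_le_const hfin fun u _ => ?_
  rw [Real.norm_eq_abs, abs_mul]
  have h1 := hM.abs_mulVec_le hm u u ω j
  nlinarith [hg u, abs_nonneg (g u), abs_nonneg ((A u *ᵥ X u ω) j)]

theorem IsMarkovChain.integrableOn_mulVec (hA : IsRateMatrix A) (hM : IsMarkovChain P A X hX)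
    (s t : ℝ≥0) (ω : Ω) (j : Fin N) :
    IntegrableOn (fun u => (A u *ᵥ X u ω) j) (Ioc s t) leb := by
  obtain ⟨m, hm⟩ := hA.bounded
  have h1 : IntegrableOn (fun u => (A u *ᵥ X (min u t) ω) j) (Ioc s t) leb :=
    Integrable.of_bound (((hM.measurable_mulVec_stopped hA t j).comp
      (measurable_id.prodMk measurable_const)).aestronglyMeasurable) m
      (ae_of_all _ fun u => by
        obtain ⟨i, hi⟩ := hM.unit_vector (min u t) ω
        rw [hi, Matrix.mulVec_single_one]
        exact hm u j i)
  exact h1.congr_fun (fun u hu => by simp only [min_eq_left hu.2]) measurableSet_Ioc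

theorem IsMarkovChain.measurable_integral_mulVec (hA : IsRateMatrix A)
    (hM : IsMarkovChain P A X hX) (s t : ℝ≥0) (j : Fin N) :
    Measurable fun ω => ∫ u in Ioc s t, (A u *ᵥ X u ω) j ∂leb := by
  have e1 : ∀ ω, ∫ u in Ioc s t, (A u *ᵥ X u ω) j ∂leb
      = ∫ u in Ioc s t, (A u *ᵥ X (min u t) ω) j ∂leb := fun ω =>
    setIntegral_congr_fun measurableSet_Ioc fun u hu => by simp only [min_eq_left hu.2]
  simp_rw [e1]
  exact (StronglyMeasurable.integral_prod_left
    (hM.measurable_mulVec_stopped hA t j).stronglyMeasurable).measurable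

theorem gridIntegral_eq (hA : IsRateMatrix A) (hM : IsMarkovChain P A X hX)
    (B : ℝ≥0 → Set Ω) (L n : ℕ) (j : Fin N) (ω : Ω) :
    ∫ u in Ioc 0 (L : ℝ≥0), (B (gridLeft n u)).indicator 1 ω * (A u *ᵥ X u ω) j ∂leb
      = ∑ k ∈ Finset.range (L * (n + 1)), (B ((k : ℝ≥0) / (n + 1))).indicator
        (fun ω => ∫ u in Ioc ((k : ℝ≥0) / (n + 1)) (((k + 1 : ℕ) : ℝ≥0) / (n + 1)),
          (A u *ᵥ X u ω) j ∂leb) ω := by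
  have hcongr : ∀ k : ℕ, ∀ u ∈ Ioc ((k : ℝ≥0) / (n + 1)) (((k + 1 : ℕ) : ℝ≥0) / (n + 1)),
      (B (gridLeft n u)).indicator 1 ω * (A u *ᵥ X u ω) j
        = (B ((k : ℝ≥0) / (n + 1))).indicator 1 ω * (A u *ᵥ X u ω) j := fun k u hu => by
    rw [gridLeft_eq hu]
  rw [Ioc_nat_eq_biUnion n L, integral_biUnion_finset _ (fun _ _ => measurableSet_Ioc)
    ((pairwiseDisjoint_grid n).set_pairwise _)]
  · refine Finset.sum_congr rfl fun k _ => ?_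
    rw [setIntegral_congr_fun measurableSet_Ioc (hcongr k), integral_const_mul]
    by_cases hω : ω ∈ B ((k : ℝ≥0) / (n + 1)) <;> simp [hω]
  · exact fun k _ => (integrableOn_congr_fun (hcongr k) measurableSet_Ioc).2
      ((hM.integrableOn_mulVec hA _ _ ω j).const_mul _)

/-- The event `B`, switched on at time `s` and restricted to paths outside the state `j`. -/
def awaySet (X : ℝ≥0 → Ω → Fin N → ℝ) (B : Set Ω) (s : ℝ≥0) (j : Fin N) (t : ℝ≥0) : Set Ω :=
  {ω | ω ∈ B ∧ s ≤ t ∧ X t ω j ≠ 1}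

theorem measurableSet_awaySet {B : Set Ω} {s : ℝ≥0}
    (hB : MeasurableSet[completedFiltration P X hX s] B) (j : Fin N) (t : ℝ≥0) :
    MeasurableSet[completedFiltration P X hX t] (awaySet X B s j t) := by
  by_cases hst : s ≤ t
  · have : awaySet X B s j t = B ∩ (fun ω => X t ω j) ⁻¹' {1}ᶜ := by
      ext ω; simp [awaySet, hst]
    rw [this]
    have h1 : MeasurableSet[completedFiltration P X hX t] B :=
      (completedFiltration P X hX).mono hst _ hB
    have h2 : MeasurableSet[completedFiltration P X hX t] ((fun ω => X t ω j) ⁻¹' {1}ᶜ) :=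
      measurable_completedFiltration_apply t j (measurableSet_singleton 1).compl
    exact h1.inter h2
  · have : awaySet X B s j t = ∅ := by
      ext ω; simp [awaySet, hst]
    rw [this]; exact @MeasurableSet.empty _ (completedFiltration P X hX t)

theorem IsMarkovChain.integrable_gridTerm [IsProbabilityMeasure P] (hM : IsMarkovChain P A X hX) {B : Set Ω}
    (hB : MeasurableSet B) (s t : ℝ≥0) (j : Fin N) :
    Integrable (B.indicator (fun ω => X t ω j - X s ω j)) P :=
  ((hM.integrable_apply t j).sub (hM.integrable_apply s j)).indicator hB

theorem IsMarkovChain.integrable_gridSum [IsProbabilityMeasure P] (hM : IsMarkovChain P A X hX) {B : ℝ≥0 → Set Ω}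
    (hB : ∀ t, MeasurableSet[completedFiltration P X hX t] (B t)) (L n : ℕ) (j : Fin N) :
    Integrable (gridSum X B L n j) P := by
  rw [show gridSum X B L n j = fun ω => _ from funext (hM.gridSum_eq B L n j)]
  exact integrable_finsetSum _ fun k _ =>
    hM.integrable_gridTerm ((completedFiltration P X hX).le _ _ (hB _)) _ _ j

/-- The weight on a cell is an event known at its left end, so `IsMarkovChain.setIntegral_sub`
applies cell by cell. -/
theorem IsMarkovChain.integral_gridSum [IsProbabilityMeasure P] (hA : IsRateMatrix A) (hM : IsMarkovChain P A X hX)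
    {B : ℝ≥0 → Set Ω} (hB : ∀ t, MeasurableSet[completedFiltration P X hX t] (B t)) (L n : ℕ)
    (j : Fin N) :
    ∫ ω, gridSum X B L n j ω ∂P = ∫ ω, ∫ u in Ioc 0 (L : ℝ≥0),
      (B (gridLeft n u)).indicator 1 ω * (A u *ᵥ X u ω) j ∂leb ∂P := by
  obtain ⟨m, hm⟩ := hA.bounded
  have hB' := fun t => (completedFiltration P X hX).le _ _ (hB t)
  simp_rw [hM.gridSum_eq B L n j, gridIntegral_eq hA hM]
  rw [integral_finsetSum _ fun k _ => hM.integrable_gridTerm (hB' _) _ _ j, integral_finsetSum]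
  · refine Finset.sum_congr rfl fun k _ => ?_
    rw [integral_indicator (hB' _), integral_indicator (hB' _)]
    exact hM.setIntegral_sub hA (by gcongr; simp) (hB _) j
  · intro k _
    refine Integrable.indicator ?_ (hB' _)
    refine Integrable.of_bound (hM.measurable_integral_mulVec hA _ _ j).aestronglyMeasurable
      (m * leb.real (Ioc ((k : ℝ≥0) / (n + 1)) (((k + 1 : ℕ) : ℝ≥0) / (n + 1)))) (ae_of_all _ fun ω => ?_)
    have := hM.abs_integral_mulVec_le hm ((k : ℝ≥0) / (n + 1)) (((k + 1 : ℕ) : ℝ≥0) / (n + 1))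
      (fun _ => 1) (by simp) ω j
    simpa using this

/-! ### Counting jumps into a state -/

/-- The number of jumps into the state `j` in `(s,L]`. -/
noncomputable def jumpCount (X : ℝ≥0 → Ω → Fin N → ℝ) (L : ℝ≥0) (j : Fin N) (s : ℝ≥0) (ω : Ω) : ℝ :=
  ∑ u ∈ jumps (fun t => X t ω) L, if s < u ∧ X u ω j = 1 then 1 else 0

/-- The intensity of the jumps into the state `j`. -/
noncomputable def jumpRate (A : ℝ≥0 → Matrix (Fin N) (Fin N) ℝ) (X : ℝ≥0 → Ω → Fin N → ℝ)
    (j : Fin N) (p : ℝ≥0 × Ω) : ℝ :=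
  (1 - leftX X p.1 p.2 j) * (A p.1 *ᵥ leftX X p.1 p.2) j

/-- In the limit the weight selects B, times after s, and left limits different from e_j. A jump
starting outside j changes the j-th coordinate by 1 if it lands in j and by 0 otherwise, so exactly
the entries into j are counted. -/
theorem IsMarkovChain.tendsto_gridSum (hM : IsMarkovChain P A X hX) (B : Set Ω) (s : ℝ≥0) (L : ℕ)
    (j : Fin N) (ω : Ω) :
    Tendsto (fun n => gridSum X (awaySet X B s j) L n j ω) atTop
      (𝓝 (B.indicator (jumpCount X L j s) ω)) := by
  classical
  have hF := hM.finite_range ω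
  have hr := hM.rcll ω
  have e : B.indicator (jumpCount X L j s) ω = ∑ u ∈ jumps (fun t => X t ω) L,
      if ω ∈ B ∧ s < u ∧ X u ω j = 1 then (1 : ℝ) else 0 := by
    by_cases hω : ω ∈ B <;> simp [hω, jumpCount]
  rw [e]
  refine tendsto_finsetSum _ fun u hu => tendsto_const_nhds.congr' ?_
  have hu0 := pos_of_mem_jumps hF hr hu
  have hne : leftX X u ω ≠ X u ω := ((mem_jumps hF hr).1 hu).2
  have h1 : ∀ᶠ n in atTop, X (gridLeft n u) ω = leftX X u ω :=
    (tendsto_gridLeft hu0).eventually (eventually_left_eq hF hr u)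
  -- The weak inequality at grid points becomes strict at u because the grid points approach u
  -- strictly from below.
  have h2 : ∀ᶠ n in atTop, (s ≤ gridLeft n u ↔ s < u) := by
    rcases lt_or_ge s u with h | h
    · filter_upwards [(tendsto_gridLeft hu0).eventually (Ioo_mem_nhdsLT h)] with n hn
      exact ⟨fun _ => h, fun _ => hn.1.le⟩
    · refine Eventually.of_forall fun n => ⟨fun h' => h'.trans_lt (gridLeft_lt n hu0), fun h' => ?_⟩
      exact absurd h' (not_lt.2 h)
  filter_upwards [h1, h2] with n hn hs
  have hmem : ω ∈ awaySet X B s j (gridLeft n u) ↔ ω ∈ B ∧ s < u ∧ leftX X u ω j ≠ 1 := by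
    simp only [awaySet, mem_ofPred_eq, hs, hn]
  rw [indicator_apply]
  simp only [hmem, Pi.one_apply]
  by_cases hl : leftX X u ω j = 1
  · have hx : X u ω j ≠ 1 := fun h => hne (by
      rw [hM.leftX_eq_of_apply_eq_one hl, hM.eq_of_apply_eq_one h])
    simp [hl, hx]
  · by_cases hx : X u ω j = 1
    · simp [hx, hM.leftX_eq_zero_of_ne_one hl]
    · simp [hM.leftX_eq_zero_of_ne_one hl, hM.eq_zero_of_ne_one hx]

theorem jumpCount_nonneg {Ω : Type*} {N : ℕ} {X : ℝ≥0 → Ω → Fin N → ℝ}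
    (L : ℝ≥0) (j : Fin N) (s : ℝ≥0) (ω : Ω) : 0 ≤ jumpCount X L j s ω :=
  Finset.sum_nonneg fun u _ => by split_ifs <;> simp

theorem IsMarkovChain.measurable_gridSum (hM : IsMarkovChain P A X hX) {B : ℝ≥0 → Set Ω}
    (hB : ∀ t, MeasurableSet[completedFiltration P X hX t] (B t)) (L n : ℕ) (j : Fin N) :
    Measurable (gridSum X B L n j) := by
  rw [show gridSum X B L n j = fun ω => _ from funext (hM.gridSum_eq B L n j)]
  refine Finset.measurable_sum _ fun k _ => Measurable.indicator ?_
    ((completedFiltration P X hX).le _ _ (hB _))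
  exact ((measurable_pi_apply j).comp (hX _)).sub ((measurable_pi_apply j).comp (hX _))

theorem IsMarkovChain.measurable_jumpCount (hM : IsMarkovChain P A X hX) (L : ℕ) (j : Fin N)
    (s : ℝ≥0) : Measurable (jumpCount X L j s) := by
  have h := measurable_of_tendsto_metrizable
    (fun n => hM.measurable_gridSum (measurableSet_awaySet (P := P) (hX := hX)
      (B := univ) (s := s) MeasurableSet.univ j) L n j)
    (tendsto_pi_nhds.2 fun ω => hM.tendsto_gridSum univ s L j ω)
  simpa using h

/-- On the away set the j-th coordinate is 0 at the start of the cell and so cannot decrease.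
Positivity permits Fatou's lemma before any integrable bound on the number of jumps is known. -/
theorem IsMarkovChain.gridSum_nonneg (hM : IsMarkovChain P A X hX) (B : Set Ω) (s : ℝ≥0) (L n : ℕ)
    (j : Fin N) (ω : Ω) : 0 ≤ gridSum X (awaySet X B s j) L n j ω := by
  rw [hM.gridSum_eq]
  refine Finset.sum_nonneg fun k _ => indicator_apply_nonneg fun hω => ?_
  rw [hM.eq_zero_of_ne_one hω.2.2, sub_zero]
  by_cases h : X (((k + 1 : ℕ) : ℝ≥0) / (n + 1)) ω j = 1
  · rw [h]; exact zero_le_one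
  · rw [hM.eq_zero_of_ne_one h]

/-- Every jump lands in exactly one state. Hence the total number of jumps is integrable once the
entries into each state are, and it dominates all grid sums. -/
theorem IsMarkovChain.card_jumps_eq (hM : IsMarkovChain P A X hX) (L : ℝ≥0) (ω : Ω) :
    ((jumps (fun t => X t ω) L).card : ℝ) = ∑ j, jumpCount X L j 0 ω := by
  simp only [jumpCount]
  rw [Finset.sum_comm, Finset.card_eq_sum_ones, Nat.cast_sum]
  refine Finset.sum_congr rfl fun u hu => ?_
  have hu0 := pos_of_mem_jumps (hM.finite_range ω) (hM.rcll ω) hu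
  obtain ⟨i, hi⟩ := hM.unit_vector u ω
  rw [Finset.sum_eq_single i]
  · simp [hi, hu0]
  · intro j _ hj
    simp [hi, hj]
  · simp

theorem IsMarkovChain.abs_gridSum_le (hM : IsMarkovChain P A X hX) (B : ℝ≥0 → Set Ω) (L n : ℕ)
    (j : Fin N) (ω : Ω) :
    |gridSum X B L n j ω| ≤ (jumps (fun t => X t ω) L).card := by
  classical
  rw [gridSum]
  refine (Finset.abs_sum_le_sum_abs _ _).trans ?_
  rw [Finset.card_eq_sum_ones, Nat.cast_sum]
  refine Finset.sum_le_sum fun u _ => ?_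
  rw [abs_mul, Nat.cast_one]
  have h1 : |(B (gridLeft n u)).indicator (1 : Ω → ℝ) ω| ≤ 1 := by
    rw [indicator_apply]; split_ifs <;> simp
  have h2 : |X u ω j - leftX X u ω j| ≤ 1 := by
    by_cases hl : leftX X u ω j = 1
    · by_cases hx : X u ω j = 1
      · simp [hl, hx]
      · simp [hl, hM.eq_zero_of_ne_one hx]
    · rw [hM.leftX_eq_zero_of_ne_one hl, sub_zero]
      exact hM.abs_le_one u ω j
  exact mul_le_one₀ h1 (abs_nonneg _) h2

/-- Fatou's lemma along the grid sums, whose expectations are integrals of bounded rates and so are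
bounded uniformly in n. -/
theorem IsMarkovChain.integrable_jumpCount_zero [IsProbabilityMeasure P] (hA : IsRateMatrix A)
    (hM : IsMarkovChain P A X hX) (L : ℕ) (j : Fin N) : Integrable (jumpCount X L j 0) P := by
  classical
  obtain ⟨m, hm⟩ := hA.bounded
  have hB := measurableSet_awaySet (P := P) (hX := hX) (B := univ) (s := 0) MeasurableSet.univ j
  refine ⟨(hM.measurable_jumpCount L j 0).aestronglyMeasurable, ?_⟩
  rw [hasFiniteIntegral_iff_ofReal (ae_of_all _ fun ω => jumpCount_nonneg _ _ _ _)]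
  have hlim : ∀ ω, Tendsto (fun n => ENNReal.ofReal (gridSum X (awaySet X univ 0 j) L n j ω)) atTop
      (𝓝 (ENNReal.ofReal (jumpCount X L j 0 ω))) := fun ω => by
    have := hM.tendsto_gridSum univ 0 L j ω
    rw [indicator_univ] at this
    exact ENNReal.tendsto_ofReal this
  calc ∫⁻ ω, ENNReal.ofReal (jumpCount X L j 0 ω) ∂P
      = ∫⁻ ω, liminf (fun n => ENNReal.ofReal (gridSum X (awaySet X univ 0 j) L n j ω)) atTop ∂P :=
        lintegral_congr fun ω => (hlim ω).liminf_eq.symm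
    _ ≤ liminf (fun n => ∫⁻ ω, ENNReal.ofReal (gridSum X (awaySet X univ 0 j) L n j ω) ∂P) atTop :=
        lintegral_liminf_le fun n => (hM.measurable_gridSum hB L n j).ennreal_ofReal
    _ ≤ ENNReal.ofReal (m * leb.real (Ioc 0 (L : ℝ≥0))) := by
        refine liminf_le_of_le (by isBoundedDefault) fun b hb => ?_
        obtain ⟨n, hn⟩ := hb.exists
        refine hn.trans ?_
        rw [← ofReal_integral_eq_lintegral_ofReal (hM.integrable_gridSum hB L n j)
          (ae_of_all _ fun ω => hM.gridSum_nonneg _ _ _ _ _ _), hM.integral_gridSum hA hB]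
        refine ENNReal.ofReal_le_ofReal ((le_abs_self _).trans ?_)
        have := norm_integral_le_of_norm_le_const (μ := P) (C := m * leb.real (Ioc 0 (L : ℝ≥0)))
          (f := fun ω => ∫ u in Ioc 0 (L : ℝ≥0),
            (awaySet X univ 0 j (gridLeft n u)).indicator 1 ω * (A u *ᵥ X u ω) j ∂leb)
          (ae_of_all _ fun ω => hM.abs_integral_mulVec_le hm _ _ _ (fun u => by
            rw [indicator_apply]; split_ifs <;> simp) ω j)
        simpa using this
    _ < ∞ := ENNReal.ofReal_lt_top

theorem jumpCount_le {Ω : Type*} {N : ℕ} {X : ℝ≥0 → Ω → Fin N → ℝ}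
    (s : ℝ≥0) (L : ℝ≥0) (j : Fin N) (ω : Ω) :
    jumpCount X L j s ω ≤ jumpCount X L j 0 ω := by
  refine Finset.sum_le_sum fun u _ => ?_
  by_cases h : s < u ∧ X u ω j = 1
  · rw [if_pos h, if_pos ⟨zero_le.trans_lt h.1, h.2⟩]
  · rw [if_neg h]; split_ifs <;> simp

theorem IsMarkovChain.integrable_jumpCount [IsProbabilityMeasure P] (hA : IsRateMatrix A)
    (hM : IsMarkovChain P A X hX) (L : ℕ) (j : Fin N) (s : ℝ≥0) :
    Integrable (jumpCount X L j s) P :=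
  (hM.integrable_jumpCount_zero hA L j).mono' (hM.measurable_jumpCount L j s).aestronglyMeasurable
    (ae_of_all _ fun ω => by
      rw [Real.norm_of_nonneg (jumpCount_nonneg _ _ _ _)]
      exact jumpCount_le _ _ _ _)

theorem IsMarkovChain.ae_leftX_eq (hM : IsMarkovChain P A X hX) (ω : Ω) (T : ℝ≥0) :
    ∀ᵐ u ∂(leb.restrict (Ioc 0 T)), leftX X u ω = X u ω := by
  rw [ae_restrict_iff' measurableSet_Ioc, ae_iff]
  refine measure_mono_null (fun u hu => ?_)
    ((finite_jumps (hM.finite_range ω) (hM.rcll ω) T).measure_zero leb)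
  simp only [mem_ofPred_eq, Classical.not_imp] at hu
  exact ⟨⟨zero_le, hu.1.2⟩, hu.2⟩

/-- The compensator of the number of jumps into a state. -/
theorem IsMarkovChain.setIntegral_jumpCount [IsProbabilityMeasure P] (hA : IsRateMatrix A)
    (hM : IsMarkovChain P A X hX) (L : ℕ) (j : Fin N) {s : ℝ≥0} {B : Set Ω}
    (hB : MeasurableSet[completedFiltration P X hX s] B) :
    ∫ ω in B, jumpCount X L j s ω ∂P
      = ∫ ω in B, ∫ u in Ioc 0 (L : ℝ≥0), (Ioi s).indicator 1 u * jumpRate A X j (u, ω) ∂leb ∂P := by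
  classical
  obtain ⟨m, hm⟩ := hA.bounded
  have hB' : MeasurableSet B := (completedFiltration P X hX).le _ _ hB
  have hBt := measurableSet_awaySet (P := P) (hX := hX) hB j
  rw [← integral_indicator hB', ← integral_indicator hB']
  -- Both sides of `IsMarkovChain.integral_gridSum` pass to the limit by dominated convergence: the
  -- sums are dominated by the number of jumps, the time integrals by the bound on the rates.
  have h1 : Tendsto (fun n => ∫ ω, gridSum X (awaySet X B s j) L n j ω ∂P) atTop
      (𝓝 (∫ ω, B.indicator (fun ω => jumpCount X L j s ω) ω ∂P)) := by
    refine tendsto_integral_of_dominated_convergence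
      (fun ω => ((jumps (fun t => X t ω) L).card : ℝ))
      (fun n => (hM.measurable_gridSum hBt L n j).aestronglyMeasurable) ?_
      (fun n => ae_of_all _ fun ω => hM.abs_gridSum_le _ _ _ _ _)
      (ae_of_all _ fun ω => hM.tendsto_gridSum B s L j ω)
    simp_rw [hM.card_jumps_eq]
    exact integrable_finsetSum _ fun j _ => hM.integrable_jumpCount_zero hA L j
  refine tendsto_nhds_unique h1 ?_
  simp_rw [fun n => hM.integral_gridSum hA hBt L n j]
  have hbd : ∀ t : ℝ≥0, ∀ ω, |(awaySet X B s j t).indicator (1 : Ω → ℝ) ω| ≤ 1 := fun t ω => by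
    rw [indicator_apply]; split_ifs <;> simp
  refine tendsto_integral_of_dominated_convergence (fun _ => m * leb.real (Ioc 0 (L : ℝ≥0)))
    (fun n => ?_) (integrable_const _)
    (fun n => ae_of_all _ fun ω => hM.abs_integral_mulVec_le hm _ _ _ (fun u => hbd _ ω) ω j)
    (ae_of_all _ fun ω => ?_)
  · simp_rw [gridIntegral_eq hA hM]
    exact (Finset.measurable_sum _ fun k _ => (hM.measurable_integral_mulVec hA _ _ j).indicator
      ((completedFiltration P X hX).le _ _ (hBt _))).aestronglyMeasurable
  · have e : B.indicator (fun ω => ∫ u in Ioc 0 (L : ℝ≥0),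
        (Ioi s).indicator 1 u * jumpRate A X j (u, ω) ∂leb) ω
        = ∫ u in Ioc 0 (L : ℝ≥0), B.indicator 1 ω * ((Ioi s).indicator 1 u
          * jumpRate A X j (u, ω)) ∂leb := by
      by_cases hω : ω ∈ B <;> simp [hω]
    rw [e]
    refine tendsto_integral_of_dominated_convergence (fun _ => m) (fun n => ?_)
      (integrable_const _) (fun n => ae_of_all _ fun u => ?_) ?_
    · refine AEStronglyMeasurable.mul ?_ (hM.integrableOn_mulVec hA _ _ ω j).1
      have hg : Measurable (gridLeft n) :=
        (measurable_from_top (f := fun k : ℕ => ((k - 1 : ℕ) : ℝ≥0))).comp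
          (Nat.measurable_ceil.comp (measurable_id.mul_const _)) |>.div_const _
      -- For fixed ω the condition depends on u only through a ceiling in ℕ, where every set is
      -- measurable.
      have hs : MeasurableSet {u : ℝ≥0 | ω ∈ awaySet X B s j (gridLeft n u)} := by
        have : {u : ℝ≥0 | ω ∈ awaySet X B s j (gridLeft n u)}
            = (fun u : ℝ≥0 => ⌈u * (n + 1)⌉₊) ⁻¹'
              {k | ω ∈ awaySet X B s j (((k - 1 : ℕ) : ℝ≥0) / (n + 1))} := rfl
        rw [this]
        exact (Nat.measurable_ceil.comp (measurable_id.mul_const _)) trivial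
      have : (fun u => (awaySet X B s j (gridLeft n u)).indicator (1 : Ω → ℝ) ω)
          = {u : ℝ≥0 | ω ∈ awaySet X B s j (gridLeft n u)}.indicator 1 := by
        ext u; simp [indicator_apply]
      rw [this]
      exact (measurable_one.indicator hs).aestronglyMeasurable
    · rw [Real.norm_eq_abs, abs_mul]
      have h1 := hM.abs_mulVec_le hm u u ω j
      nlinarith [hbd (gridLeft n u) ω, abs_nonneg ((awaySet X B s j (gridLeft n u)).indicator
        (1 : Ω → ℝ) ω), abs_nonneg ((A u *ᵥ X u ω) j)]
    · filter_upwards [hM.ae_leftX_eq ω L, ae_restrict_mem measurableSet_Ioc] with u hu huL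
      refine tendsto_const_nhds.congr' ?_
      have h1 : ∀ᶠ n in atTop, X (gridLeft n u) ω = leftX X u ω :=
        (tendsto_gridLeft huL.1).eventually
          (eventually_left_eq (hM.finite_range ω) (hM.rcll ω) u)
      have h2 : ∀ᶠ n in atTop, (s ≤ gridLeft n u ↔ s < u) := by
        rcases lt_or_ge s u with h | h
        · filter_upwards [(tendsto_gridLeft huL.1).eventually (Ioo_mem_nhdsLT h)] with n hn
          exact ⟨fun _ => h, fun _ => hn.1.le⟩
        · refine Eventually.of_forall fun n =>
            ⟨fun h' => h'.trans_lt (gridLeft_lt n huL.1), fun h' => ?_⟩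
          exact absurd h' (not_lt.2 h)
      filter_upwards [h1, h2] with n hn hs
      have hmem : ω ∈ awaySet X B s j (gridLeft n u) ↔ ω ∈ B ∧ s < u ∧ leftX X u ω j ≠ 1 := by
        simp only [awaySet, mem_ofPred_eq, hs, hn]
      rw [indicator_apply (awaySet X B s j (gridLeft n u))]
      simp only [hmem, Pi.one_apply, jumpRate, ← hu]
      by_cases hω : ω ∈ B <;> by_cases hsu : s < u <;> by_cases hl : leftX X u ω j = 1 <;>
        simp [hω, hsu, hl, hM.leftX_eq_zero_of_ne_one]

end Compensation

/-! ### The jump measure and its compensator on the predictable σ-algebra. -/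

section JumpKernel

open ProbabilityTheory

variable {Ω : Type*} [mΩ : MeasurableSpace Ω] {N : ℕ} {P : Measure Ω}
  {A : ℝ≥0 → Matrix (Fin N) (Fin N) ℝ} {X : ℝ≥0 → Ω → Fin N → ℝ} {hX : ∀ t, Measurable (X t)}

theorem IsMarkovChain.jumpRate_nonneg (hA : IsRateMatrix A) (hM : IsMarkovChain P A X hX)
    (j : Fin N) (p : ℝ≥0 × Ω) : 0 ≤ jumpRate A X j p := by
  obtain ⟨i, hi⟩ := hM.leftX_unit p.1 p.2
  rw [jumpRate, hi, Matrix.mulVec_single_one]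
  by_cases h : j = i
  · simp [h]
  · simpa [h] using hA.offDiag_nonneg p.1 j i h

theorem IsMarkovChain.jumpRate_le {m : ℝ} (hm : ∀ t i j, |A t i j| ≤ m)
    (hM : IsMarkovChain P A X hX) (j : Fin N) (p : ℝ≥0 × Ω) : jumpRate A X j p ≤ m := by
  obtain ⟨i, hi⟩ := hM.leftX_unit p.1 p.2
  rw [jumpRate, hi, Matrix.mulVec_single_one]
  have h0 := (abs_nonneg _).trans (hm 0 i i)
  by_cases h : j = i
  · simpa [h] using h0
  · simpa [h] using (le_abs_self _).trans (hm p.1 j i)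

theorem IsMarkovChain.measurable_jumpRate (hA : IsRateMatrix A) (hM : IsMarkovChain P A X hX)
    (j : Fin N) : Measurable (jumpRate A X j) := by
  have h := fun l => (hM.measurable_leftX l).mono (predictable_le _) le_rfl
  change Measurable fun p : ℝ≥0 × Ω =>
    (1 - leftX X p.1 p.2 j) * ∑ l, A p.1 j l * leftX X p.1 p.2 l
  exact (measurable_const.sub (h j)).mul (Finset.measurable_sum _ fun l _ =>
    ((hA.measurable j l).comp measurable_fst).mul (h l))

theorem integrable_integral_of_compProd {β : Type*} [MeasurableSpace β] [SFinite P]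
    {κ : Kernel Ω β} [IsSFiniteKernel κ] {f : Ω × β → ℝ} (hf : Integrable f (P ⊗ₘ κ)) :
    Integrable (fun ω => ∫ u, f (ω, u) ∂κ ω) P := by
  rw [Measure.compProd] at hf
  simpa using hf.integral_compProd

/-- The random measure counting the jumps into the state `j` in `(0,L]`. -/
noncomputable def jumpMeasure (X : ℝ≥0 → Ω → Fin N → ℝ) (L : ℝ≥0) (j : Fin N) (ω : Ω) :
    Measure ℝ≥0 :=
  ∑ u ∈ jumps (fun t => X t ω) L, if X u ω j = 1 then Measure.dirac u else 0

theorem lintegral_jumpMeasure {Ω : Type*} {N : ℕ} {X : ℝ≥0 → Ω → Fin N → ℝ}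
    (L : ℝ≥0) (j : Fin N) (ω : Ω) (g : ℝ≥0 → ℝ≥0∞) :
    ∫⁻ u, g u ∂(jumpMeasure X L j ω)
      = ∑ u ∈ jumps (fun t => X t ω) L, if X u ω j = 1 then g u else 0 := by
  rw [jumpMeasure, lintegral_finsetSum_measure]
  refine Finset.sum_congr rfl fun u _ => ?_
  split_ifs <;> simp

theorem integral_jumpMeasure {Ω : Type*} {N : ℕ} {X : ℝ≥0 → Ω → Fin N → ℝ}
    (L : ℝ≥0) (j : Fin N) (ω : Ω) (g : ℝ≥0 → ℝ) :
    ∫ u, g u ∂(jumpMeasure X L j ω)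
      = ∑ u ∈ jumps (fun t => X t ω) L, if X u ω j = 1 then g u else 0 := by
  rw [jumpMeasure, integral_finsetSum_measure]
  · refine Finset.sum_congr rfl fun u _ => ?_
    split_ifs <;> simp
  · intro u _
    split_ifs
    · exact integrable_dirac (by simp)
    · exact integrable_zero_measure

theorem jumpMeasure_Ioi {Ω : Type*} {N : ℕ} {X : ℝ≥0 → Ω → Fin N → ℝ}
    (L : ℝ≥0) (j : Fin N) (s : ℝ≥0) (ω : Ω) :
    jumpMeasure X L j ω (Ioi s) = ENNReal.ofReal (jumpCount X L j s ω) := by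
  rw [← lintegral_indicator_one measurableSet_Ioi, lintegral_jumpMeasure, jumpCount,
    ENNReal.ofReal_sum_of_nonneg fun u _ => by split_ifs <;> simp]
  refine Finset.sum_congr rfl fun u _ => ?_
  by_cases h1 : s < u <;> by_cases h2 : X u ω j = 1 <;> simp [h1, h2]

theorem IsMarkovChain.jumpMeasure_univ (hM : IsMarkovChain P A X hX) (L : ℝ≥0) (j : Fin N) (ω : Ω) :
    jumpMeasure X L j ω univ = ENNReal.ofReal (jumpCount X L j 0 ω) := by
  rw [← jumpMeasure_Ioi, ← lintegral_indicator_one measurableSet_Ioi,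
    ← lintegral_indicator_one MeasurableSet.univ, lintegral_jumpMeasure, lintegral_jumpMeasure]
  refine Finset.sum_congr rfl fun u hu => ?_
  have hu0 := pos_of_mem_jumps (hM.finite_range ω) (hM.rcll ω) hu
  simp [hu0]

/-- The random measure `jumpMeasure` as a kernel. -/
noncomputable def jumpKernel (hM : IsMarkovChain P A X hX) (L : ℕ) (j : Fin N) : Kernel Ω ℝ≥0 where
  toFun := jumpMeasure X L j
  measurable' := by
    have hf : ∀ ω, IsFiniteMeasure (jumpMeasure X L j ω) := fun ω =>
      ⟨by rw [hM.jumpMeasure_univ]; exact ENNReal.ofReal_lt_top⟩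
    refine Measurable.measure_of_isPiSystem
      ((BorelSpace.measurable_eq (α := ℝ≥0)).trans (borel_eq_generateFrom_Ioi ℝ≥0))
      isPiSystem_Ioi ?_ ?_
    · rintro _ ⟨s, rfl⟩
      simp_rw [jumpMeasure_Ioi]
      exact (hM.measurable_jumpCount L j s).ennreal_ofReal
    · simp_rw [hM.jumpMeasure_univ]
      exact (hM.measurable_jumpCount L j 0).ennreal_ofReal

/-- The number of jumps is finite for each ω but need not be bounded in ω, so the kernel is cut into
finite pieces by the integer part of the count. -/
instance isSFiniteKernel_jumpKernel (hM : IsMarkovChain P A X hX) (L : ℕ) (j : Fin N) :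
    IsSFiniteKernel (jumpKernel hM L j) := by
  classical
  have hm : ∀ n : ℕ, MeasurableSet {ω | ⌊jumpCount X L j 0 ω⌋₊ = n} := fun n =>
    (Nat.measurable_floor.comp (hM.measurable_jumpCount L j 0)) (measurableSet_singleton n)
  refine ⟨⟨fun n => Kernel.piecewise (hm n) (jumpKernel hM L j) 0, fun n => ?_, ?_⟩⟩
  · refine ⟨⟨n + 1, by simp, fun ω => ?_⟩⟩
    rw [Kernel.piecewise_apply]
    split_ifs with h
    · change jumpMeasure X L j ω univ ≤ _
      rw [hM.jumpMeasure_univ]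
      have h1 : jumpCount X L j 0 ω ≤ (n + 1 : ℕ) := by
        have := Nat.lt_floor_add_one (jumpCount X L j 0 ω)
        rw [show ⌊jumpCount X L j 0 ω⌋₊ = n from h] at this
        exact_mod_cast this.le
      calc ENNReal.ofReal (jumpCount X L j 0 ω) ≤ ENNReal.ofReal (n + 1 : ℕ) :=
            ENNReal.ofReal_le_ofReal h1
        _ = n + 1 := by rw [ENNReal.ofReal_natCast]; simp
    · simp
  · ext ω s hs
    rw [Kernel.sum_apply' _ _ hs, tsum_eq_single ⌊jumpCount X L j 0 ω⌋₊]
    · simp [Kernel.piecewise_apply]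
    · intro n hn
      rw [Kernel.piecewise_apply, if_neg]
      · simp
      · exact fun h => hn h.symm

/-- The compensator of `jumpMeasure` as a kernel. -/
noncomputable def rateKernel (A : ℝ≥0 → Matrix (Fin N) (Fin N) ℝ) (X : ℝ≥0 → Ω → Fin N → ℝ) (L : ℕ)
    (j : Fin N) : Kernel Ω ℝ≥0 :=
  Kernel.withDensity (Kernel.const Ω (leb.restrict (Ioc 0 (L : ℝ≥0))))
    fun ω u => ENNReal.ofReal (jumpRate A X j (u, ω))

theorem IsMarkovChain.measurable_uncurry_jumpRate (hA : IsRateMatrix A)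
    (hM : IsMarkovChain P A X hX) (j : Fin N) :
    Measurable (Function.uncurry fun ω u => ENNReal.ofReal (jumpRate A X j (u, ω))) :=
  ((hM.measurable_jumpRate hA j).comp measurable_swap).ennreal_ofReal

theorem IsMarkovChain.rateKernel_apply (hA : IsRateMatrix A) (hM : IsMarkovChain P A X hX) (L : ℕ)
    (j : Fin N) (ω : Ω) : rateKernel A X L j ω = (leb.restrict (Ioc 0 (L : ℝ≥0))).withDensity
      fun u => ENNReal.ofReal (jumpRate A X j (u, ω)) := by
  rw [rateKernel, Kernel.withDensity_apply _ (hM.measurable_uncurry_jumpRate hA j),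
    Kernel.const_apply]

instance isSFiniteKernel_rateKernel (L : ℕ) (j : Fin N) : IsSFiniteKernel (rateKernel A X L j) := by
  unfold rateKernel
  exact Kernel.IsSFiniteKernel.withDensity _ fun _ _ => ENNReal.ofReal_ne_top

theorem IsMarkovChain.measurable_jumpRate_section (hA : IsRateMatrix A)
    (hM : IsMarkovChain P A X hX) (j : Fin N) (ω : Ω) :
    Measurable fun u => jumpRate A X j (u, ω) :=
  (hM.measurable_jumpRate hA j).comp (measurable_id.prodMk measurable_const)

theorem IsMarkovChain.integrableOn_jumpRate (hA : IsRateMatrix A)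
    (hM : IsMarkovChain P A X hX) (L : ℝ≥0) (j : Fin N) (ω : Ω) :
    IntegrableOn (fun u => jumpRate A X j (u, ω)) (Ioc 0 L) leb := by
  obtain ⟨m, hm⟩ := hA.bounded
  exact Integrable.of_bound (hM.measurable_jumpRate_section hA j ω).aestronglyMeasurable m
    (ae_of_all _ fun u => by
      rw [Real.norm_of_nonneg (hM.jumpRate_nonneg hA j _)]
      exact hM.jumpRate_le hm j _)

theorem IsMarkovChain.rateKernel_Ioi (hA : IsRateMatrix A) (hM : IsMarkovChain P A X hX) (L : ℕ)
    (j : Fin N) (s : ℝ≥0) (ω : Ω) : rateKernel A X L j ω (Ioi s)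
      = ENNReal.ofReal (∫ u in Ioc 0 (L : ℝ≥0),
        (Ioi s).indicator 1 u * jumpRate A X j (u, ω) ∂leb) := by
  have e : ∀ u, (Ioi s).indicator 1 u * jumpRate A X j (u, ω)
      = (Ioi s).indicator (fun u => jumpRate A X j (u, ω)) u := fun u => by
    by_cases h : s < u <;> simp [h]
  simp_rw [e]
  rw [ofReal_integral_eq_lintegral_ofReal
    (Integrable.indicator (hM.integrableOn_jumpRate hA L j ω) measurableSet_Ioi)
    (ae_of_all _ fun u => indicator_apply_nonneg fun _ => hM.jumpRate_nonneg hA j _),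
    hM.rateKernel_apply hA, withDensity_apply _ measurableSet_Ioi,
    ← lintegral_indicator measurableSet_Ioi]
  refine lintegral_congr fun u => ?_
  by_cases h : s < u <;> simp [h]

variable [IsProbabilityMeasure P]

/-- The jumps into `j` and their compensator, as measures on the predictable `σ`-algebra. -/
theorem IsMarkovChain.trim_jumpKernel_eq (hA : IsRateMatrix A) (hM : IsMarkovChain P A X hX)
    (L : ℕ) (j : Fin N) :
    ((P ⊗ₘ jumpKernel hM L j).map Prod.swap).trim (predictable_le (completedFiltration P X hX))
      = ((P ⊗ₘ rateKernel A X L j).map Prod.swap).trim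
        (predictable_le (completedFiltration P X hX)) := by
  obtain ⟨m, hm⟩ := hA.bounded
  set ℱ := completedFiltration P X hX with hℱ
  -- On a rectangle `(s,∞) × B` with B in ℱ_s the equality is `IsMarkovChain.setIntegral_jumpCount`;
  -- integrability of the count gives finiteness.
  have key : ∀ (s : ℝ≥0) (B : Set Ω), MeasurableSet[ℱ s] B →
      ((P ⊗ₘ jumpKernel hM L j).map Prod.swap) (Ioi s ×ˢ B)
        = ((P ⊗ₘ rateKernel A X L j).map Prod.swap) (Ioi s ×ˢ B) ∧
      ((P ⊗ₘ jumpKernel hM L j).map Prod.swap) (Ioi s ×ˢ B) < ∞ := by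
    intro s B hB
    have hB' : MeasurableSet B := ℱ.le _ _ hB
    have hI := hM.integrable_jumpCount hA L j s
    have h1 : ((P ⊗ₘ jumpKernel hM L j).map Prod.swap) (Ioi s ×ˢ B)
        = ENNReal.ofReal (∫ ω in B, jumpCount X L j s ω ∂P) := by
      rw [Measure.map_apply measurable_swap (measurableSet_Ioi.prod hB'), preimage_swap_prod,
        Measure.compProd_apply_prod hB' measurableSet_Ioi,
        ofReal_integral_eq_lintegral_ofReal hI.integrableOn
          (ae_of_all _ fun ω => jumpCount_nonneg _ _ _ _)]
      exact lintegral_congr fun ω => jumpMeasure_Ioi _ _ _ _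
    have h2 : ((P ⊗ₘ rateKernel A X L j).map Prod.swap) (Ioi s ×ˢ B)
        = ENNReal.ofReal (∫ ω in B, ∫ u in Ioc 0 (L : ℝ≥0),
          (Ioi s).indicator 1 u * jumpRate A X j (u, ω) ∂leb ∂P) := by
      rw [Measure.map_apply measurable_swap (measurableSet_Ioi.prod hB'), preimage_swap_prod,
        Measure.compProd_apply_prod hB' measurableSet_Ioi, ofReal_integral_eq_lintegral_ofReal]
      · exact lintegral_congr fun ω => hM.rateKernel_Ioi hA _ _ _ _
      · have hmeas : Measurable fun p : Ω × ℝ≥0 =>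
            (Ioi s).indicator 1 p.2 * jumpRate A X j (p.2, p.1) :=
          ((measurable_one.indicator measurableSet_Ioi).comp measurable_snd).mul
            ((hM.measurable_jumpRate hA j).comp measurable_swap)
        refine Integrable.of_bound
          (StronglyMeasurable.integral_prod_right hmeas.stronglyMeasurable).aestronglyMeasurable
          (m * leb.real (Ioc 0 (L : ℝ≥0))) (ae_of_all _ fun ω => ?_)
        refine norm_setIntegral_le_of_norm_le_const
          (measure_lt_top_of_subset Subset.rfl (by rw [leb_Ioc]; simp)) fun u _ => ?_
        rw [norm_mul, Real.norm_of_nonneg (hM.jumpRate_nonneg hA j _)]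
        have h3 := hM.jumpRate_le hm j (u, ω)
        have h4 := hM.jumpRate_nonneg hA j (u, ω)
        by_cases h : s < u
        · simpa [h] using h3
        · simpa [h] using h4.trans h3
      · exact ae_of_all _ fun ω => integral_nonneg fun u =>
          mul_nonneg (indicator_nonneg (fun _ _ => zero_le_one) _) (hM.jumpRate_nonneg hA j _)
    refine ⟨?_, h1 ▸ ENNReal.ofReal_lt_top⟩
    rw [h1, h2, hM.setIntegral_jumpCount hA L j hB]
  -- The generators at time 0 are null for both measures: no jump occurs at time 0, and the
  -- compensator has a density in time.
  have key0 : ∀ B : Set Ω, MeasurableSet[ℱ ⊥] B →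
      ((P ⊗ₘ jumpKernel hM L j).map Prod.swap) ({⊥} ×ˢ B) = 0 ∧
        ((P ⊗ₘ rateKernel A X L j).map Prod.swap) ({⊥} ×ˢ B) = 0 := by
    intro B hB
    have hB' : MeasurableSet B := ℱ.le _ _ hB
    have hs : MeasurableSet ({⊥} : Set ℝ≥0) := measurableSet_singleton _
    rw [Measure.map_apply measurable_swap (hs.prod hB'), preimage_swap_prod,
      Measure.map_apply measurable_swap (hs.prod hB'), preimage_swap_prod,
      Measure.compProd_apply_prod hB' hs, Measure.compProd_apply_prod hB' hs]
    constructor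
    · rw [lintegral_eq_zero_iff' (Kernel.measurable_coe _ hs).aemeasurable]
      refine ae_of_all _ fun ω => ?_
      change jumpMeasure X L j ω {⊥} = 0
      rw [← lintegral_indicator_one hs, lintegral_jumpMeasure]
      refine Finset.sum_eq_zero fun u hu => ?_
      have hu0 := pos_of_mem_jumps (hM.finite_range ω) (hM.rcll ω) hu
      simp [hu0.ne']
    · rw [lintegral_eq_zero_iff' (Kernel.measurable_coe _ hs).aemeasurable]
      refine ae_of_all _ fun ω => ?_
      simp only [hM.rateKernel_apply hA, Pi.zero_apply]
      exact withDensity_absolutelyContinuous _ _ (Measure.restrict_le_self.absolutelyContinuous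
        (measure_singleton _))
  have huniv : (univ : Set (ℝ≥0 × Ω)) = Ioi 0 ×ˢ univ ∪ {⊥} ×ˢ univ := by
    ext ⟨u, ω⟩
    simp only [mem_univ, mem_union, mem_prod, mem_Ioi, and_true, mem_singleton_iff, true_iff]
    exact (eq_or_ne u ⊥).symm.imp (fun h => pos_iff_ne_zero.2 h) id
  have hdisj : Disjoint (Ioi (0 : ℝ≥0) ×ˢ (univ : Set Ω)) (({⊥} : Set ℝ≥0) ×ˢ univ) := by
    rw [Set.disjoint_left]
    rintro ⟨u, ω⟩ h1 h2
    exact (h1.1 : 0 < u).ne' h2.1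
  have hmu : MeasurableSet (({⊥} : Set ℝ≥0) ×ˢ (univ : Set Ω)) :=
    (measurableSet_singleton _).prod MeasurableSet.univ
  have huniv1 : ∀ ν : Measure (ℝ≥0 × Ω), ν univ = ν (Ioi 0 ×ˢ univ) + ν ({⊥} ×ˢ univ) := fun ν => by
    rw [huniv, measure_union hdisj hmu]
  have hfin : IsFiniteMeasure (((P ⊗ₘ jumpKernel hM L j).map Prod.swap).trim
      (predictable_le ℱ)) := by
    refine ⟨?_⟩
    rw [trim_measurableSet_eq _ MeasurableSet.univ, huniv1, (key0 _ MeasurableSet.univ).1, add_zero]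
    exact (key _ _ MeasurableSet.univ).2
  -- The generating rectangles form a π-system: two of the same kind intersect in that kind, and two
  -- of different kinds are disjoint.
  refine @ext_of_generate_finite _ ℱ.predictable _ _ _ rfl ?_ hfin ?_ ?_
  · rintro _ (⟨B, hB, rfl⟩ | ⟨s, B, hB, rfl⟩) _ (⟨B', hB', rfl⟩ | ⟨s', B', hB', rfl⟩) hne
    · left
      exact ⟨B ∩ B', @MeasurableSet.inter _ (ℱ ⊥) _ _ hB hB', by rw [prod_inter_prod, inter_self]⟩
    · obtain ⟨⟨u, ω⟩, h1, h2⟩ := hne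
      exact absurd (h1.1 : u = ⊥) (ne_bot_of_gt h2.1)
    · obtain ⟨⟨u, ω⟩, h1, h2⟩ := hne
      exact absurd (h2.1 : u = ⊥) (ne_bot_of_gt h1.1)
    · right
      refine ⟨s ⊔ s', B ∩ B', ?_, by rw [prod_inter_prod, Ioi_inter_Ioi]⟩
      exact @MeasurableSet.inter _ (ℱ (s ⊔ s')) _ _ (ℱ.mono le_sup_left _ hB)
        (ℱ.mono le_sup_right _ hB')
  · rintro _ (⟨B, hB, rfl⟩ | ⟨s, B, hB, rfl⟩)
    · rw [trim_measurableSet_eq _ (measurableSet_predictable_singleton_bot_prod hB),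
        trim_measurableSet_eq _ (measurableSet_predictable_singleton_bot_prod hB),
        (key0 _ hB).1, (key0 _ hB).2]
    · rw [trim_measurableSet_eq _ (measurableSet_predictable_Ioi_prod hB),
        trim_measurableSet_eq _ (measurableSet_predictable_Ioi_prod hB)]
      exact (key _ _ hB).1
  · rw [trim_measurableSet_eq _ MeasurableSet.univ, trim_measurableSet_eq _ MeasurableSet.univ,
      huniv1, huniv1, (key0 _ MeasurableSet.univ).1, (key0 _ MeasurableSet.univ).2,
      (key _ _ MeasurableSet.univ).1]

/-- Compensation formula for nonnegative predictable integrands. -/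
theorem IsMarkovChain.lintegral_jumpSum (hA : IsRateMatrix A) (hM : IsMarkovChain P A X hX)
    (L : ℕ) (j : Fin N) {G : ℝ≥0 × Ω → ℝ≥0∞}
    (hG : Measurable[(completedFiltration P X hX).predictable] G) :
    ∫⁻ ω, ∑ u ∈ jumps (fun t => X t ω) L, (if X u ω j = 1 then G (u, ω) else 0) ∂P
      = ∫⁻ ω, ∫⁻ u in Ioc 0 (L : ℝ≥0), ENNReal.ofReal (jumpRate A X j (u, ω)) * G (u, ω) ∂leb ∂P := by
  have hle := predictable_le (completedFiltration P X hX)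
  have hG' : Measurable G := hG.mono hle le_rfl
  -- The two measures agree only on the predictable σ-algebra, so the integral is passed through the
  -- trimmed measures; this is where predictability of `G` is indispensable.
  have h1 : ∫⁻ p, G p ∂((P ⊗ₘ jumpKernel hM L j).map Prod.swap)
      = ∫⁻ p, G p ∂((P ⊗ₘ rateKernel A X L j).map Prod.swap) := by
    rw [← lintegral_trim hle hG, ← lintegral_trim hle hG, hM.trim_jumpKernel_eq hA]
  rw [lintegral_map hG' measurable_swap, lintegral_map hG' measurable_swap,
    Measure.lintegral_compProd (f := fun p => G p.swap) (hG'.comp measurable_swap),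
    Measure.lintegral_compProd (f := fun p => G p.swap) (hG'.comp measurable_swap)] at h1
  convert h1 using 1
  · exact lintegral_congr fun ω => (lintegral_jumpMeasure _ _ _ _).symm
  · refine lintegral_congr fun ω => ?_
    rw [hM.rateKernel_apply hA, lintegral_withDensity_eq_lintegral_mul₀
      (hM.measurable_jumpRate_section hA j ω).ennreal_ofReal.aemeasurable]
    · rfl
    · exact (hG'.comp (measurable_id.prodMk measurable_const)).aemeasurable

/-- Compensation formula for real predictable integrands. -/
theorem IsMarkovChain.integral_jumpSum (hA : IsRateMatrix A) (hM : IsMarkovChain P A X hX)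
    (L : ℕ) (j : Fin N) {G : ℝ≥0 × Ω → ℝ}
    (hG : Measurable[(completedFiltration P X hX).predictable] G)
    (hfin : ∫⁻ ω, ∫⁻ u in Ioc 0 (L : ℝ≥0),
      ENNReal.ofReal (jumpRate A X j (u, ω)) * ‖G (u, ω)‖ₑ ∂leb ∂P < ∞) :
    Integrable (fun ω => ∑ u ∈ jumps (fun t => X t ω) L, if X u ω j = 1 then G (u, ω) else 0) P ∧
    Integrable (fun ω => ∫ u in Ioc 0 (L : ℝ≥0), jumpRate A X j (u, ω) * G (u, ω) ∂leb) P ∧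
    ∫ ω, ∑ u ∈ jumps (fun t => X t ω) L, (if X u ω j = 1 then G (u, ω) else 0) ∂P
      = ∫ ω, ∫ u in Ioc 0 (L : ℝ≥0), jumpRate A X j (u, ω) * G (u, ω) ∂leb ∂P := by
  have hle := predictable_le (completedFiltration P X hX)
  have hG' : Measurable G := hG.mono hle le_rfl
  have h1 : ∫ p, G p ∂((P ⊗ₘ jumpKernel hM L j).map Prod.swap)
      = ∫ p, G p ∂((P ⊗ₘ rateKernel A X L j).map Prod.swap) := by
    rw [integral_trim hle (hG.stronglyMeasurable), integral_trim hle (hG.stronglyMeasurable),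
      hM.trim_jumpKernel_eq hA]
  have hGe : Measurable[(completedFiltration P X hX).predictable] fun p => ‖G p‖ₑ :=
    measurable_enorm.comp hG
  have hlin := hM.lintegral_jumpSum hA L j hGe
  have hi1 : Integrable (G ∘ Prod.swap) (P ⊗ₘ jumpKernel hM L j) := by
    refine ⟨(hG'.comp measurable_swap).aestronglyMeasurable, ?_⟩
    rw [HasFiniteIntegral, Measure.lintegral_compProd (hG'.comp measurable_swap).enorm]
    rw [← hlin] at hfin
    convert hfin using 1
    exact lintegral_congr fun ω => lintegral_jumpMeasure _ _ _ _
  have hrate : ∀ ω, ∫⁻ u, ‖G (u, ω)‖ₑ ∂(rateKernel A X L j ω) = ∫⁻ u in Ioc 0 (L : ℝ≥0),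
      ENNReal.ofReal (jumpRate A X j (u, ω)) * ‖G (u, ω)‖ₑ ∂leb := fun ω => by
    rw [hM.rateKernel_apply hA, lintegral_withDensity_eq_lintegral_mul₀
      (hM.measurable_jumpRate_section hA j ω).ennreal_ofReal.aemeasurable]
    · rfl
    · exact (hG'.comp (measurable_id.prodMk measurable_const)).enorm.aemeasurable
  have hi2 : Integrable (G ∘ Prod.swap) (P ⊗ₘ rateKernel A X L j) := by
    refine ⟨(hG'.comp measurable_swap).aestronglyMeasurable, ?_⟩
    rw [HasFiniteIntegral, Measure.lintegral_compProd (hG'.comp measurable_swap).enorm]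
    convert hfin using 1
    exact lintegral_congr fun ω => hrate ω
  have hint : ∀ ω, ∫ u, G (u, ω) ∂(rateKernel A X L j ω)
      = ∫ u in Ioc 0 (L : ℝ≥0), jumpRate A X j (u, ω) * G (u, ω) ∂leb := fun ω => by
    rw [hM.rateKernel_apply hA, integral_withDensity_eq_integral_toReal_smul
      (hM.measurable_jumpRate_section hA j ω).ennreal_ofReal
      (ae_of_all _ fun _ => ENNReal.ofReal_lt_top)]
    refine integral_congr_ae (ae_of_all _ fun u => ?_)
    simp [ENNReal.toReal_ofReal (hM.jumpRate_nonneg hA j (u, ω))]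
  have e1 : ∀ ω, ∫ u, G (u, ω) ∂(jumpKernel hM L j ω)
      = ∑ u ∈ jumps (fun t => X t ω) L, if X u ω j = 1 then G (u, ω) else 0 :=
    fun ω => integral_jumpMeasure _ _ _ _
  refine ⟨?_, ?_, ?_⟩
  · simp_rw [← e1]
    exact integrable_integral_of_compProd hi1
  · simp_rw [← hint]
    exact integrable_integral_of_compProd hi2
  · rw [integral_map measurable_swap.aemeasurable hG'.aestronglyMeasurable,
      integral_map measurable_swap.aemeasurable hG'.aestronglyMeasurable] at h1
    have h2 := Measure.integral_compProd hi1
    have h3 := Measure.integral_compProd hi2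
    simp only [Function.comp_apply, Prod.swap_prod_mk] at h2 h3
    simp_rw [← e1, ← hint]
    rw [← h2, ← h3]
    exact h1

end JumpKernel

/-! ### Doob's `L²` inequality -/

section Doob

variable {Ω : Type*} [mΩ : MeasurableSpace Ω] {P : Measure Ω}

theorem two_mul_le_add_half_sq (a b : ℝ≥0∞) : 2 * (a * b) ≤ 2 * a ^ 2 + b ^ 2 / 2 := by
  rcases eq_or_ne a ∞ with rfl | ha
  · simp
  rcases eq_or_ne b ∞ with rfl | hb
  · simp [ENNReal.top_div]
  lift a to ℝ≥0 using ha
  lift b to ℝ≥0 using hb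
  have : 2 * (a * b) ≤ 2 * a ^ 2 + b ^ 2 / 2 := by
    rw [← NNReal.coe_le_coe]
    push_cast
    nlinarith [sq_nonneg (2 * (a : ℝ) - b)]
  calc (2 : ℝ≥0∞) * (a * b) = ((2 * (a * b) : ℝ≥0) : ℝ≥0∞) := by push_cast; rfl
    _ ≤ ((2 * a ^ 2 + b ^ 2 / 2 : ℝ≥0) : ℝ≥0∞) := by exact_mod_cast this
    _ = _ := by
      rw [ENNReal.coe_add, ENNReal.coe_div (by norm_num)]
      push_cast
      rfl

/-- Layer cake and the maximal inequality give E M² ≤ 2 E[f_n M], with M the running maximum. By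
Young the right side is at most 2 E f_n² + E M²/2, and the last term is absorbed. -/
theorem submartingale_lintegral_sup_sq_le [IsFiniteMeasure P] {𝒢 : Filtration ℕ mΩ}
    {f : ℕ → Ω → ℝ} (hsub : Submartingale f 𝒢 P) (h0 : 0 ≤ f) (hL2 : ∀ k, MemLp (f k) 2 P)
    (n : ℕ) :
    ∫⁻ ω, ENNReal.ofReal (((Finset.range (n + 1)).sup' Finset.nonempty_range_add_one
      fun k => f k ω) ^ 2) ∂P ≤ 4 * ∫⁻ ω, ENNReal.ofReal (f n ω ^ 2) ∂P := by
  set M : Ω → ℝ := fun ω => (Finset.range (n + 1)).sup' Finset.nonempty_range_add_one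
    fun k => f k ω with hM
  have hfm : ∀ k, Measurable (f k) := fun k =>
    ((hsub.stronglyMeasurable k).mono (𝒢.le k)).measurable
  have hMm : Measurable M := by
    have : M = (Finset.range (n + 1)).sup' Finset.nonempty_range_add_one f := by
      ext ω; simp [hM, Finset.sup'_apply]
    rw [this]
    exact Finset.measurable_sup' _ fun k _ => hfm k
  have hM0 : ∀ ω, 0 ≤ M ω := fun ω =>
    (h0 0 ω).trans (Finset.le_sup' (fun k => f k ω) (Finset.mem_range.2 n.succ_pos))
  -- Absorption requires E M² to be finite; M² is at most the finite sum of the squares.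
  have hfin : ∫⁻ ω, ENNReal.ofReal (M ω ^ 2) ∂P < ∞ := by
    have hle : ∀ ω, ENNReal.ofReal (M ω ^ 2)
        ≤ ∑ k ∈ Finset.range (n + 1), ENNReal.ofReal (f k ω ^ 2) := fun ω => by
      obtain ⟨k, hk, hk'⟩ := Finset.exists_mem_eq_sup' Finset.nonempty_range_add_one
        (s := Finset.range (n + 1)) (fun k => f k ω)
      change ENNReal.ofReal (((Finset.range (n + 1)).sup' _ fun k => f k ω) ^ 2) ≤ _
      rw [hk']
      exact Finset.single_le_sum (f := fun k => ENNReal.ofReal (f k ω ^ 2))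
        (fun _ _ => zero_le) hk
    refine (lintegral_mono hle).trans_lt ?_
    rw [lintegral_finsetSum _ fun k _ => ((hfm k).pow_const 2).ennreal_ofReal]
    exact ENNReal.sum_lt_top.2 fun k _ => (hL2 k).integrable_sq.lintegral_lt_top
  have hlayer : ∫⁻ ω, ENNReal.ofReal (M ω ^ 2) ∂P
      = 2 * ∫⁻ t in Ioi (0 : ℝ), P {ω | t ≤ M ω} * ENNReal.ofReal t := by
    have := lintegral_rpow_eq_lintegral_meas_le_mul P (ae_of_all _ hM0) hMm.aemeasurable
      (p := 2) two_pos
    norm_num at this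
    exact this
  have hmax : ∀ t ∈ Ioi (0 : ℝ), P {ω | t ≤ M ω} * ENNReal.ofReal t
      ≤ ∫⁻ ω, {ω | t ≤ M ω}.indicator (fun ω => ENNReal.ofReal (f n ω)) ω ∂P := by
    intro t ht
    obtain ⟨t, rfl⟩ : ∃ s : ℝ≥0, (s : ℝ) = t := ⟨⟨t, (mem_Ioi.1 ht).le⟩, rfl⟩
    have h1 := maximal_ineq hsub h0 (ε := t) n
    rw [lintegral_indicator (measurableSet_le measurable_const hMm),
      ← ofReal_integral_eq_lintegral_ofReal (hsub.integrable n).integrableOn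
        (ae_of_all _ fun ω => h0 n ω), mul_comm]
    rw [ENNReal.ofReal_coe_nnreal]
    exact h1
  have hswap : ∫⁻ t in Ioi (0 : ℝ), ∫⁻ ω,
        {ω | t ≤ M ω}.indicator (fun ω => ENNReal.ofReal (f n ω)) ω ∂P
      = ∫⁻ ω, ENNReal.ofReal (f n ω) * ENNReal.ofReal (M ω) ∂P := by
    have hms : MeasurableSet {p : ℝ × Ω | p.1 ≤ M p.2} :=
      measurableSet_le measurable_fst (hMm.comp measurable_snd)
    have hmeas : Measurable (Function.uncurry fun (t : ℝ) (ω : Ω) =>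
        {ω | t ≤ M ω}.indicator (fun ω => ENNReal.ofReal (f n ω)) ω) :=
      ((hfm n).ennreal_ofReal.comp measurable_snd).indicator hms
    rw [lintegral_lintegral_swap hmeas.aemeasurable]
    refine lintegral_congr fun ω => ?_
    have e : ∀ t : ℝ, {ω | t ≤ M ω}.indicator (fun ω => ENNReal.ofReal (f n ω)) ω
        = (Iic (M ω)).indicator (fun _ => ENNReal.ofReal (f n ω)) t := fun t => by
      by_cases h : t ≤ M ω <;> simp [h]
    simp_rw [e]
    rw [lintegral_indicator measurableSet_Iic, Measure.restrict_restrict measurableSet_Iic,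
      inter_comm, Ioi_inter_Iic, lintegral_const, Measure.restrict_apply_univ, Real.volume_Ioc,
      sub_zero]
  have hmain : ∫⁻ ω, ENNReal.ofReal (M ω ^ 2) ∂P
      ≤ 2 * ∫⁻ ω, ENNReal.ofReal (f n ω ^ 2) ∂P + (∫⁻ ω, ENNReal.ofReal (M ω ^ 2) ∂P) / 2 := by
    calc ∫⁻ ω, ENNReal.ofReal (M ω ^ 2) ∂P
        ≤ 2 * ∫⁻ ω, ENNReal.ofReal (f n ω) * ENNReal.ofReal (M ω) ∂P := by
          rw [hlayer, ← hswap]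
          gcongr 2 * ?_
          exact setLIntegral_mono' measurableSet_Ioi hmax
      _ = ∫⁻ ω, 2 * (ENNReal.ofReal (f n ω) * ENNReal.ofReal (M ω)) ∂P := by
          rw [lintegral_const_mul (f := fun ω => ENNReal.ofReal (f n ω) * ENNReal.ofReal (M ω)) _
            ((hfm n).ennreal_ofReal.mul hMm.ennreal_ofReal)]
      _ ≤ ∫⁻ ω, (2 * ENNReal.ofReal (f n ω) ^ 2 + ENNReal.ofReal (M ω) ^ 2 / 2) ∂P :=
          lintegral_mono fun ω => two_mul_le_add_half_sq _ _
      _ = _ := by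
          simp_rw [div_eq_mul_inv]
          rw [lintegral_add_left ((((hfm n).ennreal_ofReal.pow_const 2)).const_mul 2),
            lintegral_const_mul _ ((hfm n).ennreal_ofReal.pow_const 2),
            lintegral_mul_const _ (hMm.ennreal_ofReal.pow_const 2)]
          simp_rw [← ENNReal.ofReal_pow (h0 n _), ← ENNReal.ofReal_pow (hM0 _)]
  set a := ∫⁻ ω, ENNReal.ofReal (M ω ^ 2) ∂P
  have h2 : a / 2 + a / 2 ≤ 2 * ∫⁻ ω, ENNReal.ofReal (f n ω ^ 2) ∂P + a / 2 := by
    rwa [ENNReal.add_halves]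
  have h3 : a / 2 ≤ 2 * ∫⁻ ω, ENNReal.ofReal (f n ω ^ 2) ∂P :=
    (ENNReal.add_le_add_iff_right (ENNReal.div_lt_top hfin.ne two_ne_zero).ne).1 h2
  calc a = 2 * (a / 2) := (ENNReal.mul_div_cancel two_ne_zero ENNReal.ofNat_ne_top).symm
    _ ≤ 2 * (2 * ∫⁻ ω, ENNReal.ofReal (f n ω ^ 2) ∂P) := by gcongr
    _ = _ := by rw [← mul_assoc]; norm_num

/-- Conditional Jensen for the square. -/
theorem integrable_condExp_sq [IsProbabilityMeasure P] {m : MeasurableSpace Ω} (hm : m ≤ mΩ)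
    {G : Ω → ℝ} (hG : MemLp G 2 P) :
    MemLp (P[G|m]) 2 P ∧ ∫ ω, (P[G|m] ω) ^ 2 ∂P ≤ ∫ ω, G ω ^ 2 ∂P := by
  have hGi : Integrable G P := hG.integrable one_le_two
  have hsq := hG.integrable_sq
  have hj : ∀ᵐ ω ∂P, (P[G|m] ω) ^ 2 ≤ P[fun ω => G ω ^ 2|m] ω := by
    have := ConvexOn.map_condExp_le_univ (μ := P) (f := G) hm (even_two.convexOn_pow (𝕜 := ℝ))
      (continuous_pow 2).lowerSemicontinuous hGi hsq
    exact this
  have hmeas : AEStronglyMeasurable[mΩ] (P[G|m]) P :=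
    (stronglyMeasurable_condExp.mono hm).aestronglyMeasurable
  have hi : Integrable (fun ω => (P[G|m] ω) ^ 2) P :=
    integrable_condExp.mono' (hmeas.pow 2) (hj.mono fun ω h => by
      rwa [Real.norm_of_nonneg (sq_nonneg _)])
  refine ⟨(memLp_two_iff_integrable_sq hmeas).2 hi, ?_⟩
  calc _ ≤ ∫ ω, P[fun ω => G ω ^ 2|m] ω ∂P := integral_mono_ae hi integrable_condExp hj
    _ = _ := integral_condExp hm

theorem lintegral_finset_sup_sq_le [IsProbabilityMeasure P] {ℱ : Filtration ℝ≥0 mΩ} {T : ℝ≥0}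
    {y : ℝ≥0 → Ω → ℝ} {G : Ω → ℝ} (hG : MemLp G 2 P)
    (hy : ∀ t ≤ T, ∀ᵐ ω ∂P, |y t ω| ≤ P[G|ℱ t] ω) (n : ℕ) :
    ∫⁻ ω, ⨆ k ∈ Finset.range (n + 2), ‖y (T * (k / (n + 1))) ω‖ₑ ^ 2 ∂P
      ≤ 4 * ∫⁻ ω, ‖G ω‖ₑ ^ 2 ∂P := by
  let 𝒢 : Filtration ℕ mΩ :=
    { seq := fun k => ℱ (T * (k / (n + 1)))
      mono' := fun i j hij => ℱ.mono (by gcongr)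
      le' := fun k => ℱ.le _ }
  -- The maximal inequality wants a pointwise nonnegative submartingale. The conditional
  -- expectations need not be nonnegative everywhere, and their positive parts still dominate |y|.
  let f : ℕ → Ω → ℝ := fun k ω => (P[G|𝒢 k] ω)⁺
  have hmart : Martingale (fun k => P[G|𝒢 k]) 𝒢 P := martingale_condExp G 𝒢 P
  have hsub : Submartingale f 𝒢 P := hmart.submartingale.pos
  have h0 : 0 ≤ f := fun k ω => posPart_nonneg _
  have hpos : ∀ a : ℝ, a⁺ ≤ |a| := fun a => sup_le (le_abs_self a) (abs_nonneg a)
  have hbd : ∀ k ω, f k ω ^ 2 ≤ (P[G|𝒢 k] ω) ^ 2 := fun k ω => by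
    rw [← sq_abs (P[G|𝒢 k] ω)]
    exact pow_le_pow_left₀ (h0 k ω) (hpos _) 2
  have hfL2 : ∀ k, MemLp (f k) 2 P := fun k =>
    (integrable_condExp_sq (𝒢.le k) hG).1.mono
      ((hsub.stronglyMeasurable k).mono (𝒢.le k)).aestronglyMeasurable
      (ae_of_all _ fun ω => by
        rw [Real.norm_of_nonneg (h0 k ω), Real.norm_eq_abs]; exact hpos _)
  have hle : ∀ k ∈ Finset.range (n + 2), T * ((k : ℝ≥0) / (n + 1)) ≤ T := fun k hk => by
    refine mul_le_of_le_one_right zero_le (div_le_one_of_le₀ ?_ zero_le)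
    exact_mod_cast Nat.lt_succ_iff.1 (Finset.mem_range.1 hk)
  have hae : ∀ᵐ ω ∂P, ∀ k ∈ Finset.range (n + 2), |y (T * (k / (n + 1))) ω| ≤ f k ω := by
    refine (Finset.eventually_all _).2 fun k hk => ?_
    filter_upwards [hy _ (hle k hk)] with ω hω
    exact hω.trans (le_posPart _)
  calc ∫⁻ ω, ⨆ k ∈ Finset.range (n + 2), ‖y (T * (k / (n + 1))) ω‖ₑ ^ 2 ∂P
      ≤ ∫⁻ ω, ENNReal.ofReal (((Finset.range (n + 1 + 1)).sup' Finset.nonempty_range_add_one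
        fun k => f k ω) ^ 2) ∂P := by
        refine lintegral_mono_ae (hae.mono fun ω hω => iSup₂_le fun k hk => ?_)
        rw [Real.enorm_eq_ofReal_abs, ← ENNReal.ofReal_pow (abs_nonneg _)]
        refine ENNReal.ofReal_le_ofReal (pow_le_pow_left₀ (abs_nonneg _) ((hω k hk).trans ?_) 2)
        exact Finset.le_sup' (fun k => f k ω) hk
    _ ≤ 4 * ∫⁻ ω, ENNReal.ofReal (f (n + 1) ω ^ 2) ∂P :=
        submartingale_lintegral_sup_sq_le hsub h0 hfL2 (n + 1)
    _ ≤ 4 * ∫⁻ ω, ENNReal.ofReal ((P[G|𝒢 (n + 1)] ω) ^ 2) ∂P := by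
        gcongr 4 * ?_
        exact lintegral_mono fun ω => ENNReal.ofReal_le_ofReal (hbd _ _)
    _ ≤ 4 * ∫⁻ ω, ENNReal.ofReal (G ω ^ 2) ∂P := by
        obtain ⟨h1, h2⟩ := integrable_condExp_sq (𝒢.le (n + 1)) hG
        rw [← ofReal_integral_eq_lintegral_ofReal h1.integrable_sq (ae_of_all _ fun _ => sq_nonneg _),
          ← ofReal_integral_eq_lintegral_ofReal hG.integrable_sq (ae_of_all _ fun _ => sq_nonneg _)]
        gcongr
    _ = _ := by
        congr 1
        refine lintegral_congr fun ω => ?_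
        rw [← sq_abs, ← Real.norm_eq_abs, ENNReal.ofReal_pow (norm_nonneg _), ofReal_norm]

/-- Doob's `L²` inequality for right continuous paths dominated by a closed martingale. -/
theorem lintegral_iSup_sq_le [IsProbabilityMeasure P] {ℱ : Filtration ℝ≥0 mΩ} {T : ℝ≥0}
    {y : ℝ≥0 → Ω → ℝ} (hym : ∀ t ≤ T, Measurable (y t))
    (hr : ∀ ω, ∀ t < T, ContinuousWithinAt (fun s => y s ω) (Ici t) t) {G : Ω → ℝ}
    (hG : MemLp G 2 P) (hy : ∀ t ≤ T, ∀ᵐ ω ∂P, |y t ω| ≤ P[G|ℱ t] ω) :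
    ∫⁻ ω, ⨆ t ∈ Icc 0 T, ‖y t ω‖ₑ ^ 2 ∂P ≤ 4 * ∫⁻ ω, ‖G ω‖ₑ ^ 2 ∂P := by
  -- Suprema over the grids T k/(n+1), k ≤ n+1. By right continuity the full supremum is at most
  -- their lower limit, and Fatou transfers the uniform bound without any measurability of the full
  -- supremum.
  set S : ℕ → Ω → ℝ≥0∞ := fun n ω =>
    ⨆ k ∈ Finset.range (n + 2), ‖y (T * ((k : ℝ≥0) / (n + 1))) ω‖ₑ ^ 2 with hS
  have hle : ∀ n : ℕ, ∀ k ∈ Finset.range (n + 2), T * ((k : ℝ≥0) / (n + 1)) ≤ T := fun n k hk => by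
    refine mul_le_of_le_one_right zero_le (div_le_one_of_le₀ ?_ zero_le)
    exact_mod_cast Nat.lt_succ_iff.1 (Finset.mem_range.1 hk)
  have hSm : ∀ n, Measurable (S n) := fun n =>
    Measurable.biSup (↑(Finset.range (n + 2))) (Finset.countable_toSet _) fun k hk =>
      ((hym _ (hle n k hk)).enorm).pow_const 2
  have key : ∀ ω, ⨆ t ∈ Icc 0 T, ‖y t ω‖ₑ ^ 2 ≤ liminf (fun n => S n ω) atTop := by
    intro ω
    refine iSup₂_le fun t ht => ?_
    rcases lt_or_ge t T with htT | htT
    · have hT : 0 < T := zero_le.trans_lt htT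
      -- The first grid point strictly beyond t; its index is at most n+1 because t < T.
      obtain ⟨k, hkd⟩ : ∃ k : ℕ → ℕ, ∀ n : ℕ, k n = ⌊t / T * ((n : ℝ≥0) + 1)⌋₊ + 1 := ⟨_, fun _ => rfl⟩
      have hk : ∀ n, k n ∈ Finset.range (n + 2) := fun n => by
        rw [Finset.mem_range]
        have h1 : t / T * (n + 1) < (n + 1 : ℕ) := by
          have : t / T < 1 := (div_lt_one hT).2 htT
          calc t / T * (n + 1) < 1 * (n + 1) := by gcongr
            _ = (n + 1 : ℕ) := by push_cast; ring
        have := (Nat.floor_lt zero_le).2 h1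
        have := hkd n
        omega
      have hn : ∀ n : ℕ, (0 : ℝ≥0) < n + 1 := fun n => by positivity
      have hgt : ∀ n : ℕ, t ≤ T * ((k n : ℝ≥0) / (n + 1)) := fun n => by
        have h1 : t / T ≤ (k n : ℝ≥0) / (n + 1) := by
          rw [le_div_iff₀ (hn n), hkd]
          exact_mod_cast (Nat.lt_floor_add_one (t / T * (n + 1))).le
        calc t = T * (t / T) := by rw [mul_div_cancel₀ _ hT.ne']
          _ ≤ _ := by gcongr
      have hup : ∀ n : ℕ, T * ((k n : ℝ≥0) / (n + 1)) ≤ t + T * (1 / ((n : ℝ≥0) + 1)) := fun n => by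
        have h1 : (k n : ℝ≥0) / (n + 1) ≤ t / T + 1 / (n + 1) := by
          rw [div_le_iff₀ (hn n), add_mul, one_div, inv_mul_cancel₀ (hn n).ne']
          simp only [hkd, Nat.cast_add, Nat.cast_one]
          gcongr
          exact Nat.floor_le zero_le
        calc _ ≤ T * (t / T + 1 / (n + 1)) := by gcongr
          _ = _ := by rw [mul_add, mul_div_cancel₀ _ hT.ne']
      have hlim : Tendsto (fun n => T * ((k n : ℝ≥0) / (n + 1))) atTop (𝓝[≥] t) := by
        refine tendsto_nhdsWithin_iff.2 ⟨?_, Eventually.of_forall hgt⟩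
        refine tendsto_of_tendsto_of_tendsto_of_le_of_le tendsto_const_nhds ?_ hgt hup
        simpa using (tendsto_const_nhds (x := t)).add
          ((tendsto_one_div_add_atTop_nhds_zero_nat (𝕜 := ℝ≥0)).const_mul T)
      have h2 : Tendsto (fun n => ‖y (T * ((k n : ℝ≥0) / (n + 1))) ω‖ₑ ^ 2) atTop
          (𝓝 (‖y t ω‖ₑ ^ 2)) :=
        ((ENNReal.continuous_pow 2).tendsto _).comp
          ((continuous_enorm.tendsto _).comp ((hr ω t htT).tendsto.comp hlim))
      rw [← h2.liminf_eq]
      refine liminf_le_liminf (Eventually.of_forall fun n => ?_)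
      exact le_iSup₂ (f := fun (k : ℕ) (_ : k ∈ Finset.range (n + 2)) =>
        ‖y (T * ((k : ℝ≥0) / (n + 1))) ω‖ₑ ^ 2) (k n) (hk n)
    -- The endpoint T belongs to every grid, so nothing is needed to the right of it.
    · have : t = T := le_antisymm ht.2 htT
      rw [this]
      refine le_liminf_of_le (by isBoundedDefault) (Eventually.of_forall fun n => ?_)
      have h1 : T * (((n + 1 : ℕ) : ℝ≥0) / (n + 1)) = T := by
        rw [Nat.cast_add, Nat.cast_one, div_self (by positivity), mul_one]
      have := le_iSup₂ (f := fun (k : ℕ) (_ : k ∈ Finset.range (n + 2)) =>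
        ‖y (T * ((k : ℝ≥0) / (n + 1))) ω‖ₑ ^ 2) (n + 1) (Finset.mem_range.2 (by omega))
      rwa [h1] at this
  calc _ ≤ ∫⁻ ω, liminf (fun n => S n ω) atTop ∂P := lintegral_mono key
    _ ≤ liminf (fun n => ∫⁻ ω, S n ω ∂P) atTop := lintegral_liminf_le hSm
    _ ≤ _ := by
      refine liminf_le_of_le (by isBoundedDefault) fun b hb => ?_
      obtain ⟨n, hn⟩ := hb.exists
      exact hn.trans (lintegral_finset_sup_sq_le hG hy n)

end Doob

/-! ### Jump sizes, and the drift and seminorm as sums over target states. -/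

section JumpSize

variable {Ω : Type*} [mΩ : MeasurableSpace Ω] {N : ℕ} {P : Measure Ω}
  {A : ℝ≥0 → Matrix (Fin N) (Fin N) ℝ} {X : ℝ≥0 → Ω → Fin N → ℝ} {hX : ∀ t, Measurable (X t)}
  {z : ℝ≥0 → Ω → Fin N → ℝ}

/-- The jump of the stochastic integral of `z` when `X` jumps into the state `j`. -/
noncomputable def jumpSize (X : ℝ≥0 → Ω → Fin N → ℝ) (z : ℝ≥0 → Ω → Fin N → ℝ) (j : Fin N)
    (p : ℝ≥0 × Ω) : ℝ :=
  z p.1 p.2 j - z p.1 p.2 ⬝ᵥ leftX X p.1 p.2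

theorem IsMarkovChain.sum_mul_eq (hM : IsMarkovChain P A X hX) (u : ℝ≥0) (ω : Ω) (g : Fin N → ℝ) :
    ∃ i, X u ω = Pi.single i 1 ∧ ∑ j, X u ω j * g j = g i := by
  obtain ⟨i, hi⟩ := hM.unit_vector u ω
  refine ⟨i, hi, ?_⟩
  rw [hi, Finset.sum_eq_single i]
  · simp
  · intro j _ hj; simp [hj]
  · simp

theorem IsMarkovChain.sum_mul_jumpSize (hM : IsMarkovChain P A X hX) (u : ℝ≥0) (ω : Ω) :
    ∑ j, X u ω j * jumpSize X z j (u, ω) = z u ω ⬝ᵥ (X u ω - leftX X u ω) := by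
  obtain ⟨i, hi, h⟩ := hM.sum_mul_eq u ω (fun j => jumpSize X z j (u, ω))
  rw [h, hi, jumpSize, dotProduct_sub, dotProduct_single, mul_one]

theorem IsMarkovChain.sum_mul_jumpSize_sq (hM : IsMarkovChain P A X hX) (u : ℝ≥0) (ω : Ω) :
    ∑ j, X u ω j * jumpSize X z j (u, ω) ^ 2 = (z u ω ⬝ᵥ (X u ω - leftX X u ω)) ^ 2 := by
  obtain ⟨i, hi, h⟩ := hM.sum_mul_eq u ω (fun j => jumpSize X z j (u, ω) ^ 2)
  rw [h, hi, jumpSize, dotProduct_sub, dotProduct_single, mul_one]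

/-- When X_- = e_i the jump size into j is z_j - z_i and the rate is A_{ji}, except that the rate
vanishes at j = i. The diagonal rate can be ignored against any quantity that is zero there, such as
a jump size. -/
theorem IsMarkovChain.jumpRate_mul_eq (hM : IsMarkovChain P A X hX) (u : ℝ≥0)
    (ω : Ω) : ∃ i, leftX X u ω = Pi.single i 1 ∧ ∀ j, jumpSize X z j (u, ω) = z u ω j - z u ω i ∧
      (∀ g : ℝ, (j = i → g = 0) → jumpRate A X j (u, ω) * g = A u j i * g) := by
  obtain ⟨i, hi⟩ := hM.leftX_unit u ω
  refine ⟨i, hi, fun j => ⟨?_, fun g hg => ?_⟩⟩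
  · rw [jumpSize, hi, dotProduct_single, mul_one]
  · rw [jumpRate, hi, Matrix.mulVec_single_one]
    by_cases h : j = i
    · simp [hg h]
    · simp [h]

/-- With X_- = e_i the sum is Σ_j A_{ji}(z_j - z_i), and the terms in z_i drop out because columns
sum to zero. Thus the dt-part of z' dM is exactly the compensator of its jumps. -/
theorem IsMarkovChain.sum_jumpRate_mul_jumpSize (hA : IsRateMatrix A)
    (hM : IsMarkovChain P A X hX) (u : ℝ≥0) (ω : Ω) :
    ∑ j, jumpRate A X j (u, ω) * jumpSize X z j (u, ω) = z u ω ⬝ᵥ (A u *ᵥ leftX X u ω) := by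
  obtain ⟨i, hi, h⟩ := hM.jumpRate_mul_eq (z := z) u ω
  have h1 : ∀ j, jumpRate A X j (u, ω) * jumpSize X z j (u, ω)
      = A u j i * z u ω j - A u j i * z u ω i := fun j => by
    rw [(h j).2 _ (by rintro rfl; rw [(h j).1, sub_self]), (h j).1, mul_sub]
  simp_rw [h1]
  rw [Finset.sum_sub_distrib, ← Finset.sum_mul, hA.col_sum, zero_mul, sub_zero, hi, dotProduct]
  refine Finset.sum_congr rfl fun j _ => ?_
  rw [Matrix.mulVec_single_one, mul_comm]; rfl

/-- With X_- = e_i both sides equal Σ_j A_{ji} z_j² - 2 z_i Σ_j A_{ji} z_j; the square of z_i has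
coefficient zero by the column sums. So ‖z‖² is the compensator density of the squared jumps, and it
is nonnegative. -/
theorem IsMarkovChain.sum_jumpRate_mul_jumpSize_sq (hA : IsRateMatrix A)
    (hM : IsMarkovChain P A X hX) (u : ℝ≥0) (ω : Ω) :
    ∑ j, jumpRate A X j (u, ω) * jumpSize X z j (u, ω) ^ 2 = xNormSq A X u ω (z u ω) := by
  obtain ⟨i, hi, h⟩ := hM.jumpRate_mul_eq (z := z) u ω
  have h1 : ∀ j, jumpRate A X j (u, ω) * jumpSize X z j (u, ω) ^ 2
      = A u j i * z u ω j ^ 2 - 2 * z u ω i * (A u j i * z u ω j) + A u j i * z u ω i ^ 2 :=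
    fun j => by
      rw [(h j).2 _ (by rintro rfl; rw [(h j).1, sub_self]; ring), (h j).1]; ring
  simp_rw [h1]
  rw [Finset.sum_add_distrib, Finset.sum_sub_distrib, ← Finset.sum_mul, hA.col_sum, zero_mul,
    add_zero, ← Finset.mul_sum, xNormSq, Psi, hi, Matrix.sub_mulVec, Matrix.sub_mulVec,
    dotProduct_sub, dotProduct_sub, ← Matrix.mulVec_mulVec, ← Matrix.mulVec_mulVec]
  have e1 : z u ω ⬝ᵥ (Matrix.diagonal (A u *ᵥ (Pi.single i 1 : Fin N → ℝ)) *ᵥ z u ω)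
      = ∑ j, A u j i * z u ω j ^ 2 := by
    rw [dotProduct]
    refine Finset.sum_congr rfl fun j _ => ?_
    rw [Matrix.mulVec_diagonal, Matrix.mulVec_single_one, Matrix.col_apply]; ring
  have e2 : z u ω ⬝ᵥ (Matrix.diagonal (Pi.single i 1 : Fin N → ℝ) *ᵥ ((A u)ᵀ *ᵥ z u ω))
      = z u ω i * ∑ j, A u j i * z u ω j := by
    rw [dotProduct, Finset.sum_eq_single i]
    · rw [Matrix.mulVec_diagonal, Pi.single_eq_same, one_mul]; rfl
    · intro j _ hj; rw [Matrix.mulVec_diagonal]; simp [hj]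
    · simp
  have e3 : z u ω ⬝ᵥ (A u *ᵥ (Matrix.diagonal (Pi.single i 1 : Fin N → ℝ) *ᵥ z u ω))
      = z u ω i * ∑ j, A u j i * z u ω j := by
    have : Matrix.diagonal (Pi.single i 1 : Fin N → ℝ) *ᵥ z u ω = Pi.single i (z u ω i) := by
      ext j
      rw [Matrix.mulVec_diagonal]
      by_cases hj : j = i
      · subst hj; simp
      · simp [hj]
    rw [this, dotProduct, Finset.mul_sum]
    refine Finset.sum_congr rfl fun j _ => ?_
    simp [Matrix.mulVec_single]; ring
  rw [e1, e2, e3]; ring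

theorem IsMarkovChain.xNormSq_nonneg (hA : IsRateMatrix A) (hM : IsMarkovChain P A X hX)
    (u : ℝ≥0) (ω : Ω) (C : Fin N → ℝ) : 0 ≤ xNormSq A X u ω C := by
  rw [← hM.sum_jumpRate_mul_jumpSize_sq (z := fun _ _ => C) hA u ω]
  exact Finset.sum_nonneg fun j _ => mul_nonneg (hM.jumpRate_nonneg hA j _) (sq_nonneg _)

theorem IsMarkovChain.measurable_jumpSize (hM : IsMarkovChain P A X hX)
    (hz : Measurable[(completedFiltration P X hX).predictable] fun p : ℝ≥0 × Ω => z p.1 p.2)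
    (j : Fin N) : Measurable[(completedFiltration P X hX).predictable] (jumpSize X z j) := by
  have h1 : ∀ l, Measurable[(completedFiltration P X hX).predictable]
      fun p : ℝ≥0 × Ω => z p.1 p.2 l := fun l => (measurable_pi_apply l).comp hz
  have h2 : Measurable[(completedFiltration P X hX).predictable]
      fun p : ℝ≥0 × Ω => ∑ l, z p.1 p.2 l * leftX X p.1 p.2 l :=
    Finset.measurable_sum _ fun l _ => (h1 l).mul (hM.measurable_leftX l)
  exact (h1 j).sub h2

/-- Compensation formula for the jumps into the state `j` in `(t,T]`, on an event of `ℱ_t`. -/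
theorem IsMarkovChain.setIntegral_jumpSum [IsProbabilityMeasure P] (hA : IsRateMatrix A)
    (hM : IsMarkovChain P A X hX) (j : Fin N) {t T : ℝ≥0} {B : Set Ω}
    (hB : MeasurableSet[completedFiltration P X hX t] B) {α : ℝ≥0 × Ω → ℝ}
    (hα : Measurable[(completedFiltration P X hX).predictable] α)
    (hint : Integrable (fun p : Ω × ℝ≥0 => jumpRate A X j p.swap * α p.swap)
      (P.prod (leb.restrict (Ioc 0 T)))) :
    IntegrableOn (fun ω => ∑ u ∈ jumps (fun t => X t ω) T with t < u, X u ω j * α (u, ω)) B P ∧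
    ∫ ω in B, ∑ u ∈ jumps (fun t => X t ω) T with t < u, X u ω j * α (u, ω) ∂P
      = ∫ ω in B, ∫ u in Ioc t T, jumpRate A X j (u, ω) * α (u, ω) ∂leb ∂P := by
  obtain ⟨L, hL⟩ := exists_nat_ge T
  have hB' : MeasurableSet B := (completedFiltration P X hX).le _ _ hB
  -- Cutting the integrand off by the predictable rectangle `(t,T] × B` reduces the statement on the
  -- event B to the unconditional compensation formula. The horizon is first enlarged to a natural
  -- number L ≥ T.
  have hset : MeasurableSet[(completedFiltration P X hX).predictable] (Ioc t T ×ˢ B) :=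
    measurableSet_predictable_Ioc_prod _ _ hB
  have hG := hα.indicator hset
  set G := (Ioc t T ×ˢ B).indicator α with hGd
  have hsum : ∀ ω, ∑ u ∈ jumps (fun t => X t ω) L, (if X u ω j = 1 then G (u, ω) else 0)
      = B.indicator (fun ω => ∑ u ∈ jumps (fun t => X t ω) T with t < u, X u ω j * α (u, ω)) ω := by
    intro ω
    by_cases hω : ω ∈ B
    · rw [indicator_of_mem hω, ← jumps_filter_le (hM.finite_range ω) (hM.rcll ω) hL,
        Finset.filter_filter, Finset.sum_filter]
      refine Finset.sum_congr rfl fun u _ => ?_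
      by_cases h1 : u ≤ T ∧ t < u
      · have hm : (u, ω) ∈ Ioc t T ×ˢ B := ⟨⟨h1.2, h1.1⟩, hω⟩
        rw [if_pos h1, hGd, indicator_of_mem hm]
        by_cases hx : X u ω j = 1
        · simp [hx]
        · simp [hM.eq_zero_of_ne_one hx]
      · have hm : (u, ω) ∉ Ioc t T ×ˢ B := fun h => h1 ⟨h.1.2, h.1.1⟩
        rw [if_neg h1, hGd, indicator_of_notMem hm, ite_self]
    · rw [indicator_of_notMem hω]
      refine Finset.sum_eq_zero fun u _ => ?_
      have hm : (u, ω) ∉ Ioc t T ×ˢ B := fun h => hω h.2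
      rw [hGd, indicator_of_notMem hm, ite_self]
  have hint' : ∀ ω, ∫ u in Ioc 0 (L : ℝ≥0), jumpRate A X j (u, ω) * G (u, ω) ∂leb
      = B.indicator (fun ω => ∫ u in Ioc t T, jumpRate A X j (u, ω) * α (u, ω) ∂leb) ω := by
    intro ω
    by_cases hω : ω ∈ B
    · rw [indicator_of_mem hω]
      have e : ∀ u, jumpRate A X j (u, ω) * G (u, ω)
          = (Ioc t T).indicator (fun u => jumpRate A X j (u, ω) * α (u, ω)) u := fun u => by
        by_cases hu : u ∈ Ioc t T
        · have hm : (u, ω) ∈ Ioc t T ×ˢ B := ⟨hu, hω⟩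
          rw [indicator_of_mem hu, hGd, indicator_of_mem hm]
        · have hm : (u, ω) ∉ Ioc t T ×ˢ B := fun h => hu h.1
          rw [indicator_of_notMem hu, hGd, indicator_of_notMem hm, mul_zero]
      simp_rw [e]
      rw [integral_indicator measurableSet_Ioc, Measure.restrict_restrict measurableSet_Ioc,
        inter_eq_left.2 (Ioc_subset_Ioc zero_le hL)]
    · rw [indicator_of_notMem hω]
      refine integral_eq_zero_of_ae (ae_of_all _ fun u => ?_)
      have hm : (u, ω) ∉ Ioc t T ×ˢ B := fun h => hω h.2
      simp only [hGd, indicator_of_notMem hm, mul_zero, Pi.zero_apply]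
  have hfin : ∫⁻ ω, ∫⁻ u in Ioc 0 (L : ℝ≥0),
      ENNReal.ofReal (jumpRate A X j (u, ω)) * ‖G (u, ω)‖ₑ ∂leb ∂P < ∞ := by
    have h2 := hint.2
    rw [HasFiniteIntegral, lintegral_prod _ hint.1.enorm] at h2
    refine lt_of_le_of_lt (lintegral_mono fun ω => ?_) h2
    rw [← lintegral_indicator measurableSet_Ioc, ← lintegral_indicator measurableSet_Ioc]
    refine lintegral_mono fun u => ?_
    by_cases hu : (u, ω) ∈ Ioc t T ×ˢ B
    · have hu2 : u ∈ Ioc 0 T := ⟨zero_le.trans_lt hu.1.1, hu.1.2⟩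
      rw [indicator_of_mem hu2, indicator_of_mem (Ioc_subset_Ioc_right hL hu2), hGd,
        indicator_of_mem hu, Prod.swap_prod_mk, enorm_mul,
        Real.enorm_of_nonneg (hM.jumpRate_nonneg hA j _)]
    · refine le_trans (le_of_eq ?_) zero_le
      rw [indicator_apply_eq_zero]
      intro _
      rw [hGd, indicator_of_notMem hu, enorm_zero, mul_zero]
  obtain ⟨h1, _, h3⟩ := hM.integral_jumpSum hA L j hG hfin
  simp_rw [hsum, hint'] at h1 h3
  rw [integral_indicator hB', integral_indicator hB'] at h3
  exact ⟨(integrable_indicator_iff hB').1 h1, h3⟩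

/-- Compensation formula, summed over the states. -/
theorem IsMarkovChain.setIntegral_sum_jumpSum [IsProbabilityMeasure P] (hA : IsRateMatrix A)
    (hM : IsMarkovChain P A X hX) {t T : ℝ≥0} {B : Set Ω}
    (hB : MeasurableSet[completedFiltration P X hX t] B) {α : Fin N → ℝ≥0 × Ω → ℝ}
    (hα : ∀ j, Measurable[(completedFiltration P X hX).predictable] (α j))
    (hint : ∀ j, Integrable (fun p : Ω × ℝ≥0 => jumpRate A X j p.swap * α j p.swap)
      (P.prod (leb.restrict (Ioc 0 T)))) :
    IntegrableOn
      (fun ω => ∑ u ∈ jumps (fun t => X t ω) T with t < u, ∑ j, X u ω j * α j (u, ω)) B P ∧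
    ∫ ω in B, ∑ u ∈ jumps (fun t => X t ω) T with t < u, ∑ j, X u ω j * α j (u, ω) ∂P
      = ∫ ω in B, ∫ u in Ioc t T, ∑ j, jumpRate A X j (u, ω) * α j (u, ω) ∂leb ∂P := by
  have h := fun j => hM.setIntegral_jumpSum hA j hB (hα j) (hint j)
  have hsec : ∀ᵐ ω ∂P, ∀ j, IntegrableOn
      (fun u => jumpRate A X j (u, ω) * α j (u, ω)) (Ioc t T) leb := by
    refine ae_all_iff.2 fun j => ?_
    filter_upwards [(hint j).prod_right_ae] with ω hω
    exact IntegrableOn.mono_set (t := Ioc 0 T) hω (Ioc_subset_Ioc_left zero_le)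
  have hint2 : ∀ j, IntegrableOn
      (fun ω => ∫ u in Ioc t T, jumpRate A X j (u, ω) * α j (u, ω) ∂leb) B P := fun j => by
    have h1 : Integrable (fun p : Ω × ℝ≥0 => jumpRate A X j p.swap * α j p.swap)
        (P.prod (leb.restrict (Ioc t T))) :=
      (hint j).mono_measure (Measure.prod_mono le_rfl
        (Measure.restrict_mono (Ioc_subset_Ioc_left zero_le) le_rfl))
    exact h1.integral_prod_left.integrableOn
  simp_rw [fun ω => Finset.sum_comm (s := (jumps (fun t => X t ω) T).filter (fun u => t < u))
    (t := Finset.univ) (f := fun u j => X u ω j * α j (u, ω))]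
  refine ⟨integrable_finsetSum _ fun j _ => (h j).1, ?_⟩
  rw [integral_finsetSum _ fun j _ => (h j).1]
  rw [integral_congr_ae (g := fun ω => ∑ j, ∫ u in Ioc t T, jumpRate A X j (u, ω) * α j (u, ω) ∂leb)]
  · rw [integral_finsetSum _ fun j _ => hint2 j]
    exact Finset.sum_congr rfl fun j _ => (h j).2
  · filter_upwards [ae_restrict_of_ae hsec] with ω hω
    exact integral_finsetSum _ fun j _ => hω j

end JumpSize

/-! ### Backward equations with dominated integrand -/

/-- The left limits of `y` on `(0,T]`. -/
noncomputable def leftVersion {Ω : Type*} (T : ℝ≥0) (y : ℝ≥0 → Ω → ℝ) : ℝ≥0 × Ω → ℝ :=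
  (Ioc (0 : ℝ≥0) T ×ˢ (univ : Set Ω)).indicator fun p => Function.leftLim (fun s => y s p.2) p.1

theorem leftVersion_apply {Ω : Type*} {T : ℝ≥0} {y : ℝ≥0 → Ω → ℝ} {u : ℝ≥0} 
    (hu : u ∈ Ioc 0 T) (ω : Ω) :
    leftVersion T y (u, ω) = Function.leftLim (fun s => y s ω) u :=
  indicator_of_mem (show (u, ω) ∈ Ioc (0 : ℝ≥0) T ×ˢ (univ : Set Ω) from ⟨hu, trivial⟩) _

/-- Only countably many times are lost, so the predictable left version replaces y in every integral
against dt. -/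
theorem ae_leftVersion_eq {Ω : Type*} {T : ℝ≥0} {y : ℝ≥0 → Ω → ℝ} {ω : Ω}
    (hy : IsRCLLOn T fun t => y t ω) :
    ∀ᵐ u ∂leb.restrict (Ioc 0 T), leftVersion T y (u, ω) = y u ω := by
  have h1 := ((countable_ne_leftLim hy).ae_notMem leb)
  filter_upwards [ae_restrict_of_ae h1, ae_restrict_mem measurableSet_Ioc] with u hu hm
  rw [leftVersion_apply hm]
  by_contra hne
  exact hu ⟨Ioc_subset_Icc_self hm, hne⟩

section Dominated

variable {Ω : Type*} [mΩ : MeasurableSpace Ω] {N : ℕ} {P : Measure Ω}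
  {A : ℝ≥0 → Matrix (Fin N) (Fin N) ℝ} {X : ℝ≥0 → Ω → Fin N → ℝ} {hX : ∀ t, Measurable (X t)}
  {T : ℝ≥0} {c : ℝ} {ξ : Ω → ℝ} {ψ h : ℝ≥0 × Ω → ℝ} {y : ℝ≥0 → Ω → ℝ}
  {z : ℝ≥0 → Ω → Fin N → ℝ}

theorem memLp_two_of_lintegral {α : Type*} {m : MeasurableSpace α} {μ : Measure α} {f : α → ℝ}
    (hf : AEStronglyMeasurable f μ) (h : ∫⁻ x, ‖f x‖ₑ ^ 2 ∂μ < ∞) : MemLp f 2 μ := by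
  refine ⟨hf, ?_⟩
  rw [eLpNorm_lt_top_iff_lintegral_rpow_enorm_lt_top (by norm_num) (by norm_num)]
  simpa using h

/-- `P ⊗ dt` on `Ω × (t,T]`. -/
noncomputable def timeProd (P : Measure Ω) (t T : ℝ≥0) : Measure (Ω × ℝ≥0) :=
  P.prod (leb.restrict (Ioc t T))

instance [IsFiniteMeasure P] (t T : ℝ≥0) : IsFiniteMeasure (timeProd P t T) := by
  unfold timeProd; infer_instance

theorem timeProd_le (t T : ℝ≥0) : timeProd P t T ≤ timeProd P 0 T :=
  Measure.prod_mono le_rfl (Measure.restrict_mono (Ioc_subset_Ioc_left zero_le) le_rfl)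

theorem memLp_timeProd [IsProbabilityMeasure P] {g : Ω × ℝ≥0 → ℝ} (hg : Measurable g)
    (h : ∫⁻ ω, ∫⁻ t in Ioc 0 T, ‖g (ω, t)‖ₑ ^ 2 ∂leb ∂P < ∞) : MemLp g 2 (timeProd P 0 T) := by
  refine memLp_two_of_lintegral hg.aestronglyMeasurable ?_
  rwa [timeProd, lintegral_prod _ (hg.enorm.pow_const 2).aemeasurable]

/-- `(y,z)` solves the backward equation
`y_t = ξ + ∫_t^T h_s ds - ∫_t^T z_s' dM_s` whose integrand satisfies
`|h| ≤ |ψ| + c (|y| + ‖z‖_X)`. -/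
structure IsDominatedBSDE (P : Measure Ω) (A : ℝ≥0 → Matrix (Fin N) (Fin N) ℝ)
    (X : ℝ≥0 → Ω → Fin N → ℝ) (hX : ∀ t, Measurable (X t)) (T : ℝ≥0) (c : ℝ) (ξ : Ω → ℝ)
    (ψ h : ℝ≥0 × Ω → ℝ) (y : ℝ≥0 → Ω → ℝ) (z : ℝ≥0 → Ω → Fin N → ℝ) : Prop where
  memLp_terminal : MemLp ξ 2 P
  adapted : ∀ t ≤ T, Measurable[completedFiltration P X hX t] (y t)
  rcll : ∀ ω, IsRCLLOn T fun t => y t ω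
  memLp_leftVersion : MemLp (fun p => leftVersion T y p.swap) 2 (timeProd P 0 T)
  predictable_z : Measurable[(completedFiltration P X hX).predictable] fun p => z p.1 p.2
  integrable_xNormSq : Integrable (fun p => xNormSq A X p.2 p.1 (z p.2 p.1)) (timeProd P 0 T)
  measurable_source : Measurable ψ
  memLp_source : MemLp (fun p => ψ p.swap) 2 (timeProd P 0 T)
  measurable_integrand : Measurable h
  bound : ∀ᵐ ω ∂P, ∀ᵐ t ∂leb.restrict (Ioc 0 T),
    |h (t, ω)| ≤ |ψ (t, ω)| + c * |y t ω| + c * xNorm A X t ω (z t ω)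
  equation : ∀ᵐ ω ∂P, ∀ t ≤ T,
    y t ω = ξ ω + (∫ u in Ioc t T, h (u, ω) ∂leb) - stochInt A X z t T ω

theorem MemL2Adapted.memLp_leftVersion [IsProbabilityMeasure P]
    (hy : MemL2Adapted P (completedFiltration P X hX) T y) :
    MemLp (fun p => leftVersion T y p.swap) 2 (timeProd P 0 T) := by
  have hm : Measurable fun p : Ω × ℝ≥0 => leftVersion T y p.swap :=
    ((measurable_predictable_leftLim hy.adapted fun ω => (hy.rcll ω).2).mono (predictable_le _)
      le_rfl).comp measurable_swap
  refine memLp_timeProd hm (lt_of_le_of_lt (lintegral_mono fun ω => ?_) hy.sq_integrable)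
  calc _ = ∫⁻ u in Ioc 0 T, ‖y u ω‖ₑ ^ 2 ∂leb := by
        refine lintegral_congr_ae ?_
        filter_upwards [ae_leftVersion_eq (hy.rcll ω)] with u hu
        rw [Prod.swap_prod_mk, hu]
    _ ≤ _ := lintegral_mono_set Ioc_subset_Icc_self

theorem IsMarkovChain.measurable_rate_mul (hA : IsRateMatrix A) (hM : IsMarkovChain P A X hX) (j : Fin N)
    {α : ℝ≥0 × Ω → ℝ} (hα : Measurable[(completedFiltration P X hX).predictable] α) :
    Measurable fun p : Ω × ℝ≥0 => jumpRate A X j p.swap * α p.swap :=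
  ((hM.measurable_jumpRate hA j).mul (hα.mono (predictable_le _) le_rfl)).comp measurable_swap

theorem IsMarkovChain.measurable_xNormSq (hA : IsRateMatrix A) (hM : IsMarkovChain P A X hX)
    (hz : Measurable[(completedFiltration P X hX).predictable] fun p : ℝ≥0 × Ω => z p.1 p.2) :
    Measurable fun p : Ω × ℝ≥0 => xNormSq A X p.2 p.1 (z p.2 p.1) := by
  have : (fun p : Ω × ℝ≥0 => xNormSq A X p.2 p.1 (z p.2 p.1))
      = fun p => ∑ j, jumpRate A X j p.swap * jumpSize X z j p.swap ^ 2 := by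
    ext p
    exact (hM.sum_jumpRate_mul_jumpSize_sq hA p.2 p.1).symm
  rw [this]
  exact Finset.measurable_sum _ fun j _ => hM.measurable_rate_mul hA j
    (α := fun p => jumpSize X z j p ^ 2) ((hM.measurable_jumpSize hz j).pow_const 2)

/-- The drift `z_u' A_u X_{u-}` of the jump part of the stochastic integral. -/
noncomputable def drift (A : ℝ≥0 → Matrix (Fin N) (Fin N) ℝ) (X : ℝ≥0 → Ω → Fin N → ℝ)
    (z : ℝ≥0 → Ω → Fin N → ℝ) (p : ℝ≥0 × Ω) : ℝ :=
  ∑ j, jumpRate A X j p * jumpSize X z j p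

namespace IsDominatedBSDE

theorem measurable_leftVersion (H : IsDominatedBSDE P A X hX T c ξ ψ h y z) :
    Measurable[(completedFiltration P X hX).predictable] (leftVersion T y) :=
  measurable_predictable_leftLim H.adapted fun ω => (H.rcll ω).2

theorem integrable_rate_mul_sq [IsProbabilityMeasure P]
    (H : IsDominatedBSDE P A X hX T c ξ ψ h y z) (hA : IsRateMatrix A)
    (hM : IsMarkovChain P A X hX) (j : Fin N) :
    Integrable (fun p => jumpRate A X j p.swap * jumpSize X z j p.swap ^ 2) (timeProd P 0 T) := by
  refine H.integrable_xNormSq.mono' (hM.measurable_rate_mul hA j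
    (α := fun p => jumpSize X z j p ^ 2)
    ((hM.measurable_jumpSize H.predictable_z j).pow_const 2)).aestronglyMeasurable
    (ae_of_all _ fun p => ?_)
  rw [← hM.sum_jumpRate_mul_jumpSize_sq hA p.2 p.1, Real.norm_eq_abs,
    abs_of_nonneg (mul_nonneg (hM.jumpRate_nonneg hA j _) (sq_nonneg _))]
  exact Finset.single_le_sum (f := fun j => jumpRate A X j p.swap * jumpSize X z j p.swap ^ 2)
    (fun j _ => mul_nonneg (hM.jumpRate_nonneg hA j _) (sq_nonneg _)) (Finset.mem_univ j)

/-- Young's inequality and boundedness of the rates: the product is at most m α² plus rate times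
squared jump size. No supremum bound on y is needed to compensate the cross term y_- z' ΔX. -/
theorem integrable_rate_mul_mul [IsProbabilityMeasure P]
    (H : IsDominatedBSDE P A X hX T c ξ ψ h y z) (hA : IsRateMatrix A)
    (hM : IsMarkovChain P A X hX) (j : Fin N) {α : ℝ≥0 × Ω → ℝ}
    (hα : Measurable[(completedFiltration P X hX).predictable] α)
    (hα2 : MemLp (fun p => α p.swap) 2 (timeProd P 0 T)) :
    Integrable (fun p => jumpRate A X j p.swap * (α p.swap * jumpSize X z j p.swap))
      (timeProd P 0 T) := by
  obtain ⟨m, hm⟩ := hA.bounded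
  refine ((hα2.integrable_sq.const_mul m).add (H.integrable_rate_mul_sq hA hM j)).mono'
    (hM.measurable_rate_mul hA j (α := fun p => α p * jumpSize X z j p)
      (hα.mul (hM.measurable_jumpSize H.predictable_z j))).aestronglyMeasurable
    (ae_of_all _ fun p => ?_)
  have h0 := hM.jumpRate_nonneg hA j p.swap
  have h1 := hM.jumpRate_le hm j p.swap
  rw [Real.norm_eq_abs, Pi.add_apply, abs_mul, abs_of_nonneg h0]
  have h2 : |α p.swap * jumpSize X z j p.swap| ≤ α p.swap ^ 2 + jumpSize X z j p.swap ^ 2 := by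
    rw [abs_le]
    constructor <;> nlinarith [sq_nonneg (α p.swap + jumpSize X z j p.swap),
      sq_nonneg (α p.swap - jumpSize X z j p.swap), sq_nonneg (α p.swap),
      sq_nonneg (jumpSize X z j p.swap)]
  calc _ ≤ jumpRate A X j p.swap * (α p.swap ^ 2 + jumpSize X z j p.swap ^ 2) :=
        mul_le_mul_of_nonneg_left h2 h0
    _ ≤ _ := by
        rw [mul_add]
        gcongr

theorem integrable_rate_mul [IsProbabilityMeasure P]
    (H : IsDominatedBSDE P A X hX T c ξ ψ h y z) (hA : IsRateMatrix A)
    (hM : IsMarkovChain P A X hX) (j : Fin N) :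
    Integrable (fun p => jumpRate A X j p.swap * jumpSize X z j p.swap) (timeProd P 0 T) := by
  simpa using H.integrable_rate_mul_mul hA hM j (α := fun _ => 1) measurable_const
    (memLp_const 1)

theorem memLp_xNorm [IsProbabilityMeasure P] (H : IsDominatedBSDE P A X hX T c ξ ψ h y z)
    (hA : IsRateMatrix A) (hM : IsMarkovChain P A X hX) :
    MemLp (fun p => xNorm A X p.2 p.1 (z p.2 p.1)) 2 (timeProd P 0 T) := by
  have hm : Measurable fun p : Ω × ℝ≥0 => xNorm A X p.2 p.1 (z p.2 p.1) :=
    (hM.measurable_xNormSq hA H.predictable_z).sqrt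
  rw [memLp_two_iff_integrable_sq hm.aestronglyMeasurable]
  refine H.integrable_xNormSq.congr (ae_of_all _ fun p => ?_)
  exact (Real.sq_sqrt (hM.xNormSq_nonneg hA _ _ _)).symm

/-- Passing from almost every path and almost every time to almost everywhere in the product needs a
measurable set, which the left version in place of y provides. -/
theorem ae_bound [IsProbabilityMeasure P] (H : IsDominatedBSDE P A X hX T c ξ ψ h y z)
    (hA : IsRateMatrix A) (hM : IsMarkovChain P A X hX) :
    ∀ᵐ p ∂timeProd P 0 T, |h p.swap| ≤ |ψ p.swap| + c * |leftVersion T y p.swap|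
      + c * xNorm A X p.2 p.1 (z p.2 p.1) := by
  rw [timeProd, Measure.ae_prod_iff_ae_ae]
  · filter_upwards [H.bound] with ω hω
    filter_upwards [hω, ae_leftVersion_eq (H.rcll ω)] with u hu hy
    rw [Prod.swap_prod_mk, hy]
    exact hu
  · have h1 : Measurable fun p : Ω × ℝ≥0 => xNorm A X p.2 p.1 (z p.2 p.1) :=
      (hM.measurable_xNormSq hA H.predictable_z).sqrt
    have h2 : Measurable fun p : Ω × ℝ≥0 => leftVersion T y p.swap :=
      (H.measurable_leftVersion.mono (predictable_le _) le_rfl).comp measurable_swap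
    have h3 := H.measurable_source.comp (measurable_swap (α := Ω) (β := ℝ≥0))
    have h4 := H.measurable_integrand.comp (measurable_swap (α := Ω) (β := ℝ≥0))
    refine measurableSet_le ?_ ?_
    · exact continuous_abs.measurable.comp h4
    · exact ((continuous_abs.measurable.comp h3).add
        ((continuous_abs.measurable.comp h2).const_mul c)).add (h1.const_mul c)

theorem memLp_integrand [IsProbabilityMeasure P] (H : IsDominatedBSDE P A X hX T c ξ ψ h y z)
    (hA : IsRateMatrix A) (hM : IsMarkovChain P A X hX) :
    MemLp (fun p => h p.swap) 2 (timeProd P 0 T) :=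
  (((H.memLp_source.norm).add (H.memLp_leftVersion.norm.const_mul c)).add
    ((H.memLp_xNorm hA hM).const_mul c)).mono'
    (H.measurable_integrand.comp measurable_swap).aestronglyMeasurable (H.ae_bound hA hM)

theorem integrable_drift [IsProbabilityMeasure P]
    (H : IsDominatedBSDE P A X hX T c ξ ψ h y z) (hA : IsRateMatrix A)
    (hM : IsMarkovChain P A X hX) :
    Integrable (fun p => drift A X z p.swap) (timeProd P 0 T) :=
  integrable_finsetSum _ fun j _ => H.integrable_rate_mul hA hM j

theorem integrable_leftVersion_mul_drift [IsProbabilityMeasure P]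
    (H : IsDominatedBSDE P A X hX T c ξ ψ h y z) (hA : IsRateMatrix A)
    (hM : IsMarkovChain P A X hX) :
    Integrable (fun p => leftVersion T y p.swap * drift A X z p.swap) (timeProd P 0 T) := by
  have : (fun p : Ω × ℝ≥0 => leftVersion T y p.swap * drift A X z p.swap)
      = fun p => ∑ j, jumpRate A X j p.swap * (leftVersion T y p.swap * jumpSize X z j p.swap) := by
    ext p
    rw [drift, Finset.mul_sum]
    exact Finset.sum_congr rfl fun j _ => by ring
  rw [this]
  exact integrable_finsetSum _ fun j _ =>
    H.integrable_rate_mul_mul hA hM j H.measurable_leftVersion H.memLp_leftVersion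

end IsDominatedBSDE

theorem IsMarkovChain.ae_drift_eq (hA : IsRateMatrix A) (hM : IsMarkovChain P A X hX) (ω : Ω)
    (T : ℝ≥0) : ∀ᵐ u ∂leb.restrict (Ioc 0 T),
      z u ω ⬝ᵥ (A u *ᵥ X u ω) = drift A X z (u, ω) := by
  filter_upwards [hM.ae_leftX_eq ω T] with u hu
  rw [drift, hM.sum_jumpRate_mul_jumpSize hA, hu]

/-- The stochastic integral as a finite sum over the jumps minus its compensator. -/
theorem IsMarkovChain.stochInt_eq (hA : IsRateMatrix A) (hM : IsMarkovChain P A X hX) (ω : Ω)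
    (t T : ℝ≥0) : stochInt A X z t T ω
      = (∑ u ∈ jumps (fun t => X t ω) T with t < u, z u ω ⬝ᵥ (X u ω - leftX X u ω))
        - ∫ u in Ioc t T, drift A X z (u, ω) ∂leb := by
  rw [stochInt]
  congr 1
  · refine finsum_mem_eq_sum_of_inter_support_eq _ ?_
    ext u
    simp only [mem_inter_iff, mem_Ioc, Function.mem_support, Finset.coe_filter, mem_ofPred_eq,
      mem_jumps (hM.finite_range ω) (hM.rcll ω)]
    refine ⟨fun ⟨h1, h2⟩ => ⟨⟨⟨h1.2, fun h3 => h2 ?_⟩, h1.1⟩, h2⟩,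
      fun ⟨h1, h2⟩ => ⟨⟨h1.2, h1.1.1⟩, h2⟩⟩
    rw [leftX, h3, sub_self, dotProduct_zero]
  · refine integral_congr_ae ?_
    exact ae_mono (Measure.restrict_mono (Ioc_subset_Ioc_left zero_le) le_rfl)
      (hM.ae_drift_eq hA ω T)

end Dominated

/-! ### Energy identity and martingale bound -/

/-- The jumps of the solution of a backward equation. -/
theorem leftLim_eq_of_backward {T : ℝ≥0} {ξ : ℝ} {k a y : ℝ≥0 → ℝ} {S : Finset ℝ≥0}
    (hk : IntegrableOn k (Ioc 0 T) leb)
    (hy : ∀ s ≤ T, y s = ξ + (∫ u in Ioc s T, k u ∂leb) - ∑ u ∈ S with s < u, a u)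
    {u : ℝ≥0} (hu : u ∈ S) (hu0 : 0 < u) (huT : u ≤ T) :
    Function.leftLim y u = y u - a u := by
  have hne : (𝓝[<] u).NeBot := by
    have := tendsto_gridLeft hu0
    exact this.neBot
  refine leftLim_eq_of_tendsto ?_
  -- The absolutely continuous part contributes no jump, by dominated convergence away from the null
  -- set {u}.
  have hint : Tendsto (fun s => ∫ v in Ioc s T, k v ∂leb) (𝓝[<] u)
      (𝓝 (∫ v in Ioc u T, k v ∂leb)) := by
    have e : ∀ s : ℝ≥0, ∫ v in Ioc s T, k v ∂leb
        = ∫ v in Ioc 0 T, (Ioc s T).indicator k v ∂leb := fun s => by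
      rw [integral_indicator measurableSet_Ioc, Measure.restrict_restrict measurableSet_Ioc,
        inter_eq_left.2 (Ioc_subset_Ioc_left zero_le)]
    simp_rw [e]
    refine tendsto_integral_filter_of_dominated_convergence (fun v => ‖k v‖)
      (Eventually.of_forall fun s => hk.1.indicator measurableSet_Ioc)
      (Eventually.of_forall fun s => ae_of_all _ fun v => norm_indicator_le_norm_self _ _)
      hk.norm ?_
    have hn : ∀ᵐ v ∂leb.restrict (Ioc 0 T), v ≠ u :=
      ae_restrict_of_ae (by simp [ae_iff, measure_singleton])
    filter_upwards [hn] with v hv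
    refine tendsto_const_nhds.congr' ?_
    rcases lt_or_gt_of_ne hv with h | h
    · filter_upwards [mem_nhdsWithin_of_mem_nhds (Ioi_mem_nhds h)] with s hs
      rw [indicator_of_notMem (fun h1 => absurd h1.1 h.not_gt),
        indicator_of_notMem (fun h1 => absurd h1.1 (not_lt.2 (mem_Ioi.1 hs).le))]
    · filter_upwards [self_mem_nhdsWithin] with s hs
      have hs' : s < v := (mem_Iio.1 hs).trans h
      by_cases hvT : v ≤ T
      · rw [indicator_of_mem (show v ∈ Ioc u T from ⟨h, hvT⟩),
          indicator_of_mem (show v ∈ Ioc s T from ⟨hs', hvT⟩)]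
      · rw [indicator_of_notMem (fun h1 => hvT h1.2), indicator_of_notMem (fun h1 => hvT h1.2)]
  have hlim : Tendsto (fun s => ξ + (∫ v in Ioc s T, k v ∂leb) - (∑ v ∈ S with u < v, a v + a u))
      (𝓝[<] u) (𝓝 (y u - a u)) := by
    rw [hy u huT, sub_sub]
    exact (hint.const_add ξ).sub_const _
  refine hlim.congr' ?_
  have hS : ∀ᶠ s in 𝓝[<] u, ∀ v ∈ S, v < u → v < s := by
    refine (Finset.eventually_all S).2 fun v _ => ?_
    by_cases h : v < u
    · filter_upwards [mem_nhdsWithin_of_mem_nhds (Ioi_mem_nhds h)] with s hs _ using hs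
    · exact Eventually.of_forall fun _ h' => absurd h' h
  filter_upwards [hS, self_mem_nhdsWithin] with s hs hsu
  have hsu' : s < u := hsu
  rw [hy s (hsu'.le.trans huT)]
  congr 1
  -- For s just below u the sum over later jumps gains exactly the jump at u.
  have : S.filter (fun v => s < v) = insert u (S.filter fun v => u < v) := by
    ext v
    simp only [Finset.mem_filter, Finset.mem_insert]
    constructor
    · rintro ⟨h1, h2⟩
      rcases lt_trichotomy v u with h | h | h
      · exact absurd (hs v h1 h) h2.not_gt
      · exact Or.inl h
      · exact Or.inr ⟨h1, h⟩
    · rintro (rfl | ⟨h1, h2⟩)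
      · exact ⟨hu, hsu'⟩
      · exact ⟨h1, hsu'.trans h2⟩
  rw [this, Finset.sum_insert (by simp), add_comm]

theorem integral_lincomb {Ω : Type*} [MeasurableSpace Ω] {P : Measure Ω}
    {f₁ f₂ f₃ f₄ f₅ : Ω → ℝ} (h₁ : Integrable f₁ P) (h₂ : Integrable f₂ P)
    (h₃ : Integrable f₃ P) (h₄ : Integrable f₄ P) (h₅ : Integrable f₅ P) :
    Integrable (fun ω => f₁ ω + 2 * f₂ ω + 2 * f₃ ω - f₄ ω - 2 * f₅ ω) P ∧
    ∫ ω, f₁ ω + 2 * f₂ ω + 2 * f₃ ω - f₄ ω - 2 * f₅ ω ∂P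
      = ∫ ω, f₁ ω ∂P + 2 * ∫ ω, f₂ ω ∂P + 2 * ∫ ω, f₃ ω ∂P - ∫ ω, f₄ ω ∂P - 2 * ∫ ω, f₅ ω ∂P := by
  have i1 : Integrable (fun ω => f₁ ω + 2 * f₂ ω) P := h₁.add (h₂.const_mul 2)
  have i2 : Integrable (fun ω => f₁ ω + 2 * f₂ ω + 2 * f₃ ω) P := i1.add (h₃.const_mul 2)
  have i3 : Integrable (fun ω => f₁ ω + 2 * f₂ ω + 2 * f₃ ω - f₄ ω) P := i2.sub h₄
  refine ⟨i3.sub (h₅.const_mul 2), ?_⟩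
  rw [integral_sub i3 (h₅.const_mul 2), integral_sub i2 h₄, integral_add i1 (h₃.const_mul 2),
    integral_add h₁ (h₂.const_mul 2), integral_const_mul, integral_const_mul, integral_const_mul]

namespace IsDominatedBSDE

variable {Ω : Type*} [mΩ : MeasurableSpace Ω] {N : ℕ} {P : Measure Ω}
  {A : ℝ≥0 → Matrix (Fin N) (Fin N) ℝ} {X : ℝ≥0 → Ω → Fin N → ℝ} {hX : ∀ t, Measurable (X t)}
  {T : ℝ≥0} {c : ℝ} {ξ : Ω → ℝ} {ψ h : ℝ≥0 × Ω → ℝ} {y : ℝ≥0 → Ω → ℝ}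
  {z : ℝ≥0 → Ω → Fin N → ℝ}

variable [IsProbabilityMeasure P]

theorem integrableOn_Ioc {g : ℝ≥0 × Ω → ℝ}
    (hg : Integrable (fun p => g p.swap) (timeProd P 0 T)) :
    ∀ᵐ ω ∂P, ∀ t, IntegrableOn (fun u => g (u, ω)) (Ioc t T) leb := by
  filter_upwards [Integrable.prod_right_ae hg] with ω hω t
  exact IntegrableOn.mono_set (t := Ioc 0 T) hω (Ioc_subset_Ioc_left zero_le)

theorem integrable_integral_Ioc {g : ℝ≥0 × Ω → ℝ}
    (hg : Integrable (fun p => g p.swap) (timeProd P 0 T)) (t : ℝ≥0) :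
    Integrable (fun ω => ∫ u in Ioc t T, g (u, ω) ∂leb) P ∧
      ∫ ω, ∫ u in Ioc t T, g (u, ω) ∂leb ∂P = ∫ p, g p.swap ∂timeProd P t T := by
  have h1 := hg.mono_measure (timeProd_le t T)
  exact ⟨Integrable.integral_prod_left h1, (integral_prod _ h1).symm⟩

/-- The compensation formula says that the jump sum and the drift have the same integral over any
event of ℱ_t. This is all of the martingale property that the estimate uses. -/
theorem setIntegral_stochInt (H : IsDominatedBSDE P A X hX T c ξ ψ h y z) (hA : IsRateMatrix A)
    (hM : IsMarkovChain P A X hX) {t : ℝ≥0} {B : Set Ω}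
    (hB : MeasurableSet[completedFiltration P X hX t] B) :
    IntegrableOn (stochInt A X z t T) B P ∧ ∫ ω in B, stochInt A X z t T ω ∂P = 0 := by
  obtain ⟨h1, h2⟩ := hM.setIntegral_sum_jumpSum hA (T := T) hB
    (hM.measurable_jumpSize H.predictable_z) (H.integrable_rate_mul hA hM)
  simp_rw [hM.sum_mul_jumpSize] at h1 h2
  have h3 := (integrable_integral_Ioc (H.integrable_drift hA hM) t).1.integrableOn (s := B)
  have h4 : stochInt A X z t T = fun ω =>
      (∑ u ∈ jumps (fun t => X t ω) T with t < u, z u ω ⬝ᵥ (X u ω - leftX X u ω))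
        - ∫ u in Ioc t T, drift A X z (u, ω) ∂leb := funext fun ω => hM.stochInt_eq hA ω t T
  rw [h4]
  refine ⟨h1.sub h3, ?_⟩
  rw [integral_sub h1 h3, h2, sub_eq_zero]
  rfl

theorem integrable_stochInt (H : IsDominatedBSDE P A X hX T c ξ ψ h y z) (hA : IsRateMatrix A)
    (hM : IsMarkovChain P A X hX) (t : ℝ≥0) : Integrable (stochInt A X z t T) P := by
  have := (H.setIntegral_stochInt hA hM (t := t) MeasurableSet.univ).1
  rwa [integrableOn_univ] at this

/-- The majorant of the martingale controlling `y`. -/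
noncomputable def majorant (T : ℝ≥0) (ξ : Ω → ℝ) (h : ℝ≥0 × Ω → ℝ) (ω : Ω) : ℝ :=
  |ξ ω| + ∫ u in Ioc 0 T, |h (u, ω)| ∂leb

theorem integrable_majorant (H : IsDominatedBSDE P A X hX T c ξ ψ h y z) (hA : IsRateMatrix A)
    (hM : IsMarkovChain P A X hX) : Integrable (majorant T ξ h) P :=
  (H.memLp_terminal.integrable one_le_two).abs.add
    (integrable_integral_Ioc (g := fun p => |h p|)
      ((H.memLp_integrand hA hM).integrable one_le_two).abs 0).1

/-- Conditioning the equation on ℱ_t removes the stochastic integral, so y_t is the conditional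
expectation of ξ + ∫_t^T h. Enlarging the interval to `(0,T]` makes the majorant independent of t,
hence the bound a closed martingale to which Doob applies. -/
theorem abs_le_condExp_majorant (H : IsDominatedBSDE P A X hX T c ξ ψ h y z)
    (hA : IsRateMatrix A) (hM : IsMarkovChain P A X hX) {t : ℝ≥0} (ht : t ≤ T) :
    ∀ᵐ ω ∂P, |y t ω| ≤ P[majorant T ξ h|completedFiltration P X hX t] ω := by
  have hhi := (H.memLp_integrand hA hM).integrable one_le_two
  have hξ := H.memLp_terminal.integrable one_le_two
  have h1 := (integrable_integral_Ioc hhi t).1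
  have h2 := H.integrable_stochInt hA hM t
  have hF : Integrable (fun ω => ξ ω + ∫ u in Ioc t T, h (u, ω) ∂leb) P := hξ.add h1
  have hyeq : y t =ᵐ[P] fun ω => (ξ ω + ∫ u in Ioc t T, h (u, ω) ∂leb) - stochInt A X z t T ω := by
    filter_upwards [H.equation] with ω hω using hω t ht
  have hyi : Integrable (y t) P := (hF.sub h2).congr hyeq.symm
  have hc : y t =ᵐ[P] P[fun ω => ξ ω + ∫ u in Ioc t T, h (u, ω) ∂leb|
      completedFiltration P X hX t] := by
    refine ae_eq_condExp_of_forall_setIntegral_eq ((completedFiltration P X hX).le t) hF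
      (fun s _ _ => hyi.integrableOn) (fun s hs _ => ?_)
      (H.adapted t ht).stronglyMeasurable.aestronglyMeasurable
    have h3 := H.setIntegral_stochInt hA hM hs
    rw [integral_congr_ae (ae_restrict_of_ae hyeq),
      integral_sub hF.integrableOn h3.1, h3.2, sub_zero]
  have habs := abs_condExp_ae_le_condExp_abs (μ := P) (m := completedFiltration P X hX t)
    (fun ω => ξ ω + ∫ u in Ioc t T, h (u, ω) ∂leb)
  have hmono : P[abs (fun ω => ξ ω + ∫ u in Ioc t T, h (u, ω) ∂leb)|completedFiltration P X hX t]
      ≤ᵐ[P] P[majorant T ξ h|completedFiltration P X hX t] := by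
    refine condExp_mono hF.abs (H.integrable_majorant hA hM) ?_
    filter_upwards [integrableOn_Ioc hhi] with ω hω
    refine (abs_add_le _ _).trans (add_le_add le_rfl ?_)
    refine (abs_integral_le_integral_abs).trans ?_
    exact setIntegral_mono_set (hω 0).abs (ae_of_all _ fun _ => abs_nonneg _)
      (Ioc_subset_Ioc_left zero_le).eventuallyLE
  filter_upwards [hc, habs, hmono] with ω h3 h4 h5
  rw [h3]
  exact h4.trans h5

/-- The pathwise formula for y² is integrated. The squared jumps compensate to ‖z‖², and the cross
terms y_- z' ΔX compensate to y_- times the drift and cancel. All terms are integrable beforehand,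
so no localization is involved. -/
theorem energy (H : IsDominatedBSDE P A X hX T c ξ ψ h y z)
    (hA : IsRateMatrix A) (hM : IsMarkovChain P A X hX) {t : ℝ≥0} (ht : t ≤ T) :
    Integrable (fun ω => y t ω ^ 2) P ∧
    ∫ ω, y t ω ^ 2 ∂P + ∫ p, xNormSq A X p.2 p.1 (z p.2 p.1) ∂timeProd P t T
      = ∫ ω, ξ ω ^ 2 ∂P + 2 * ∫ p, leftVersion T y p.swap * h p.swap ∂timeProd P t T := by
  have hB : MeasurableSet[completedFiltration P X hX t] (univ : Set Ω) := MeasurableSet.univ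
  have hhi := (H.memLp_integrand hA hM).integrable one_le_two
  have hyh : Integrable (fun p => leftVersion T y p.swap * h p.swap) (timeProd P 0 T) :=
    H.memLp_leftVersion.integrable_mul (H.memLp_integrand hA hM)
  have hdr := H.integrable_drift hA hM
  have hyd := H.integrable_leftVersion_mul_drift hA hM
  obtain ⟨a1, a2⟩ := hM.setIntegral_sum_jumpSum hA (T := T) hB
    (α := fun j p => jumpSize X z j p ^ 2)
    (fun j => (hM.measurable_jumpSize H.predictable_z j).pow_const 2)
    (H.integrable_rate_mul_sq hA hM)
  obtain ⟨b1, b2⟩ := hM.setIntegral_sum_jumpSum hA (T := T) hB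
    (α := fun j p => leftVersion T y p * jumpSize X z j p)
    (fun j => H.measurable_leftVersion.mul (hM.measurable_jumpSize H.predictable_z j))
    (fun j => H.integrable_rate_mul_mul hA hM j H.measurable_leftVersion H.memLp_leftVersion)
  have e1 : ∀ (u : ℝ≥0) (ω : Ω), ∑ j, X u ω j * (leftVersion T y (u, ω) * jumpSize X z j (u, ω))
      = leftVersion T y (u, ω) * (z u ω ⬝ᵥ (X u ω - leftX X u ω)) := fun u ω => by
    rw [← hM.sum_mul_jumpSize, Finset.mul_sum]
    exact Finset.sum_congr rfl fun j _ => by ring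
  have e2 : ∀ (u : ℝ≥0) (ω : Ω),
      ∑ j, jumpRate A X j (u, ω) * (leftVersion T y (u, ω) * jumpSize X z j (u, ω))
      = leftVersion T y (u, ω) * drift A X z (u, ω) := fun u ω => by
    rw [drift, Finset.mul_sum]
    exact Finset.sum_congr rfl fun j _ => by ring
  simp_rw [hM.sum_mul_jumpSize_sq, hM.sum_jumpRate_mul_jumpSize_sq hA] at a1 a2
  simp_rw [e1, e2] at b1 b2
  rw [integrableOn_univ] at a1 b1
  rw [setIntegral_univ, setIntegral_univ] at a2 b2
  obtain ⟨d1, d2⟩ :=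
    integrable_integral_Ioc (g := fun p => leftVersion T y p * h p) hyh t
  obtain ⟨f1, f2⟩ :=
    integrable_integral_Ioc (g := fun p => leftVersion T y p * drift A X z p) hyd t
  have a3 := (integrable_integral_Ioc (g := fun p => xNormSq A X p.1 p.2 (z p.1 p.2))
    H.integrable_xNormSq t).2
  have key : ∀ᵐ ω ∂P, y t ω ^ 2 = ξ ω ^ 2
      + 2 * (∫ u in Ioc t T, leftVersion T y (u, ω) * h (u, ω) ∂leb)
      + 2 * (∫ u in Ioc t T, leftVersion T y (u, ω) * drift A X z (u, ω) ∂leb)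
      - (∑ u ∈ jumps (fun t => X t ω) T with t < u, (z u ω ⬝ᵥ (X u ω - leftX X u ω)) ^ 2)
      - 2 * (∑ u ∈ jumps (fun t => X t ω) T with t < u,
        leftVersion T y (u, ω) * (z u ω ⬝ᵥ (X u ω - leftX X u ω))) := by
    filter_upwards [H.equation, integrableOn_Ioc hhi, integrableOn_Ioc (g := fun p => leftVersion T y p * h p) hyh, integrableOn_Ioc hdr,
      integrableOn_Ioc (g := fun p => leftVersion T y p * drift A X z p) hyd] with ω heq i1 i2 i3 i4
    have hJ : ∀ u ∈ jumps (fun t => X t ω) T, u ∈ Ioc 0 T := fun u hu =>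
      ⟨pos_of_mem_jumps (hM.finite_range ω) (hM.rcll ω) hu,
        ((mem_jumps (hM.finite_range ω) (hM.rcll ω)).1 hu).1⟩
    have hpath : ∀ s ≤ T, y s ω = ξ ω
        + (∫ u in Ioc s T, (h (u, ω) + drift A X z (u, ω)) ∂leb)
        - ∑ u ∈ jumps (fun t => X t ω) T with s < u, z u ω ⬝ᵥ (X u ω - leftX X u ω) := by
      intro s hs
      rw [heq s hs, hM.stochInt_eq hA, integral_add (i1 s) (i3 s)]
      ring
    have hk : IntegrableOn (fun u => h (u, ω) + drift A X z (u, ω)) (Ioc 0 T) leb :=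
      (i1 0).add (i3 0)
    rw [sq_backward_path ht hJ hk hpath]
    have hI : ∫ u in Ioc t T, y u ω * (h (u, ω) + drift A X z (u, ω)) ∂leb
        = (∫ u in Ioc t T, leftVersion T y (u, ω) * h (u, ω) ∂leb)
          + ∫ u in Ioc t T, leftVersion T y (u, ω) * drift A X z (u, ω) ∂leb := by
      rw [← integral_add (i2 t) (i4 t)]
      refine integral_congr_ae ?_
      filter_upwards [ae_mono (Measure.restrict_mono (Ioc_subset_Ioc_left zero_le) le_rfl)
        (ae_leftVersion_eq (H.rcll ω))] with u hu
      rw [hu, mul_add]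
    -- Substituting y_u = y_{u-} + a_u, with a_u the jump, turns 2 a_u y_u - a_u² into a_u² + 2 a_u
    -- y_{u-}, whose factors y_{u-} are predictable.
    have hsum : ∑ u ∈ jumps (fun t => X t ω) T with t < u,
        (2 * (z u ω ⬝ᵥ (X u ω - leftX X u ω)) * y u ω - (z u ω ⬝ᵥ (X u ω - leftX X u ω)) ^ 2)
        = (∑ u ∈ jumps (fun t => X t ω) T with t < u, (z u ω ⬝ᵥ (X u ω - leftX X u ω)) ^ 2)
          + 2 * ∑ u ∈ jumps (fun t => X t ω) T with t < u,
            leftVersion T y (u, ω) * (z u ω ⬝ᵥ (X u ω - leftX X u ω)) := by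
      rw [Finset.mul_sum, ← Finset.sum_add_distrib]
      refine Finset.sum_congr rfl fun u hu => ?_
      have huJ := (Finset.mem_filter.1 hu).1
      rw [leftVersion_apply (hJ u huJ),
        leftLim_eq_of_backward hk hpath huJ (hJ u huJ).1 (hJ u huJ).2]
      ring
    rw [hsum, hI]
    ring
  obtain ⟨l1, l2⟩ := integral_lincomb H.memLp_terminal.integrable_sq d1 f1 a1 b1
  refine ⟨l1.congr (key.mono fun ω hω => hω.symm), ?_⟩
  rw [integral_congr_ae key, l2, a2, b2, d2]
  have a3' : ∫ ω, ∫ u in Ioc t T, xNormSq A X u ω (z u ω) ∂leb ∂P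
    = ∫ p, xNormSq A X p.2 p.1 (z p.2 p.1) ∂timeProd P t T := a3
  rw [a3']
  ring

end IsDominatedBSDE

/-! ### A priori estimate -/

/-- The constant in the backward Gronwall inequality. -/
noncomputable def gronwallConst (lam : ℝ) (T : ℝ≥0) : ℝ := 2 ^ (⌈2 * lam * T⌉₊ + 1) * (2 * T)

theorem gronwallConst_nonneg (lam : ℝ) (T : ℝ≥0) : 0 ≤ gronwallConst lam T := by
  unfold gronwallConst; positivity

/-- Go back from T in n equal steps with lam T/n ≤ 1/2. On each step the implicit term lam V(s) is
absorbed, which gives V(s) ≤ 2V(t) + 2TK; iteration gives (2^n - 1)·2TK. The value of V at the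
earlier time on the right spares any continuity of V. -/
theorem backward_gronwall {V : ℝ≥0 → ℝ} {T : ℝ≥0} {K lam : ℝ} (hT : V T = 0) (h0 : ∀ t, 0 ≤ V t)
    (hK : 0 ≤ K)
    (h : ∀ s t, s ≤ t → t ≤ T → V s ≤ V t + ((t : ℝ) - s) * (K + lam * V s)) :
    V 0 ≤ gronwallConst lam T * K := by
  -- The ceiling forces lam T/n ≤ 1/2; the added 1 keeps n positive.
  set n : ℕ := ⌈2 * lam * T⌉₊ + 1 with hn
  have hn0 : (0 : ℝ) < n := by rw [hn]; positivity
  have hn1 : (1 : ℝ) ≤ n := by rw [hn]; push_cast; linarith [Nat.cast_nonneg (α := ℝ) ⌈2 * lam * T⌉₊]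
  have hlam : 2 * lam * T ≤ n := (Nat.le_ceil _).trans (by rw [hn]; push_cast; linarith)
  set τ : ℕ → ℝ≥0 := fun k => T * (((n - k : ℕ) : ℝ≥0) / n) with hτ
  have hcl : ∀ k ≤ n, V (τ k) ≤ (2 ^ k - 1) * (2 * T * K) := by
    intro k
    induction k with
    | zero =>
      intro _
      have : τ 0 = T := by
        have hn' : (n : ℝ≥0) ≠ 0 := by rw [hn]; positivity
        simp [hτ]
      rw [this, hT]; simp
    | succ k ih =>
      intro hk
      have hd : (τ k : ℝ) - τ (k + 1) = T / n := by
        simp only [hτ, NNReal.coe_mul, NNReal.coe_div, NNReal.coe_natCast]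
        rw [Nat.cast_sub hk, Nat.cast_sub (Nat.le_of_succ_le hk)]
        push_cast
        field_simp
        ring
      have hle : τ (k + 1) ≤ τ k := by
        rw [← NNReal.coe_le_coe]
        have : (0 : ℝ) ≤ T / n := by positivity
        linarith
      have hleT : τ k ≤ T := by
        refine mul_le_of_le_one_right zero_le (div_le_one_of_le₀ ?_ zero_le)
        exact_mod_cast Nat.sub_le _ _
      have h1 := h _ _ hle hleT
      rw [hd] at h1
      have h2 : (T : ℝ) / n * lam ≤ 1 / 2 := by
        rw [div_mul_eq_mul_div, div_le_iff₀ hn0]; linarith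
      have h3 : (T : ℝ) / n ≤ T := div_le_self T.2 hn1
      have h4 := mul_le_mul_of_nonneg_right h2 (h0 (τ (k + 1)))
      have h5 := mul_le_mul_of_nonneg_right h3 hK
      have h6 := ih (Nat.le_of_succ_le hk)
      have h7 : V (τ (k + 1)) ≤ 2 * V (τ k) + 2 * T * K := by linarith
      rw [pow_succ]
      linarith
  have hlast := hcl n le_rfl
  have : τ n = 0 := by simp [hτ]
  rw [this] at hlast
  refine hlast.trans ?_
  have : (0 : ℝ) ≤ 2 * T * K := by positivity
  unfold gronwallConst
  rw [← hn]
  linarith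

/-- Cauchy–Schwarz, obtained by expanding the nonnegative integral of (T f - ∫f)² over `(0,T]`. -/
theorem sq_setIntegral_le {T : ℝ≥0} {f : ℝ≥0 → ℝ} (hf : IntegrableOn f (Ioc 0 T) leb)
    (hf2 : IntegrableOn (fun u => f u ^ 2) (Ioc 0 T) leb) :
    (∫ u in Ioc 0 T, f u ∂leb) ^ 2 ≤ T * ∫ u in Ioc 0 T, f u ^ 2 ∂leb := by
  rcases eq_or_ne T 0 with rfl | hT
  · simp
  set I := ∫ u in Ioc 0 T, f u ∂leb
  have h0 : 0 ≤ ∫ u in Ioc 0 T, (T * f u - I) ^ 2 ∂leb := integral_nonneg fun _ => sq_nonneg _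
  have e : ∀ u, ((T : ℝ) * f u - I) ^ 2 = T ^ 2 * f u ^ 2 - 2 * T * I * f u + I ^ 2 := fun u => by
    ring
  simp_rw [e] at h0
  have i1 : IntegrableOn (fun u => (T : ℝ) ^ 2 * f u ^ 2) (Ioc 0 T) leb := hf2.const_mul _
  have i2 : IntegrableOn (fun u => 2 * T * I * f u) (Ioc 0 T) leb := hf.const_mul _
  have i3 : IntegrableOn (fun u => (T : ℝ) ^ 2 * f u ^ 2 - 2 * T * I * f u) (Ioc 0 T) leb :=
    i1.sub i2
  rw [integral_add i3 (integrable_const _), integral_sub i1 i2, integral_const_mul,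
    integral_const_mul, integral_const, measureReal_restrict_apply_univ, measureReal_def, leb_Ioc,
    ENNReal.toReal_ofReal (by simp)] at h0
  have hT' : (0 : ℝ) < T := by
    have := pos_iff_ne_zero.2 hT
    exact_mod_cast this
  have h1 : 0 ≤ (T : ℝ) * (T * (∫ u in Ioc 0 T, f u ^ 2 ∂leb) - I ^ 2) := by
    simp only [NNReal.coe_zero, sub_zero, smul_eq_mul] at h0
    change 0 ≤ (T : ℝ) ^ 2 * _ - 2 * T * I * I + T * I ^ 2 at h0
    linarith
  have := nonneg_of_mul_nonneg_right h1 hT'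
  linarith

namespace IsDominatedBSDE

variable {Ω : Type*} [mΩ : MeasurableSpace Ω] {N : ℕ} {P : Measure Ω}
  {A : ℝ≥0 → Matrix (Fin N) (Fin N) ℝ} {X : ℝ≥0 → Ω → Fin N → ℝ} {hX : ∀ t, Measurable (X t)}
  {T : ℝ≥0} {c : ℝ} {ξ : Ω → ℝ} {ψ h : ℝ≥0 × Ω → ℝ} {y : ℝ≥0 → Ω → ℝ}
  {z : ℝ≥0 → Ω → Fin N → ℝ}

variable [IsProbabilityMeasure P]

theorem sq_integral_Ioc_le {g : ℝ≥0 × Ω → ℝ} (hg : MemLp (fun p => g p.swap) 2 (timeProd P 0 T)) :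
    MemLp (fun ω => ∫ u in Ioc 0 T, g (u, ω) ∂leb) 2 P ∧
      ∫ ω, (∫ u in Ioc 0 T, g (u, ω) ∂leb) ^ 2 ∂P ≤ T * ∫ p, g p.swap ^ 2 ∂timeProd P 0 T := by
  obtain ⟨a1, a2⟩ := integrable_integral_Ioc (hg.integrable one_le_two) 0
  obtain ⟨b1, b2⟩ := integrable_integral_Ioc (g := fun p => g p ^ 2) hg.integrable_sq 0
  have hle : ∀ᵐ ω ∂P, (∫ u in Ioc 0 T, g (u, ω) ∂leb) ^ 2
      ≤ T * ∫ u in Ioc 0 T, g (u, ω) ^ 2 ∂leb := by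
    filter_upwards [integrableOn_Ioc (hg.integrable one_le_two),
      integrableOn_Ioc (g := fun p => g p ^ 2) hg.integrable_sq] with ω h1 h2
    exact sq_setIntegral_le (h1 0) (h2 0)
  have hint : Integrable (fun ω => (∫ u in Ioc 0 T, g (u, ω) ∂leb) ^ 2) P := by
    refine (b1.const_mul (T : ℝ)).mono' (a1.1.pow 2) (hle.mono fun ω hω => ?_)
    rwa [Real.norm_eq_abs, abs_of_nonneg (sq_nonneg _)]
  refine ⟨(memLp_two_iff_integrable_sq a1.1).2 hint, ?_⟩
  refine (integral_mono_ae hint (b1.const_mul _) hle).trans (le_of_eq ?_)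
  rw [integral_const_mul, b2]

/-- The dominated bound splits the majorant into four terms, whence the factor 4. Cauchy–Schwarz in
time is applied only to y and z; the source keeps the square outside its time integral. -/
theorem majorant_le (H : IsDominatedBSDE P A X hX T c ξ ψ h y z) (hA : IsRateMatrix A)
    (hM : IsMarkovChain P A X hX) :
    MemLp (majorant T ξ h) 2 P ∧
    ∫ ω, majorant T ξ h ω ^ 2 ∂P ≤ 4 * (∫ ω, ξ ω ^ 2 ∂P
      + ∫ ω, (∫ u in Ioc 0 T, |ψ (u, ω)| ∂leb) ^ 2 ∂P
      + c ^ 2 * T * ∫ p, leftVersion T y p.swap ^ 2 ∂timeProd P 0 T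
      + c ^ 2 * T * ∫ p, xNormSq A X p.2 p.1 (z p.2 p.1) ∂timeProd P 0 T) := by
  have hG1 := (sq_integral_Ioc_le (g := fun p => |h p|) (H.memLp_integrand hA hM).norm).1
  have hG : MemLp (majorant T ξ h) 2 P := H.memLp_terminal.norm.add hG1
  refine ⟨hG, ?_⟩
  obtain ⟨p1, -⟩ := sq_integral_Ioc_le (g := fun p => |ψ p|) H.memLp_source.norm
  obtain ⟨y1, y2⟩ := sq_integral_Ioc_le (g := fun p => |leftVersion T y p|) H.memLp_leftVersion.norm
  obtain ⟨z1, z2⟩ := sq_integral_Ioc_le (g := fun p => xNorm A X p.1 p.2 (z p.1 p.2))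
    (H.memLp_xNorm hA hM)
  have hz : ∀ p : Ω × ℝ≥0, xNorm A X p.2 p.1 (z p.2 p.1) ^ 2 = xNormSq A X p.2 p.1 (z p.2 p.1) :=
    fun p => Real.sq_sqrt (hM.xNormSq_nonneg hA _ _ _)
  simp only [Prod.fst_swap, Prod.snd_swap, hz, sq_abs] at y2 z2
  have i1 := H.memLp_terminal.integrable_sq
  have i2 := p1.integrable_sq
  have i3 := (y1.integrable_sq.const_mul (c ^ 2))
  have i4 := (z1.integrable_sq.const_mul (c ^ 2))
  have j1 : Integrable (fun ω => ξ ω ^ 2 + (∫ u in Ioc 0 T, |ψ (u, ω)| ∂leb) ^ 2) P := i1.add i2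
  have j2 : Integrable (fun ω => ξ ω ^ 2 + (∫ u in Ioc 0 T, |ψ (u, ω)| ∂leb) ^ 2
    + c ^ 2 * (∫ u in Ioc 0 T, |leftVersion T y (u, ω)| ∂leb) ^ 2) P := j1.add i3
  have j3 : Integrable (fun ω => ξ ω ^ 2 + (∫ u in Ioc 0 T, |ψ (u, ω)| ∂leb) ^ 2
    + c ^ 2 * (∫ u in Ioc 0 T, |leftVersion T y (u, ω)| ∂leb) ^ 2
    + c ^ 2 * (∫ u in Ioc 0 T, xNorm A X u ω (z u ω) ∂leb) ^ 2) P := j2.add i4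
  have hle : ∀ᵐ ω ∂P, majorant T ξ h ω ^ 2 ≤ 4 * (ξ ω ^ 2 + (∫ u in Ioc 0 T, |ψ (u, ω)| ∂leb) ^ 2
      + c ^ 2 * (∫ u in Ioc 0 T, |leftVersion T y (u, ω)| ∂leb) ^ 2
      + c ^ 2 * (∫ u in Ioc 0 T, xNorm A X u ω (z u ω) ∂leb) ^ 2) := by
    have hb := Measure.ae_ae_of_ae_prod (H.ae_bound hA hM)
    filter_upwards [hb, integrableOn_Ioc ((H.memLp_integrand hA hM).integrable one_le_two),
      integrableOn_Ioc (H.memLp_source.integrable one_le_two),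
      integrableOn_Ioc (H.memLp_leftVersion.integrable one_le_two),
      integrableOn_Ioc (g := fun p => xNorm A X p.1 p.2 (z p.1 p.2))
        ((H.memLp_xNorm hA hM).integrable one_le_two)] with ω hω k1 k2 k3 k4
    have l2 : IntegrableOn (fun u => c * |leftVersion T y (u, ω)|) (Ioc 0 T) leb :=
      (k3 0).abs.const_mul c
    have l3 : IntegrableOn (fun u => c * xNorm A X u ω (z u ω)) (Ioc 0 T) leb :=
      (k4 0).const_mul c
    have l4 : IntegrableOn (fun u => |ψ (u, ω)| + c * |leftVersion T y (u, ω)|) (Ioc 0 T) leb :=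
      (k2 0).abs.add l2
    have hI : ∫ u in Ioc 0 T, |h (u, ω)| ∂leb ≤ (∫ u in Ioc 0 T, |ψ (u, ω)| ∂leb)
        + c * (∫ u in Ioc 0 T, |leftVersion T y (u, ω)| ∂leb)
        + c * (∫ u in Ioc 0 T, xNorm A X u ω (z u ω) ∂leb) := by
      refine (integral_mono_ae (k1 0).abs (l4.add l3) hω).trans (le_of_eq ?_)
      rw [← integral_const_mul, ← integral_const_mul, ← integral_add (k2 0).abs l2,
        ← integral_add l4 l3]
      rfl
    have h0 : 0 ≤ majorant T ξ h ω :=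
      add_nonneg (abs_nonneg _) (integral_nonneg fun _ => abs_nonneg _)
    set p := ∫ u in Ioc 0 T, |ψ (u, ω)| ∂leb
    set q := ∫ u in Ioc 0 T, |leftVersion T y (u, ω)| ∂leb
    set r := ∫ u in Ioc 0 T, xNorm A X u ω (z u ω) ∂leb
    have h1 : majorant T ξ h ω ≤ |ξ ω| + (p + c * q + c * r) := add_le_add le_rfl hI
    calc majorant T ξ h ω ^ 2 ≤ (|ξ ω| + (p + c * q + c * r)) ^ 2 := pow_le_pow_left₀ h0 h1 2
      _ ≤ 4 * (|ξ ω| ^ 2 + p ^ 2 + (c * q) ^ 2 + (c * r) ^ 2) := by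
        nlinarith [sq_nonneg (|ξ ω| - p), sq_nonneg (|ξ ω| - c * q), sq_nonneg (|ξ ω| - c * r),
          sq_nonneg (p - c * q), sq_nonneg (p - c * r), sq_nonneg (c * q - c * r)]
      _ = _ := by rw [sq_abs]; ring
  refine (integral_mono_ae hG.integrable_sq (j3.const_mul 4) hle).trans ?_
  rw [integral_const_mul, integral_add j2 i4, integral_add j1 i3, integral_add i1 i2,
    integral_const_mul, integral_const_mul]
  have := mul_le_mul_of_nonneg_left y2 (sq_nonneg c)
  have := mul_le_mul_of_nonneg_left z2 (sq_nonneg c)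
  linarith

/-- Doob's constant 4 times the 4 of `majorant_le`. The finiteness of this bound is what later
allows the supremum to be absorbed. -/
theorem lintegral_iSup_le (H : IsDominatedBSDE P A X hX T c ξ ψ h y z) (hA : IsRateMatrix A)
    (hM : IsMarkovChain P A X hX) :
    ∫⁻ ω, ⨆ t ∈ Icc 0 T, ‖y t ω‖ₑ ^ 2 ∂P ≤ ENNReal.ofReal (16 * (∫ ω, ξ ω ^ 2 ∂P
      + ∫ ω, (∫ u in Ioc 0 T, |ψ (u, ω)| ∂leb) ^ 2 ∂P
      + c ^ 2 * T * ∫ p, leftVersion T y p.swap ^ 2 ∂timeProd P 0 T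
      + c ^ 2 * T * ∫ p, xNormSq A X p.2 p.1 (z p.2 p.1) ∂timeProd P 0 T)) := by
  obtain ⟨h1, h2⟩ := H.majorant_le hA hM
  refine (lintegral_iSup_sq_le (fun t ht => (H.adapted t ht).mono
    ((completedFiltration P X hX).le t) le_rfl) (fun ω => (H.rcll ω).1) h1
    (fun t ht => H.abs_le_condExp_majorant hA hM ht)).trans ?_
  have e : ∫⁻ ω, ‖majorant T ξ h ω‖ₑ ^ 2 ∂P = ENNReal.ofReal (∫ ω, majorant T ξ h ω ^ 2 ∂P) := by
    rw [ofReal_integral_eq_lintegral_ofReal h1.integrable_sq (ae_of_all _ fun _ => sq_nonneg _)]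
    refine lintegral_congr fun ω => ?_
    rw [← Real.enorm_of_nonneg (sq_nonneg _), enorm_pow]
  rw [e, show (4 : ℝ≥0∞) = ENNReal.ofReal 4 by norm_num, ← ENNReal.ofReal_mul (by norm_num)]
  exact ENNReal.ofReal_le_ofReal (by linarith)

/-- The interaction of the solution with the source. -/
theorem interaction_le (H : IsDominatedBSDE P A X hX T c ξ ψ h y z) {ε s : ℝ} (hε : 0 < ε)
    (hs0 : 0 ≤ s) (hs : ∫⁻ ω, ⨆ t ∈ Icc 0 T, ‖y t ω‖ₑ ^ 2 ∂P = ENNReal.ofReal s) :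
    2 * ∫ p, |leftVersion T y p.swap| * |ψ p.swap| ∂timeProd P 0 T
      ≤ ε * s + ε⁻¹ * ∫ ω, (∫ u in Ioc 0 T, |ψ (u, ω)| ∂leb) ^ 2 ∂P := by
  have hyp : Integrable (fun p => |leftVersion T y p.swap| * |ψ p.swap|) (timeProd P 0 T) :=
    H.memLp_leftVersion.norm.integrable_mul H.memLp_source.norm
  obtain ⟨a1, a2⟩ := integrable_integral_Ioc (g := fun p => |leftVersion T y p| * |ψ p|) hyp 0
  obtain ⟨p1, -⟩ := sq_integral_Ioc_le (g := fun p => |ψ p|) H.memLp_source.norm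
  have q0 : 0 ≤ ∫ ω, (∫ u in Ioc 0 T, |ψ (u, ω)| ∂leb) ^ 2 ∂P :=
    integral_nonneg fun _ => sq_nonneg _
  rw [← ENNReal.ofReal_le_ofReal_iff (by positivity), ← a2, ← integral_const_mul,
    ENNReal.ofReal_add (by positivity) (by positivity), ENNReal.ofReal_mul hε.le, ← hs,
    ← integral_const_mul,
    ofReal_integral_eq_lintegral_ofReal (a1.const_mul 2) (ae_of_all _ fun ω =>
      mul_nonneg (by norm_num) (integral_nonneg fun _ => by positivity)),
    ofReal_integral_eq_lintegral_ofReal (p1.integrable_sq.const_mul _) (ae_of_all _ fun ω =>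
      by positivity), ← lintegral_const_mul' _ _ ENNReal.ofReal_ne_top,
    ← lintegral_add_right' _ (p1.integrable_sq.const_mul _).1.aemeasurable.ennreal_ofReal]
  refine lintegral_mono_ae ?_
  filter_upwards [integrableOn_Ioc (H.memLp_source.integrable one_le_two),
    integrableOn_Ioc (g := fun p => |leftVersion T y p| * |ψ p|) hyp] with ω k1 k2
  set S := ⨆ t ∈ Icc 0 T, ‖y t ω‖ₑ ^ 2 with hS
  rcases eq_or_ne S ∞ with hST | hST
  -- On paths where the supremum is infinite the pointwise inequality is trivial.
  · rw [hST, ENNReal.mul_top (by simpa using hε), top_add]; exact le_top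
  have hy : ∀ᵐ u ∂leb.restrict (Ioc 0 T), |leftVersion T y (u, ω)| ≤ √S.toReal := by
    filter_upwards [ae_leftVersion_eq (H.rcll ω), ae_restrict_mem measurableSet_Ioc]
      with u hu hm
    rw [hu]
    refine Real.abs_le_sqrt ?_
    rw [← ENNReal.ofReal_le_iff_le_toReal hST, ← Real.enorm_of_nonneg (sq_nonneg _), enorm_pow]
    exact le_iSup₂_of_le u (Ioc_subset_Icc_self hm) le_rfl
  have hle : ∫ u in Ioc 0 T, |leftVersion T y (u, ω)| * |ψ (u, ω)| ∂leb
      ≤ √S.toReal * ∫ u in Ioc 0 T, |ψ (u, ω)| ∂leb := by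
    rw [← integral_const_mul]
    refine integral_mono_ae (k2 0) ((k1 0).abs.const_mul _) ?_
    filter_upwards [hy] with u hu
    exact mul_le_mul_of_nonneg_right hu (abs_nonneg _)
  rw [← ENNReal.ofReal_toReal hST, ← ENNReal.ofReal_mul hε.le,
    ← ENNReal.ofReal_add (by positivity) (by positivity)]
  refine ENNReal.ofReal_le_ofReal ?_
  set q := ∫ u in Ioc 0 T, |ψ (u, ω)| ∂leb
  have hsq : √S.toReal ^ 2 = S.toReal := Real.sq_sqrt ENNReal.toReal_nonneg
  -- Pathwise, ∫|y||ψ| is at most sup|y| times ∫|ψ|, followed by Young with weight ε.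
  have hmain : 2 * (√S.toReal * q) ≤ ε * √S.toReal ^ 2 + ε⁻¹ * q ^ 2 := by
    have : 0 ≤ ε⁻¹ * (ε * √S.toReal - q) ^ 2 := by positivity
    have e : ε⁻¹ * (ε * √S.toReal - q) ^ 2
        = ε * √S.toReal ^ 2 + ε⁻¹ * q ^ 2 - 2 * (√S.toReal * q) := by
      field_simp; ring
    linarith
  rw [hsq] at hmain
  linarith

/-- In the energy identity c|y|‖z‖ ≤ c² y² + ‖z‖²/4; after doubling, half of ‖z‖² stays on the left
and y² has coefficient 2c + 2c². The source term is taken over all of `(0,T]` so that it does not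
depend on t. -/
theorem energy_le (H : IsDominatedBSDE P A X hX T c ξ ψ h y z)
    (hA : IsRateMatrix A) (hM : IsMarkovChain P A X hX) {t : ℝ≥0} (ht : t ≤ T) :
    ∫ ω, y t ω ^ 2 ∂P + 1 / 2 * ∫ p, xNormSq A X p.2 p.1 (z p.2 p.1) ∂timeProd P t T
      ≤ (∫ ω, ξ ω ^ 2 ∂P + 2 * ∫ p, |leftVersion T y p.swap| * |ψ p.swap| ∂timeProd P 0 T)
        + (2 * c + 2 * c ^ 2) * ∫ p, leftVersion T y p.swap ^ 2 ∂timeProd P t T := by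
  have h1 := (H.energy hA hM ht).2
  have hyp : Integrable (fun p => |leftVersion T y p.swap| * |ψ p.swap|) (timeProd P 0 T) :=
    H.memLp_leftVersion.norm.integrable_mul H.memLp_source.norm
  have hyh : Integrable (fun p => leftVersion T y p.swap * h p.swap) (timeProd P 0 T) :=
    H.memLp_leftVersion.integrable_mul (H.memLp_integrand hA hM)
  have hy2 := H.memLp_leftVersion.integrable_sq.const_mul (c + c ^ 2)
  have hz2 := H.integrable_xNormSq.const_mul (1 / 4)
  have hb : ∀ᵐ p ∂timeProd P 0 T, leftVersion T y p.swap * h p.swap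
      ≤ |leftVersion T y p.swap| * |ψ p.swap| + (c + c ^ 2) * leftVersion T y p.swap ^ 2
        + 1 / 4 * xNormSq A X p.2 p.1 (z p.2 p.1) := by
    filter_upwards [H.ae_bound hA hM] with p hp
    have hz : xNorm A X p.2 p.1 (z p.2 p.1) ^ 2 = xNormSq A X p.2 p.1 (z p.2 p.1) :=
      Real.sq_sqrt (hM.xNormSq_nonneg hA _ _ _)
    rw [← hz, ← sq_abs (leftVersion T y p.swap)]
    have h2 := mul_le_mul_of_nonneg_left hp (abs_nonneg (leftVersion T y p.swap))
    have h3 : leftVersion T y p.swap * h p.swap ≤ |leftVersion T y p.swap| * |h p.swap| := by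
      rw [← abs_mul]; exact le_abs_self _
    nlinarith [sq_nonneg (c * |leftVersion T y p.swap| - 1 / 2 * xNorm A X p.2 p.1 (z p.2 p.1))]
  have l := timeProd_le (P := P) t T
  have m1 := hyp.mono_measure l
  have m2 := hy2.mono_measure l
  have m3 := hz2.mono_measure l
  have m12 : Integrable (fun p => |leftVersion T y p.swap| * |ψ p.swap|
    + (c + c ^ 2) * leftVersion T y p.swap ^ 2) (timeProd P t T) := m1.add m2
  have h4 := integral_mono_ae (hyh.mono_measure l) (m12.add m3) (ae_mono l hb)
  have h5 : ∫ p, |leftVersion T y p.swap| * |ψ p.swap| ∂timeProd P t T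
      ≤ ∫ p, |leftVersion T y p.swap| * |ψ p.swap| ∂timeProd P 0 T :=
    integral_mono_measure l (ae_of_all _ fun _ => by positivity) hyp
  rw [integral_add' m12 m3, integral_add m1 m2, integral_const_mul, integral_const_mul] at h4
  linarith

theorem timeProd_add {s t : ℝ≥0} (hst : s ≤ t) (htT : t ≤ T) :
    timeProd P s T = timeProd P s t + timeProd P t T := by
  rw [timeProd, timeProd, timeProd, ← Measure.prod_add, ← Measure.restrict_union
    (Ioc_disjoint_Ioc_of_le le_rfl) measurableSet_Ioc, Ioc_union_Ioc_eq_Ioc hst htT]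

/-- The left version equals y almost everywhere in the product, so Fubini in time reduces to the
bound at fixed times. Joint measurability of y is what allows this replacement. -/
theorem integral_leftVersion_sq_le (H : IsDominatedBSDE P A X hX T c ξ ψ h y z) {s t : ℝ≥0}
    (hst : s ≤ t) (htT : t ≤ T) {D : ℝ} (hD : ∀ u ∈ Ioc s t, ∫ ω, y u ω ^ 2 ∂P ≤ D) :
    ∫ p, leftVersion T y p.swap ^ 2 ∂timeProd P s t ≤ ((t : ℝ) - s) * D := by
  have hm := measurable_stopped_of_right_continuous (T := T)
    (fun t ht => (H.adapted t ht).mono ((completedFiltration P X hX).le t) le_rfl)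
    (fun ω => (H.rcll ω).1)
  have hm' : Measurable fun p : Ω × ℝ≥0 => y (min p.2 T) p.1 := hm.comp measurable_swap
  have hl : Measurable fun p : Ω × ℝ≥0 => leftVersion T y p.swap :=
    (H.measurable_leftVersion.mono (predictable_le _) le_rfl).comp measurable_swap
  have hle : timeProd P s t ≤ timeProd P 0 T := by
    refine le_trans ?_ (timeProd_le s T)
    rw [timeProd_add hst htT]
    exact Measure.le_add_right le_rfl
  have hae : ∀ᵐ p ∂timeProd P 0 T, leftVersion T y p.swap ^ 2 = y (min p.2 T) p.1 ^ 2 := by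
    rw [timeProd, Measure.ae_prod_iff_ae_ae
      (measurableSet_eq_fun (hl.pow_const 2) (hm'.pow_const 2))]
    refine ae_of_all _ fun ω => ?_
    filter_upwards [ae_leftVersion_eq (H.rcll ω), ae_restrict_mem measurableSet_Ioc]
      with u hu hmem
    rw [Prod.swap_prod_mk, hu, min_eq_left hmem.2]
  have hint : Integrable (fun p : Ω × ℝ≥0 => y (min p.2 T) p.1 ^ 2) (timeProd P s t) :=
    (H.memLp_leftVersion.integrable_sq.congr hae).mono_measure hle
  rw [integral_congr_ae (ae_mono hle hae), timeProd, integral_prod_symm _ hint]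
  refine (setIntegral_mono_on hint.integral_prod_right (integrable_const D) measurableSet_Ioc
    fun u hu => ?_).trans ?_
  · simp only [min_eq_left (hu.2.trans htT)]
    exact hD u hu
  · rw [integral_const, measureReal_restrict_apply_univ, measureReal_def, leb_Ioc,
      ENNReal.toReal_ofReal (sub_nonneg.2 (NNReal.coe_le_coe.2 hst)), smul_eq_mul]

/-- Take V(t) = E∫_t^T y². By the energy inequality each E y_u² with u in `(s,t]` is at most K + lam
V(u) ≤ K + lam V(s), because V is nonincreasing; integrating over `(s,t]` gives the hypothesis of
`backward_gronwall`. -/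
theorem integral_leftVersion_sq_le_gronwall (H : IsDominatedBSDE P A X hX T c ξ ψ h y z)
    (hc : 0 ≤ c) (hA : IsRateMatrix A) (hM : IsMarkovChain P A X hX) :
    ∫ p, leftVersion T y p.swap ^ 2 ∂timeProd P 0 T ≤ gronwallConst (2 * c + 2 * c ^ 2) T *
      (∫ ω, ξ ω ^ 2 ∂P + 2 * ∫ p, |leftVersion T y p.swap| * |ψ p.swap| ∂timeProd P 0 T) := by
  refine backward_gronwall (V := fun t => ∫ p, leftVersion T y p.swap ^ 2 ∂timeProd P t T) ?_
    (fun t => integral_nonneg fun _ => sq_nonneg _)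
    (add_nonneg (integral_nonneg fun _ => sq_nonneg _)
      (mul_nonneg (by norm_num) (integral_nonneg fun _ => by positivity))) ?_
  · simp [timeProd]
  · intro s t hst htT
    have hi := H.memLp_leftVersion.integrable_sq.mono_measure (timeProd_le s T)
    have hadd := timeProd_add (P := P) hst htT
    have hi' := hi
    rw [hadd, integrable_add_measure] at hi'
    have h1 : ∫ p, leftVersion T y p.swap ^ 2 ∂timeProd P s T
        = ∫ p, leftVersion T y p.swap ^ 2 ∂timeProd P s t
          + ∫ p, leftVersion T y p.swap ^ 2 ∂timeProd P t T := by
      rw [hadd, integral_add_measure hi'.1 hi'.2]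
    suffices h6 : ∀ u ∈ Ioc s t, ∫ ω, y u ω ^ 2 ∂P ≤ (∫ ω, ξ ω ^ 2 ∂P
        + 2 * ∫ p, |leftVersion T y p.swap| * |ψ p.swap| ∂timeProd P 0 T)
        + (2 * c + 2 * c ^ 2) * ∫ p, leftVersion T y p.swap ^ 2 ∂timeProd P s T by
      linarith [H.integral_leftVersion_sq_le hst htT h6]
    intro u hu
    have h2 := H.energy_le hA hM (hu.2.trans htT)
    have h3 : 0 ≤ ∫ p, xNormSq A X p.2 p.1 (z p.2 p.1) ∂timeProd P u T :=
      integral_nonneg fun p => hM.xNormSq_nonneg hA _ _ _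
    have h4 : ∫ p, leftVersion T y p.swap ^ 2 ∂timeProd P u T
        ≤ ∫ p, leftVersion T y p.swap ^ 2 ∂timeProd P s T := by
      refine integral_mono_measure ?_ (ae_of_all _ fun _ => sq_nonneg _) hi
      rw [timeProd_add (P := P) hu.1.le (hu.2.trans htT)]
      exact Measure.le_add_left le_rfl
    have h5 := mul_le_mul_of_nonneg_left h4 (by positivity : 0 ≤ 2 * c + 2 * c ^ 2)
    linarith

end IsDominatedBSDE

/-- The constant of the a priori estimate. -/
noncomputable def estimateConst (c : ℝ) (T : ℝ≥0) : ℝ :=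
  let D₁ := gronwallConst (2 * c + 2 * c ^ 2) T
  let D₂ := 2 * (1 + (2 * c + 2 * c ^ 2) * D₁)
  let F := 16 * c ^ 2 * T * (D₁ + D₂)
  let R := 2 * (16 + F + 2 * F * (F + 1))
  R + D₂ * (1 + R + 2 * (F + 1))

theorem estimateConst_pos {c : ℝ} (hc : 0 ≤ c) (T : ℝ≥0) : 0 < estimateConst c T := by
  have := gronwallConst_nonneg (2 * c + 2 * c ^ 2) T
  unfold estimateConst
  positivity

/-- Here s stands for E sup|y|², W for E∫‖z‖², U for E∫y², and e, q, κ for the terminal, source and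
interaction terms. First U and W, then s, are bounded through e + κ; the estimate of κ by εs + ε⁻¹q
closes the loop. -/
theorem closing_estimate {c s W U e q κ : ℝ} {T : ℝ≥0} (hc : 0 ≤ c) (he : 0 ≤ e) (hq : 0 ≤ q)
    (hs : s ≤ 16 * (e + q + c ^ 2 * T * U + c ^ 2 * T * W))
    (hU : U ≤ gronwallConst (2 * c + 2 * c ^ 2) T * (e + κ))
    (hW : 1 / 2 * W ≤ e + κ + (2 * c + 2 * c ^ 2) * U)
    (hs0 : 0 ≤ s) (hκ : ∀ ε > 0, κ ≤ ε * s + ε⁻¹ * q) :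
    s + W ≤ estimateConst c T * (e + q) := by
  have hD₁ := gronwallConst_nonneg (2 * c + 2 * c ^ 2) T
  unfold estimateConst
  set D₁ := gronwallConst (2 * c + 2 * c ^ 2) T
  set lam := 2 * c + 2 * c ^ 2 with hlam
  have hl : 0 ≤ lam := by positivity
  extract_lets D D₂ F R
  have hD : D = D₁ := rfl
  have hD₂ : D₂ = 2 * (1 + lam * D₁) := rfl
  have hF : F = 16 * c ^ 2 * T * (D₁ + D₂) := rfl
  have hR : R = 2 * (16 + F + 2 * F * (F + 1)) := rfl
  clear_value D D₂ F R
  have hD₂0 : 0 ≤ D₂ := by rw [hD₂]; positivity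
  have hF0 : 0 ≤ F := by rw [hF]; positivity
  have hR0 : 0 ≤ R := by rw [hR]; positivity
  have hW' : W ≤ D₂ * (e + κ) := by
    have := mul_le_mul_of_nonneg_left hU hl
    rw [hD₂]; linarith
  have hcT : 0 ≤ 16 * c ^ 2 * T := by positivity
  have hs1 : s ≤ 16 * (e + q) + F * (e + κ) := by
    have h1 := mul_le_mul_of_nonneg_left hU hcT
    have h2 := mul_le_mul_of_nonneg_left hW' hcT
    rw [hF]; linarith
  -- This ε makes Fε ≤ 1/2, so Fκ costs at most half of s; the added 1 keeps ε defined when F = 0.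
  have hκ' := hκ (1 / (2 * (F + 1))) (by positivity)
  rw [one_div, inv_inv] at hκ'
  have hFi : F * (2 * (F + 1))⁻¹ ≤ 1 / 2 := by
    rw [← div_eq_mul_inv, div_le_iff₀ (by positivity)]; linarith
  have hi1 : (2 * (F + 1))⁻¹ ≤ 1 := inv_le_one_of_one_le₀ (by linarith)
  have hs2 : s ≤ R * (e + q) := by
    have h1 := mul_le_mul_of_nonneg_left hκ' hF0
    have h2 := mul_le_mul_of_nonneg_right hFi hs0
    have h3 : 0 ≤ 2 * (F * (F + 1)) * e := by positivity
    have h4 : 0 ≤ F * q := by positivity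
    rw [hR]; linarith
  have hK : e + κ ≤ (1 + R + 2 * (F + 1)) * (e + q) := by
    have h1 := mul_le_mul_of_nonneg_right hi1 hs0
    have h2 : 0 ≤ 2 * (F + 1) * e := by positivity
    linarith
  have := mul_le_mul_of_nonneg_left hK hD₂0
  linarith

theorem jumpSize_sub {Ω : Type*} {N : ℕ} {X : ℝ≥0 → Ω → Fin N → ℝ} {z₁ z₂ : ℝ≥0 → Ω → Fin N → ℝ} (j : Fin N) (p : ℝ≥0 × Ω) :
    jumpSize X (fun t ω => z₁ t ω - z₂ t ω) j p = jumpSize X z₁ j p - jumpSize X z₂ j p := by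
  simp only [jumpSize, Pi.sub_apply, sub_dotProduct]
  ring

theorem leftVersion_sub {Ω : Type*} {T : ℝ≥0} {y₁ y₂ : ℝ≥0 → Ω → ℝ}
    (h₁ : ∀ ω, IsRCLLOn T fun t => y₁ t ω)
    (h₂ : ∀ ω, IsRCLLOn T fun t => y₂ t ω) (p : ℝ≥0 × Ω) :
    leftVersion T (fun t ω => y₁ t ω - y₂ t ω) p = leftVersion T y₁ p - leftVersion T y₂ p := by
  obtain ⟨u, ω⟩ := p
  by_cases hu : u ∈ Ioc 0 T
  · rw [leftVersion_apply hu, leftVersion_apply hu, leftVersion_apply hu]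
    have : (𝓝[<] u).NeBot := (tendsto_gridLeft hu.1).neBot
    exact leftLim_eq_of_tendsto ((tendsto_leftLim_of_tendsto ((h₁ ω).2 u hu.2)).sub
      (tendsto_leftLim_of_tendsto ((h₂ ω).2 u hu.2)))
  · have hn : (u, ω) ∉ Ioc (0 : ℝ≥0) T ×ˢ (univ : Set Ω) := fun h => hu h.1
    simp only [leftVersion, indicator_of_notMem hn, sub_zero]

section Estimate

variable {Ω : Type*} [mΩ : MeasurableSpace Ω] {N : ℕ} {P : Measure Ω}
  {A : ℝ≥0 → Matrix (Fin N) (Fin N) ℝ} {X : ℝ≥0 → Ω → Fin N → ℝ} {hX : ∀ t, Measurable (X t)}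
  {T : ℝ≥0} {c : ℝ} {ξ : Ω → ℝ} {ψ h : ℝ≥0 × Ω → ℝ} {y : ℝ≥0 → Ω → ℝ}
  {z : ℝ≥0 → Ω → Fin N → ℝ}

variable [IsProbabilityMeasure P]

/-- A priori estimate for dominated backward equations. -/
theorem IsDominatedBSDE.estimate (H : IsDominatedBSDE P A X hX T c ξ ψ h y z) (hc : 0 ≤ c)
    (hA : IsRateMatrix A) (hM : IsMarkovChain P A X hX) :
    ∫⁻ ω, ((⨆ t ∈ Icc 0 T, ‖y t ω‖ₑ ^ 2) +
        ∫⁻ t in Icc 0 T, ENNReal.ofReal (xNormSq A X t ω (z t ω)) ∂leb) ∂P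
      ≤ ENNReal.ofReal (estimateConst c T) *
        ∫⁻ ω, (‖ξ ω‖ₑ ^ 2 + (∫⁻ t in Icc 0 T, ‖ψ (t, ω)‖ₑ ∂leb) ^ 2) ∂P := by
  have hIcc : leb.restrict (Icc 0 T) = leb.restrict (Ioc 0 T) :=
    (Measure.restrict_congr_set Ioc_ae_eq_Icc).symm
  rw [hIcc]
  obtain ⟨p1, -⟩ := sq_integral_Ioc_le (g := fun p => |ψ p|) H.memLp_source.norm
  have hmz : Measurable fun p : Ω × ℝ≥0 => ENNReal.ofReal (xNormSq A X p.2 p.1 (z p.2 p.1)) :=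
    (hM.measurable_xNormSq hA H.predictable_z).ennreal_ofReal
  have hz0 : ∀ p : Ω × ℝ≥0, 0 ≤ xNormSq A X p.2 p.1 (z p.2 p.1) := fun p =>
    hM.xNormSq_nonneg hA _ _ _
  have hz : ∫⁻ ω, ∫⁻ t in Ioc 0 T, ENNReal.ofReal (xNormSq A X t ω (z t ω)) ∂leb ∂P
      = ENNReal.ofReal (∫ p, xNormSq A X p.2 p.1 (z p.2 p.1) ∂timeProd P 0 T) := by
    rw [ofReal_integral_eq_lintegral_ofReal H.integrable_xNormSq (ae_of_all _ hz0), timeProd,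
      lintegral_prod _ hmz.aemeasurable]
  have hψ : ∀ᵐ ω ∂P, ‖ξ ω‖ₑ ^ 2 + (∫⁻ t in Ioc 0 T, ‖ψ (t, ω)‖ₑ ∂leb) ^ 2
      = ENNReal.ofReal (ξ ω ^ 2 + (∫ t in Ioc 0 T, |ψ (t, ω)| ∂leb) ^ 2) := by
    filter_upwards [integrableOn_Ioc (H.memLp_source.integrable one_le_two)] with ω hω
    rw [ENNReal.ofReal_add (sq_nonneg _) (sq_nonneg _), ← Real.enorm_of_nonneg (sq_nonneg (ξ ω)),
      enorm_pow, ENNReal.ofReal_pow (integral_nonneg fun _ => abs_nonneg _),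
      ofReal_integral_eq_lintegral_ofReal (hω 0).abs (ae_of_all _ fun _ => abs_nonneg _)]
    simp_rw [← Real.enorm_eq_ofReal_abs]
  have hRHS : ∫⁻ ω, (‖ξ ω‖ₑ ^ 2 + (∫⁻ t in Ioc 0 T, ‖ψ (t, ω)‖ₑ ∂leb) ^ 2) ∂P
      = ENNReal.ofReal (∫ ω, ξ ω ^ 2 ∂P + ∫ ω, (∫ u in Ioc 0 T, |ψ (u, ω)| ∂leb) ^ 2 ∂P) := by
    have hi : Integrable (fun ω => ξ ω ^ 2 + (∫ u in Ioc 0 T, |ψ (u, ω)| ∂leb) ^ 2) P :=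
      H.memLp_terminal.integrable_sq.add p1.integrable_sq
    rw [lintegral_congr_ae hψ, ← ofReal_integral_eq_lintegral_ofReal hi
        (ae_of_all _ fun ω => add_nonneg (sq_nonneg _) (sq_nonneg _)),
      integral_add H.memLp_terminal.integrable_sq p1.integrable_sq]
  rw [hRHS, lintegral_add_right _ hmz.lintegral_prod_right', hz,
    ← ENNReal.ofReal_mul (estimateConst_pos hc T).le]
  have hsup := H.lintegral_iSup_le hA hM
  -- Finiteness of the expected squared supremum, supplied by Doob and the square integrability of
  -- the integrand, permits working with real numbers and absorbing it.
  have hfin : ∫⁻ ω, ⨆ t ∈ Icc 0 T, ‖y t ω‖ₑ ^ 2 ∂P ≠ ∞ := (hsup.trans_lt ENNReal.ofReal_lt_top).ne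
  have he : 0 ≤ ∫ ω, ξ ω ^ 2 ∂P := integral_nonneg fun _ => sq_nonneg _
  have hq : 0 ≤ ∫ ω, (∫ u in Ioc 0 T, |ψ (u, ω)| ∂leb) ^ 2 ∂P :=
    integral_nonneg fun _ => sq_nonneg _
  have hU : 0 ≤ ∫ p, leftVersion T y p.swap ^ 2 ∂timeProd P 0 T :=
    integral_nonneg fun _ => sq_nonneg _
  have hW : 0 ≤ ∫ p, xNormSq A X p.2 p.1 (z p.2 p.1) ∂timeProd P 0 T := integral_nonneg hz0
  have hs := ENNReal.toReal_le_of_le_ofReal (by positivity) hsup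
  have hs0 : 0 ≤ (∫⁻ ω, ⨆ t ∈ Icc 0 T, ‖y t ω‖ₑ ^ 2 ∂P).toReal := ENNReal.toReal_nonneg
  have hE := H.energy_le hA hM (t := 0) zero_le
  have hE0 : 0 ≤ ∫ ω, y 0 ω ^ 2 ∂P := integral_nonneg fun _ => sq_nonneg _
  rw [← ENNReal.ofReal_toReal hfin, ← ENNReal.ofReal_add hs0 hW]
  refine ENNReal.ofReal_le_ofReal ?_
  exact closing_estimate hc he hq hs (H.integral_leftVersion_sq_le_gronwall hc hA hM)
    (by linarith) hs0 fun ε hε =>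
      H.interaction_le hε hs0 (ENNReal.ofReal_toReal hfin).symm

/-- The difference of two solutions of dominated backward equations. -/
theorem IsDominatedBSDE.sub {c₁ c₂ : ℝ} {ξ₁ ξ₂ : Ω → ℝ} {ψ₁ ψ₂ h₁ h₂ : ℝ≥0 × Ω → ℝ}
    {y₁ y₂ : ℝ≥0 → Ω → ℝ} {z₁ z₂ : ℝ≥0 → Ω → Fin N → ℝ}
    (H₁ : IsDominatedBSDE P A X hX T c₁ ξ₁ ψ₁ h₁ y₁ z₁)
    (H₂ : IsDominatedBSDE P A X hX T c₂ ξ₂ ψ₂ h₂ y₂ z₂)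
    (hA : IsRateMatrix A) (hM : IsMarkovChain P A X hX) (hψ : Measurable ψ)
    (hψ2 : MemLp (fun p => ψ p.swap) 2 (timeProd P 0 T))
    (hbound : ∀ᵐ ω ∂P, ∀ᵐ t ∂leb.restrict (Ioc 0 T),
      |h₁ (t, ω) - h₂ (t, ω)| ≤ |ψ (t, ω)| + c * |y₁ t ω - y₂ t ω|
        + c * xNorm A X t ω (z₁ t ω - z₂ t ω)) :
    IsDominatedBSDE P A X hX T c (fun ω => ξ₁ ω - ξ₂ ω) ψ (fun p => h₁ p - h₂ p)
      (fun t ω => y₁ t ω - y₂ t ω) (fun t ω => z₁ t ω - z₂ t ω) where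
  memLp_terminal := H₁.memLp_terminal.sub H₂.memLp_terminal
  adapted t ht := (H₁.adapted t ht).sub (H₂.adapted t ht)
  rcll ω := ⟨fun t ht => ((H₁.rcll ω).1 t ht).sub ((H₂.rcll ω).1 t ht), fun t ht => by
    obtain ⟨a, ha⟩ := (H₁.rcll ω).2 t ht
    obtain ⟨b, hb⟩ := (H₂.rcll ω).2 t ht
    exact ⟨a - b, ha.sub hb⟩⟩
  memLp_leftVersion := by
    simp_rw [leftVersion_sub H₁.rcll H₂.rcll]
    exact H₁.memLp_leftVersion.sub H₂.memLp_leftVersion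
  predictable_z := H₁.predictable_z.sub H₂.predictable_z
  integrable_xNormSq := by
    have hz := H₁.predictable_z.sub H₂.predictable_z
    -- State by state (a - b)² ≤ 2a² + 2b², in the representation of ‖·‖² with nonnegative rates.
    refine ((H₁.integrable_xNormSq.const_mul 2).add (H₂.integrable_xNormSq.const_mul 2)).mono'
      (hM.measurable_xNormSq hA (z := fun t ω => z₁ t ω - z₂ t ω) hz).aestronglyMeasurable
      (ae_of_all _ fun p => ?_)
    rw [Real.norm_eq_abs, abs_of_nonneg (hM.xNormSq_nonneg hA _ _ _), Pi.add_apply,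
      ← hM.sum_jumpRate_mul_jumpSize_sq (z := fun t ω => z₁ t ω - z₂ t ω) hA,
      ← hM.sum_jumpRate_mul_jumpSize_sq hA, ← hM.sum_jumpRate_mul_jumpSize_sq hA,
      Finset.mul_sum, Finset.mul_sum, ← Finset.sum_add_distrib]
    refine Finset.sum_le_sum fun j _ => ?_
    rw [jumpSize_sub]
    nlinarith [mul_nonneg (hM.jumpRate_nonneg hA j (p.2, p.1))
      (sq_nonneg (jumpSize X z₁ j (p.2, p.1) + jumpSize X z₂ j (p.2, p.1)))]
  measurable_source := hψ
  memLp_source := hψ2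
  measurable_integrand := H₁.measurable_integrand.sub H₂.measurable_integrand
  bound := hbound
  equation := by
    filter_upwards [H₁.equation, H₂.equation,
      integrableOn_Ioc ((H₁.memLp_integrand hA hM).integrable one_le_two),
      integrableOn_Ioc ((H₂.memLp_integrand hA hM).integrable one_le_two),
      integrableOn_Ioc (H₁.integrable_drift hA hM),
      integrableOn_Ioc (H₂.integrable_drift hA hM)] with ω e1 e2 i1 i2 d1 d2 t ht
    have hd : ∀ u, drift A X (fun t ω => z₁ t ω - z₂ t ω) (u, ω)
        = drift A X z₁ (u, ω) - drift A X z₂ (u, ω) := fun u => by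
      simp_rw [drift, jumpSize_sub, mul_sub, Finset.sum_sub_distrib]
    rw [e1 t ht, e2 t ht, hM.stochInt_eq hA, hM.stochInt_eq hA, hM.stochInt_eq hA,
      integral_sub (i1 t) (i2 t)]
    simp_rw [hd]
    -- Linearity of the pathwise stochastic integral holds almost surely only: it uses integrability
    -- of both drifts along the path.
    rw [integral_sub (d1 t) (d2 t)]
    simp_rw [sub_dotProduct, Finset.sum_sub_distrib]
    ring

end Estimate

/-! ### Solutions as dominated backward equations -/

/-- A process restricted to `[0,T]`, extended by zero. -/
noncomputable def onInterval {Ω E : Type*} [Zero E] (T : ℝ≥0) (u : ℝ≥0 → Ω → E) : ℝ≥0 × Ω → E :=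
  (Icc (0 : ℝ≥0) T ×ˢ (univ : Set Ω)).indicator fun p => u p.1 p.2

theorem onInterval_apply {Ω E : Type*} [Zero E] {T t : ℝ≥0} (u : ℝ≥0 → Ω → E) (ht : t ≤ T)
    (ω : Ω) : onInterval T u (t, ω) = u t ω :=
  indicator_of_mem (show (t, ω) ∈ Icc (0 : ℝ≥0) T ×ˢ (univ : Set Ω) from ⟨⟨zero_le, ht⟩, trivial⟩) _

/-- A driver restricted to `[0,T]`, extended by zero. -/
noncomputable def driverOn {Ω : Type*} {N : ℕ} (T : ℝ≥0) (f : ℝ≥0 → Ω → ℝ → (Fin N → ℝ) → ℝ) :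
    (ℝ≥0 × Ω) × (ℝ × (Fin N → ℝ)) → ℝ :=
  ((Icc (0 : ℝ≥0) T ×ˢ (univ : Set Ω)) ×ˢ (univ : Set (ℝ × (Fin N → ℝ)))).indicator
    fun p => f p.1.1 p.1.2 p.2.1 p.2.2

theorem driverOn_apply {Ω : Type*} {N : ℕ} {T t : ℝ≥0} (f : ℝ≥0 → Ω → ℝ → (Fin N → ℝ) → ℝ)
    (ht : t ≤ T) (ω : Ω) (a : ℝ) (b : Fin N → ℝ) : driverOn T f ((t, ω), (a, b)) = f t ω a b :=
  indicator_of_mem (show ((t, ω), (a, b)) ∈ (Icc (0 : ℝ≥0) T ×ˢ (univ : Set Ω)) ×ˢ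
    (univ : Set (ℝ × (Fin N → ℝ))) from ⟨⟨⟨zero_le, ht⟩, trivial⟩, trivial⟩) _

/-- The integrand `f(t, Y_{t-}, Z_t) + φ_t` on `[0,T]`. -/
noncomputable def backwardIntegrand {Ω : Type*} {N : ℕ} (T : ℝ≥0)
    (f : ℝ≥0 → Ω → ℝ → (Fin N → ℝ) → ℝ) (φ Y : ℝ≥0 → Ω → ℝ) (Z : ℝ≥0 → Ω → Fin N → ℝ)
    (p : ℝ≥0 × Ω) : ℝ :=
  driverOn T f (p, (leftVersion T Y p, onInterval T Z p)) + onInterval T φ p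

theorem ae_backwardIntegrand_eq {Ω : Type*} {N : ℕ} {T : ℝ≥0}
    {f : ℝ≥0 → Ω → ℝ → (Fin N → ℝ) → ℝ} {φ Y : ℝ≥0 → Ω → ℝ} {Z : ℝ≥0 → Ω → Fin N → ℝ} {ω : Ω}
    (hY : IsRCLLOn T fun t => Y t ω) : ∀ᵐ u ∂leb.restrict (Ioc 0 T),
      backwardIntegrand T f φ Y Z (u, ω) = f u ω (Y u ω) (Z u ω) + φ u ω := by
  filter_upwards [ae_leftVersion_eq hY, ae_restrict_mem measurableSet_Ioc] with u hu hm
  rw [backwardIntegrand, driverOn_apply f hm.2, hu, onInterval_apply Z hm.2,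
    onInterval_apply φ hm.2]

section Solution

variable {Ω : Type*} [mΩ : MeasurableSpace Ω] {N : ℕ} {P : Measure Ω}
  {A : ℝ≥0 → Matrix (Fin N) (Fin N) ℝ} {X : ℝ≥0 → Ω → Fin N → ℝ} {hX : ∀ t, Measurable (X t)}
  {T : ℝ≥0} {c' c'' : ℝ} {f : ℝ≥0 → Ω → ℝ → (Fin N → ℝ) → ℝ} {φ Y : ℝ≥0 → Ω → ℝ} {ξ : Ω → ℝ}
  {Z : ℝ≥0 → Ω → Fin N → ℝ}

theorem MemL2Terminal.memLp (hξ : MemL2Terminal P (completedFiltration P X hX) T ξ) :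
    MemLp ξ 2 P :=
  memLp_two_of_lintegral (hξ.measurable.mono ((completedFiltration P X hX).le T)
    le_rfl).aestronglyMeasurable hξ.sq_integrable

theorem memLp_onInterval [IsProbabilityMeasure P] {u : ℝ≥0 → Ω → ℝ} (hm : Measurable (onInterval T u))
    (hu : ∫⁻ ω, (∫⁻ t in Icc 0 T, ‖u t ω‖ₑ ^ 2 ∂leb) ∂P < ∞) :
    MemLp (fun p => onInterval T u p.swap) 2 (timeProd P 0 T) := by
  refine memLp_timeProd (hm.comp measurable_swap) (lt_of_le_of_lt (lintegral_mono fun ω => ?_) hu)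
  refine le_trans (le_of_eq ?_) (lintegral_mono_set Ioc_subset_Icc_self)
  refine setLIntegral_congr_fun measurableSet_Ioc fun t ht => ?_
  simp only [Prod.swap_prod_mk, onInterval_apply u ht.2]

theorem IsLipschitzDriver.measurable_comp {ℱ : Filtration ℝ≥0 mΩ}
    (hf : IsLipschitzDriver P ℱ A X T c' c'' f) {a : ℝ≥0 × Ω → ℝ} {b : ℝ≥0 × Ω → Fin N → ℝ}
    (ha : Measurable[ℱ.predictable] a) (hb : Measurable[ℱ.predictable] b) :
    Measurable[ℱ.predictable] fun p => driverOn T f (p, (a p, b p)) :=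
  hf.measurable.comp ((@measurable_id _ ℱ.predictable).prodMk (ha.prodMk hb))

/-- A solution of a Lipschitz backward equation solves a dominated backward equation. -/
theorem IsBSDESolution.isDominatedBSDE [IsProbabilityMeasure P] (hA : IsRateMatrix A)
    (hM : IsMarkovChain P A X hX)
    (hf : IsLipschitzDriver P (completedFiltration P X hX) A X T c' c'' f)
    (hξ : MemL2Terminal P (completedFiltration P X hX) T ξ)
    (hφ : IsPerturbation P (completedFiltration P X hX) T φ)
    (hS : IsBSDESolution P (completedFiltration P X hX) A X T f φ ξ Y Z) :
    IsDominatedBSDE P A X hX T (max c' c'') ξ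
      (fun p => |driverOn T f (p, (0, 0))| + |onInterval T φ p|)
      (backwardIntegrand T f φ Y Z) Y (fun t ω => onInterval T Z (t, ω)) := by
  have hle := predictable_le (completedFiltration P X hX)
  have hYl : Measurable[(completedFiltration P X hX).predictable] (leftVersion T Y) :=
    measurable_predictable_leftLim hS.memY.adapted fun ω => (hS.memY.rcll ω).2
  have hZ : Measurable[(completedFiltration P X hX).predictable] (onInterval T Z) :=
    hS.memZ.predictable
  have hf0 : Measurable fun p : ℝ≥0 × Ω => driverOn T f (p, (0, 0)) :=
    (hf.measurable_comp measurable_const measurable_const).mono hle le_rfl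
  have hφm : Measurable (onInterval T φ) := hφ.predictable.mono hle le_rfl
  have hf0L : MemLp (fun p : Ω × ℝ≥0 => driverOn T f (p.swap, (0, 0))) 2 (timeProd P 0 T) := by
    refine memLp_timeProd (hf0.comp measurable_swap)
      (lt_of_le_of_lt (lintegral_mono fun ω => ?_) hf.sq_integrable)
    refine le_trans (le_of_eq ?_) (lintegral_mono_set Ioc_subset_Icc_self)
    refine setLIntegral_congr_fun measurableSet_Ioc fun t ht => ?_
    simp only [Prod.swap_prod_mk, driverOn_apply f ht.2]
  refine ⟨hξ.memLp, hS.memY.adapted, hS.memY.rcll, hS.memY.memLp_leftVersion, hZ, ?_,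
    (continuous_abs.measurable.comp hf0).add (continuous_abs.measurable.comp hφm),
    hf0L.norm.add (memLp_onInterval hφm hφ.sq_integrable).norm, ?_, ?_, ?_⟩
  · have hm := hM.measurable_xNormSq hA (z := fun t ω => onInterval T Z (t, ω)) hZ
    refine ⟨hm.aestronglyMeasurable, ?_⟩
    rw [HasFiniteIntegral, timeProd, lintegral_prod _ hm.enorm.aemeasurable]
    refine lt_of_le_of_lt (lintegral_mono fun ω => ?_) hS.memZ.sq_integrable
    refine le_trans (le_of_eq ?_) (lintegral_mono_set Ioc_subset_Icc_self)
    refine setLIntegral_congr_fun measurableSet_Ioc fun t ht => ?_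
    simp only [onInterval_apply Z ht.2]
    rw [Real.enorm_of_nonneg (hM.xNormSq_nonneg hA _ _ _)]
  · exact ((hf.measurable_comp hYl hZ).mono hle le_rfl).add hφm
  · filter_upwards [hf.lipschitz] with ω hω
    filter_upwards [ae_backwardIntegrand_eq (f := f) (φ := φ) (Z := Z) (hS.memY.rcll ω),
      ae_restrict_mem measurableSet_Ioc] with u hu hm
    rw [hu, driverOn_apply f hm.2, onInterval_apply Z hm.2, onInterval_apply φ hm.2]
    -- Comparison with the point (0,0) produces the source |f(·,0,0)| + |φ|.
    have h1 := hω u hm.2 (Y u ω) 0 (Z u ω) 0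
    rw [sub_zero, sub_zero] at h1
    have h2 := mul_le_mul_of_nonneg_right (le_max_left c' c'') (abs_nonneg (Y u ω))
    have h3 := mul_le_mul_of_nonneg_right (le_max_right c' c'')
      (Real.sqrt_nonneg (xNormSq A X u ω (Z u ω)))
    have h4 : |f u ω (Y u ω) (Z u ω)| ≤ |f u ω 0 0| + |f u ω (Y u ω) (Z u ω) - f u ω 0 0| := by
      have := abs_add_le (f u ω 0 0) (f u ω (Y u ω) (Z u ω) - f u ω 0 0)
      rwa [add_sub_cancel] at this
    have h5 := abs_add_le (f u ω (Y u ω) (Z u ω)) (φ u ω)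
    rw [abs_of_nonneg (by positivity : 0 ≤ |f u ω 0 0| + |φ u ω|)]
    unfold xNorm at h1 ⊢
    linarith
  · filter_upwards [hS.equation] with ω hω t ht
    rw [hω t ht]
    congr 1
    · congr 1
      refine integral_congr_ae ?_
      filter_upwards [ae_mono (Measure.restrict_mono (Ioc_subset_Ioc_left zero_le) le_rfl)
        (ae_backwardIntegrand_eq (f := f) (φ := φ) (Z := Z) (hS.memY.rcll ω))] with u hu
      exact hu.symm
    · rw [stochInt, stochInt]
      congr 1
      · exact finsum_mem_congr rfl fun u hu => by rw [onInterval_apply Z hu.2]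
      · exact setIntegral_congr_fun measurableSet_Ioc fun u hu => by
          simp only [onInterval_apply Z hu.2]

/-- The difference of two solutions with perturbed data. -/
theorem IsBSDESolution.isDominatedBSDE_sub [IsProbabilityMeasure P] (hA : IsRateMatrix A)
    (hM : IsMarkovChain P A X hX)
    (hf : IsLipschitzDriver P (completedFiltration P X hX) A X T c' c'' f)
    {ξ₁ ξ₂ : Ω → ℝ} {φ₁ φ₂ Y₁ Y₂ : ℝ≥0 → Ω → ℝ} {Z₁ Z₂ : ℝ≥0 → Ω → Fin N → ℝ}
    (hξ₁ : MemL2Terminal P (completedFiltration P X hX) T ξ₁)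
    (hξ₂ : MemL2Terminal P (completedFiltration P X hX) T ξ₂)
    (hφ₁ : IsPerturbation P (completedFiltration P X hX) T φ₁)
    (hφ₂ : IsPerturbation P (completedFiltration P X hX) T φ₂)
    (hS₁ : IsBSDESolution P (completedFiltration P X hX) A X T f φ₁ ξ₁ Y₁ Z₁)
    (hS₂ : IsBSDESolution P (completedFiltration P X hX) A X T f φ₂ ξ₂ Y₂ Z₂) :
    IsDominatedBSDE P A X hX T (max c' c'') (fun ω => ξ₁ ω - ξ₂ ω)
      (fun p => onInterval T φ₁ p - onInterval T φ₂ p)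
      (fun p => backwardIntegrand T f φ₁ Y₁ Z₁ p - backwardIntegrand T f φ₂ Y₂ Z₂ p)
      (fun t ω => Y₁ t ω - Y₂ t ω) (fun t ω => onInterval T Z₁ (t, ω) - onInterval T Z₂ (t, ω)) := by
  have hle := predictable_le (completedFiltration P X hX)
  have hm₁ : Measurable (onInterval T φ₁) := hφ₁.predictable.mono hle le_rfl
  have hm₂ : Measurable (onInterval T φ₂) := hφ₂.predictable.mono hle le_rfl
  refine (hS₁.isDominatedBSDE hA hM hf hξ₁ hφ₁).sub (hS₂.isDominatedBSDE hA hM hf hξ₂ hφ₂) hA hM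
    (hm₁.sub hm₂) ((memLp_onInterval hm₁ hφ₁.sq_integrable).sub
      (memLp_onInterval hm₂ hφ₂.sq_integrable)) ?_
  filter_upwards [hf.lipschitz] with ω hω
  filter_upwards [ae_backwardIntegrand_eq (f := f) (φ := φ₁) (Z := Z₁) (hS₁.memY.rcll ω),
    ae_backwardIntegrand_eq (f := f) (φ := φ₂) (Z := Z₂) (hS₂.memY.rcll ω),
    ae_restrict_mem measurableSet_Ioc] with u h₁ h₂ hm
  rw [h₁, h₂, onInterval_apply φ₁ hm.2, onInterval_apply φ₂ hm.2, onInterval_apply Z₁ hm.2,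
    onInterval_apply Z₂ hm.2]
  -- Comparing the two solutions directly, the values of f at (0,0) disappear and only the
  -- difference of the perturbations remains as source.
  have k1 := hω u hm.2 (Y₁ u ω) (Y₂ u ω) (Z₁ u ω) (Z₂ u ω)
  have k2 := mul_le_mul_of_nonneg_right (le_max_left c' c'') (abs_nonneg (Y₁ u ω - Y₂ u ω))
  have k3 := mul_le_mul_of_nonneg_right (le_max_right c' c'')
    (Real.sqrt_nonneg (xNormSq A X u ω (Z₁ u ω - Z₂ u ω)))
  have k4 := abs_add_le (φ₁ u ω - φ₂ u ω) (f u ω (Y₁ u ω) (Z₁ u ω) - f u ω (Y₂ u ω) (Z₂ u ω))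
  rw [show φ₁ u ω - φ₂ u ω + (f u ω (Y₁ u ω) (Z₁ u ω) - f u ω (Y₂ u ω) (Z₂ u ω))
    = f u ω (Y₁ u ω) (Z₁ u ω) + φ₁ u ω - (f u ω (Y₂ u ω) (Z₂ u ω) + φ₂ u ω) by ring] at k4
  unfold xNorm at k1 ⊢
  linarith

end Solution

end MarkovBSDE

/-! ### The stability estimate. -/

theorem proposition4p2 (c : ℝ) (T : ℝ≥0) :
    ∃ C : ℝ, 0 < C ∧
      ∀ {Ω : Type*} [MeasurableSpace Ω] (P : Measure Ω) [IsProbabilityMeasure P] (N : ℕ)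
        (A : ℝ≥0 → Matrix (Fin N) (Fin N) ℝ) (_ : MarkovBSDE.IsRateMatrix A)
        (X : ℝ≥0 → Ω → Fin N → ℝ) (hX : ∀ t, Measurable (X t))
        (_ : MarkovBSDE.IsMarkovChain P A X hX)
        (c' c'' : ℝ) (_ : 0 ≤ c') (_ : 0 ≤ c'') (_ : max c' c'' = c)
        (f : ℝ≥0 → Ω → ℝ → (Fin N → ℝ) → ℝ)
        (_ : MarkovBSDE.IsLipschitzDriver P (MarkovBSDE.completedFiltration P X hX) A X T c' c'' f)
        (ξ₁ ξ₂ : Ω → ℝ)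
        (_ : MarkovBSDE.MemL2Terminal P (MarkovBSDE.completedFiltration P X hX) T ξ₁)
        (_ : MarkovBSDE.MemL2Terminal P (MarkovBSDE.completedFiltration P X hX) T ξ₂)
        (φ₁ φ₂ : ℝ≥0 → Ω → ℝ)
        (_ : MarkovBSDE.IsPerturbation P (MarkovBSDE.completedFiltration P X hX) T φ₁)
        (_ : MarkovBSDE.IsPerturbation P (MarkovBSDE.completedFiltration P X hX) T φ₂)
        (Y₁ Y₂ : ℝ≥0 → Ω → ℝ) (Z₁ Z₂ : ℝ≥0 → Ω → Fin N → ℝ)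
        (_ : MarkovBSDE.IsBSDESolution P (MarkovBSDE.completedFiltration P X hX) A X T
          f φ₁ ξ₁ Y₁ Z₁)
        (_ : MarkovBSDE.IsBSDESolution P (MarkovBSDE.completedFiltration P X hX) A X T
          f φ₂ ξ₂ Y₂ Z₂),
        ∫⁻ ω, ((⨆ t ∈ Icc 0 T, ‖Y₁ t ω - Y₂ t ω‖ₑ ^ 2) +
            ∫⁻ t in Icc 0 T,
              ENNReal.ofReal (MarkovBSDE.xNormSq A X t ω (Z₁ t ω - Z₂ t ω)) ∂MarkovBSDE.leb) ∂P
          ≤ ENNReal.ofReal C *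
            ∫⁻ ω, (‖ξ₁ ω - ξ₂ ω‖ₑ ^ 2 + (∫⁻ t in Icc 0 T, ‖φ₁ t ω - φ₂ t ω‖ₑ ∂MarkovBSDE.leb) ^ 2) ∂P := by
  -- The absolute value gives a positive constant for every real c, chosen before any data; as soon
  -- as c is a maximum of nonnegative constants it changes nothing.
  refine ⟨MarkovBSDE.estimateConst |c| T, MarkovBSDE.estimateConst_pos (abs_nonneg c) T, ?_⟩
  intro Ω _ P _ N A hA X hX hM c' c'' hc' _ hc f hf ξ₁ ξ₂ hξ₁ hξ₂ φ₁ φ₂ hφ₁ hφ₂ Y₁ Y₂ Z₁ Z₂ hS₁ hS₂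
  have hc0 : 0 ≤ c := hc ▸ hc'.trans (le_max_left _ _)
  have H := hS₁.isDominatedBSDE_sub hA hM hf hξ₁ hξ₂ hφ₁ hφ₂ hS₂
  rw [hc] at H
  have h := H.estimate hc0 hA hM
  rw [abs_of_nonneg hc0]
  have e1 : ∀ ω, ∫⁻ t in Icc 0 T, ENNReal.ofReal (MarkovBSDE.xNormSq A X t ω
      (MarkovBSDE.onInterval T Z₁ (t, ω) - MarkovBSDE.onInterval T Z₂ (t, ω))) ∂MarkovBSDE.leb
      = ∫⁻ t in Icc 0 T, ENNReal.ofReal (MarkovBSDE.xNormSq A X t ω (Z₁ t ω - Z₂ t ω))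
        ∂MarkovBSDE.leb := fun ω =>
    setLIntegral_congr_fun measurableSet_Icc fun t ht => by
      simp only [MarkovBSDE.onInterval_apply _ ht.2]
  have e2 : ∀ ω, ∫⁻ t in Icc 0 T, ‖MarkovBSDE.onInterval T φ₁ (t, ω)
      - MarkovBSDE.onInterval T φ₂ (t, ω)‖ₑ ∂MarkovBSDE.leb
      = ∫⁻ t in Icc 0 T, ‖φ₁ t ω - φ₂ t ω‖ₑ ∂MarkovBSDE.leb := fun ω =>
    setLIntegral_congr_fun measurableSet_Icc fun t ht => by
      simp only [MarkovBSDE.onInterval_apply _ ht.2]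
  simp_rw [e1, e2] at h
  exact h
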